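/- Let $\Omega\subset\mathbb C^n$ be a bounded pseudoconvex domain with smooth boundary $b\Omega$, let $r$ be the signed distance to $b\Omega$, let $B$ be the Bergman projection (the orthogonal projection of $L^2(\Omega)$ onto the subspace of holomorphic functions), and let $\mathcal B(z,w)$ be the Bergman kernel, $Bv(z)=\int_\Omega\mathcal B(z,w)v(w)\,dw$. For $\chi,\chi'\in C^\infty_c(\mathbb C^n)$ write $\chi\prec\chi'$ if $\chi'=1$ on $\operatorname{supp}\chi$. Let $L^2_s(\Omega)$, $s\ge 0$, be the $L^2$-Sobolev space of order $s$, and let $L^2_{-m}(\Omega)$, $m\ge 0$, be the dual of the closure of $C_c^\infty(\Omega)$ in $L^2_m(\Omega)$. Assume that $\Omega$ satisfies local Condition R at $z_0\in b\Omega$ with the open neighborhood $U$ of $z_0$: for all $s,m\ge 0$ there is $M=M_{s,m}$ such that for all real-valued $\chi_1,\chi_2,\chi_3\in C^\infty_c(U)$ with $\chi_1\prec\chi_2\prec\chi_3$ there is a constant $c$ with $$\|\chi_1Bu\|^2_{L^2_s(\Omega)}\le c\Big(\|\chi_2u\|^2_{L^2_{s+M}(\Omega)}+\|\chi_3Bu\|^2_{L^2_{-m}(\Omega)}+\|u\|^2_{L^2(\Omega)}\Big)$$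 for every $u\in L^2_{s+M}(U\cap\Omega)\cap L^2(\Omega)$ (the left side being finite whenever the right side is). **Theorem 2.1.** Under these assumptions: 1. The Bergman kernel is smooth on $$S=\big((\overline\Omega\cap U)\times(\overline\Omega\cap U)\big)\setminus\{(z,z):z\in b\Omega\cap U\},$$ that is, its restriction to $(\Omega\cap U)\times(\Omega\cap U)$ extends to a $C^\infty$ function on $S$ (smooth up to the boundary), again denoted by $\mathcal B$. 2. For every open $V$ with $\overline V\subset U$, every $\varepsilon>0$ and all multi-indices $\alpha,\beta$ there is a constant $c_{\alpha,\beta,V,\varepsilon}$ such that $$|D^\alpha_zD^\beta_{\bar w}\mathcal B(z,w)|\le c_{\alpha,\beta,V,\varepsilon}$$ for all $z,w\in\overline\Omega\cap V$ whose isotropic distance satisfies $\max\{|r(z)|,|r(w)|,|z-w|\}\ge\varepsilon$. -/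

import Mathlib

open MeasureTheory Set Filter Topology
open scoped ENNReal NNReal ContDiff ComplexConjugate

/-- Complex `n`-space with its Euclidean norm; `volume` is Lebesgue measure on `ℝ²ⁿ`. -/
abbrev CSpace (n : ℕ) := EuclideanSpace ℂ (Fin n)

/-- Restriction of a holomorphic function to a complex line. -/
theorem diffContOnCl_slice {n : ℕ} {Ω : Set (CSpace n)} {g : CSpace n → ℂ}
    (hΩ : IsOpen Ω) (hg : DifferentiableOn ℂ g Ω) (z v : CSpace n) {R : ℝ}
    (h : ∀ t : ℂ, ‖t‖ ≤ R → z + t • v ∈ Ω) :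
    DiffContOnCl ℂ (fun t : ℂ => g (z + t • v)) (Metric.ball 0 R) := by
  have : DifferentiableOn ℂ (fun t : ℂ => g (z + t • v)) (Metric.closedBall 0 R) := by
    intro t ht
    have h1 : DifferentiableAt ℂ g (z + t • v) :=
      hg.differentiableAt (hΩ.mem_nhds (h t (by simpa using ht)))
    have h2 : DifferentiableAt ℂ (fun t : ℂ => z + t • v) t := by fun_prop
    exact (DifferentiableAt.comp (g := g) t h1 h2).differentiableWithinAt
  exact (this.mono Metric.closure_ball_subset_closedBall).diffContOnCl

/-- The mean value inequality for holomorphic functions of several variables. -/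
theorem holomorphic_norm_le_lintegral {n : ℕ} {Ω : Set (CSpace n)} {g : CSpace n → ℂ}
    (hΩ : IsOpen Ω) (hg : DifferentiableOn ℂ g Ω) (z : CSpace n) {r : ℝ}
    (h : Metric.closedBall z r ⊆ Ω) :
    volume (Metric.ball (0 : CSpace n) r) * ‖g z‖ₑ ≤ ∫⁻ x in Ω, ‖g x‖ₑ := by
  have hmem : ∀ v ∈ Metric.ball (0 : CSpace n) r, ∀ t : ℂ, ‖t‖ ≤ 1 → z + t • v ∈ Ω := by
    intro v hv t ht
    apply h
    simp only [Metric.mem_closedBall, dist_self_add_left, norm_smul]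
    have : ‖v‖ < r := by simpa using hv
    nlinarith [norm_nonneg v, norm_nonneg t]
  set μ : Measure ℝ := volume.restrict (Ioc 0 (2 * Real.pi))
  have hμ : μ univ = ENNReal.ofReal (2 * Real.pi) := by simp [μ]
  have hμ0 : μ univ ≠ 0 := by rw [hμ]; simp [Real.pi_pos]
  have hμt : μ univ ≠ ⊤ := by rw [hμ]; exact ENNReal.ofReal_ne_top
  -- pointwise mean value inequality on slices
  have h1 : ∀ v ∈ Metric.ball (0 : CSpace n) r,
      μ univ * ‖g z‖ₑ ≤ ∫⁻ θ, ‖g (z + circleMap 0 1 θ • v)‖ₑ ∂μ := by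
    intro v hv
    have hd := diffContOnCl_slice hΩ hg z v (hmem v hv)
    have hca := DiffContOnCl.circleAverage (R := 1) (c := 0)
      (f := fun t : ℂ => g (z + t • v)) (by simpa using hd)
    simp only [zero_smul, add_zero] at hca
    rw [← hca, Real.circleAverage_def, enorm_smul,
      intervalIntegral.integral_of_le (by positivity), hμ]
    calc _ ≤ ENNReal.ofReal (2 * Real.pi) * (‖(2 * Real.pi)⁻¹‖ₑ *
          ∫⁻ θ, ‖g (z + circleMap 0 1 θ • v)‖ₑ ∂μ) := by
          gcongr; exact enorm_integral_le_lintegral_enorm _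
      _ = _ := by
          rw [← mul_assoc, Real.enorm_of_nonneg (by positivity),
            ← ENNReal.ofReal_mul (by positivity), mul_inv_cancel₀ (by positivity)]
          simp
  -- integrate over the ball and exchange
  have hcont : ContinuousOn (fun p : CSpace n × ℝ => g (z + circleMap 0 1 p.2 • p.1))
      (Metric.ball (0 : CSpace n) r ×ˢ univ) := by
    refine hg.continuousOn.comp (by fun_prop) ?_
    rintro ⟨v, θ⟩ ⟨hv, -⟩
    exact hmem v hv _ (by simp)
  have hmeas : AEMeasurable (fun p : CSpace n × ℝ => ‖g (z + circleMap 0 1 p.2 • p.1)‖ₑ)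
      ((volume.restrict (Metric.ball (0 : CSpace n) r)).prod μ) := by
    have := hcont.aemeasurable (μ := (volume : Measure (CSpace n)).prod μ)
      (Metric.isOpen_ball.measurableSet.prod MeasurableSet.univ)
    rw [← Measure.prod_restrict, Measure.restrict_univ] at this
    exact this.enorm
  have h2 : μ univ * (volume (Metric.ball (0 : CSpace n) r) * ‖g z‖ₑ)
      ≤ μ univ * ∫⁻ x in Ω, ‖g x‖ₑ := by
    calc μ univ * (volume (Metric.ball (0 : CSpace n) r) * ‖g z‖ₑ)
        = ∫⁻ v in Metric.ball (0 : CSpace n) r, μ univ * ‖g z‖ₑ := by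
          rw [setLIntegral_const]; ring
      _ ≤ ∫⁻ v in Metric.ball (0 : CSpace n) r,
            ∫⁻ θ, ‖g (z + circleMap 0 1 θ • v)‖ₑ ∂μ :=
          setLIntegral_mono' Metric.isOpen_ball.measurableSet h1
      _ = ∫⁻ θ, (∫⁻ v in Metric.ball (0 : CSpace n) r,
            ‖g (z + circleMap 0 1 θ • v)‖ₑ) ∂μ := lintegral_lintegral_swap hmeas
      _ ≤ ∫⁻ θ, (∫⁻ x in Ω, ‖g x‖ₑ) ∂μ := by
          refine lintegral_mono fun θ => ?_
          let e : CSpace n ≃ₗᵢ[ℝ] CSpace n := 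
            { (LinearEquiv.smulOfNeZero ℂ (CSpace n) (circleMap 0 1 θ) (by simp)).restrictScalars ℝ with
              norm_map' := fun v => by
                simp [norm_smul] }
          have he : ∀ v, e v = circleMap 0 1 θ • v := fun v => rfl
          have hmp : MeasurePreserving (fun v => z + e v) (volume : Measure (CSpace n)) volume :=
            (measurePreserving_add_left volume z).comp e.measurePreserving
          have hemb : MeasurableEmbedding (fun v => z + e v) :=
            (measurableEmbedding_addLeft z).comp e.toHomeomorph.measurableEmbedding
          have hsub : Metric.ball (0 : CSpace n) r ⊆ (fun v => z + e v) ⁻¹' Ω := by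
            intro v hv; exact hmem v hv _ (by simp)
          calc _ ≤ ∫⁻ v in (fun v => z + e v) ⁻¹' Ω, ‖g (z + e v)‖ₑ :=
                lintegral_mono_set hsub
            _ = _ := hmp.setLIntegral_comp_preimage_emb hemb (fun x => ‖g x‖ₑ) Ω
      _ = μ univ * ∫⁻ x in Ω, ‖g x‖ₑ := by simp [mul_comm]
  exact (ENNReal.mul_le_mul_iff_right hμ0 hμt).1 h2

/-- Point values of holomorphic functions are controlled by the `L²` norm. -/
theorem holomorphic_norm_le_eLpNorm {n : ℕ} {r : ℝ} (hr : 0 < r) :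
    ∃ C : ℝ, 0 ≤ C ∧ ∀ (Ω : Set (CSpace n)) (g : CSpace n → ℂ) (z : CSpace n), IsOpen Ω →
      DifferentiableOn ℂ g Ω → MemLp g 2 (volume.restrict Ω) → Metric.ball z r ⊆ Ω →
      ‖g z‖ ≤ C * (eLpNorm g 2 (volume.restrict Ω)).toReal := by
  set A := volume (Metric.ball (0 : CSpace n) (r / 2)) with hA
  set B := volume (Metric.ball (0 : CSpace n) r) with hB
  have hA0 : A ≠ 0 := (Metric.measure_ball_pos volume _ (by positivity)).ne'
  have hAt : A ≠ ⊤ := measure_ball_lt_top.ne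
  have hBt : B ≠ ⊤ := measure_ball_lt_top.ne
  refine ⟨A.toReal⁻¹ * (B ^ (1 / 2 : ℝ)).toReal, by positivity, ?_⟩
  intro Ω g z hΩ hg hL hball
  have h1 := holomorphic_norm_le_lintegral (Ω := Metric.ball z r) Metric.isOpen_ball (hg.mono hball) z
    (r := r / 2) (Metric.closedBall_subset_ball (by linarith))
  have h2 : ∫⁻ x in Metric.ball z r, ‖g x‖ₑ ≤ eLpNorm g 2 (volume.restrict Ω) * B ^ (1 / 2 : ℝ) := by
    have hm : AEStronglyMeasurable g (volume.restrict (Metric.ball z r)) :=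
      hL.1.mono_measure (Measure.restrict_mono_set _ hball)
    have := eLpNorm_le_eLpNorm_mul_rpow_measure_univ (μ := volume.restrict (Metric.ball z r))
      (p := 1) (q := 2) (by norm_num) hm
    rw [eLpNorm_one_eq_lintegral_enorm] at this
    refine this.trans ?_
    rw [Measure.restrict_apply_univ, Measure.addHaar_ball_center]
    norm_num
    gcongr
  have h3 := h1.trans h2
  have h4 := ENNReal.toReal_mono (by finiteness [hL.2.ne]) h3
  rw [ENNReal.toReal_mul, ENNReal.toReal_mul, toReal_enorm] at h4
  have hA1 : 0 < A.toReal := ENNReal.toReal_pos hA0 hAt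
  rw [mul_assoc, le_inv_mul_iff₀ hA1, mul_comm (B ^ (1 / 2 : ℝ)).toReal]
  exact h4

/-- The Bergman space of `Ω`: the classes in `L²(Ω)` that have a holomorphic representative. -/
noncomputable def bergmanSpace {n : ℕ} (Ω : TopologicalSpace.Opens (CSpace n)) :
    Submodule ℂ (Lp ℂ 2 (volume.restrict (Ω : Set (CSpace n)))) where
  carrier := {f | ∃ g : CSpace n → ℂ, DifferentiableOn ℂ g Ω ∧
    f =ᵐ[volume.restrict (Ω : Set (CSpace n))] g}
  zero_mem' := ⟨0, differentiableOn_const 0, Lp.coeFn_zero _ _ _⟩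
  add_mem' := by
    rintro f₁ f₂ ⟨g₁, h₁, e₁⟩ ⟨g₂, h₂, e₂⟩
    exact ⟨g₁ + g₂, h₁.add h₂, (Lp.coeFn_add f₁ f₂).trans (e₁.add e₂)⟩
  smul_mem' := by
    rintro c f ⟨g, h, e⟩
    exact ⟨c • g, h.const_smul c, (Lp.coeFn_smul c f).trans (e.const_smul c)⟩

/-- The holomorphic representative of an element of the Bergman space (its values on `Ω` are
uniquely determined). -/
noncomputable def holRep {n : ℕ} {Ω : TopologicalSpace.Opens (CSpace n)} (f : bergmanSpace Ω) :
    CSpace n → ℂ := Classical.choose f.2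

theorem holRep_diff {n : ℕ} {Ω : TopologicalSpace.Opens (CSpace n)} (f : bergmanSpace Ω) :
    DifferentiableOn ℂ (holRep f) Ω := (Classical.choose_spec f.2).1

theorem holRep_ae {n : ℕ} {Ω : TopologicalSpace.Opens (CSpace n)} (f : bergmanSpace Ω) :
    (f : Lp ℂ 2 (volume.restrict (Ω : Set (CSpace n)))) 
      =ᵐ[volume.restrict (Ω : Set (CSpace n))] holRep f := (Classical.choose_spec f.2).2

theorem eqOn_of_ae {n : ℕ} {Ω : TopologicalSpace.Opens (CSpace n)} {g₁ g₂ : CSpace n → ℂ}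
    (h₁ : DifferentiableOn ℂ g₁ Ω) (h₂ : DifferentiableOn ℂ g₂ Ω)
    (h : g₁ =ᵐ[volume.restrict (Ω : Set (CSpace n))] g₂) : EqOn g₁ g₂ Ω :=
  Measure.eqOn_open_of_ae_eq h Ω.isOpen h₁.continuousOn h₂.continuousOn

theorem norm_holRep_le {n : ℕ} {r : ℝ} (hr : 0 < r) :
    ∃ C : ℝ, 0 ≤ C ∧ ∀ (Ω : TopologicalSpace.Opens (CSpace n)) (f : bergmanSpace Ω) (z : CSpace n),
      Metric.ball z r ⊆ Ω → ‖holRep f z‖ ≤ C * ‖f‖ := by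
  obtain ⟨C, hC, h⟩ := holomorphic_norm_le_eLpNorm (n := n) hr
  refine ⟨C, hC, fun Ω f z hz => ?_⟩
  have hm : MemLp (holRep f) 2 (volume.restrict (Ω : Set (CSpace n))) :=
    (memLp_congr_ae (holRep_ae f)).1 (Lp.memLp _)
  have := h Ω (holRep f) z Ω.isOpen (holRep_diff f) hm hz
  rwa [← eLpNorm_congr_ae (holRep_ae f), ← Lp.norm_def] at this

theorem holRep_add {n : ℕ} {Ω : TopologicalSpace.Opens (CSpace n)} (f g : bergmanSpace Ω) :
    EqOn (holRep (f + g)) (holRep f + holRep g) Ω :=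
  eqOn_of_ae (holRep_diff _) ((holRep_diff f).add (holRep_diff g))
    ((holRep_ae _).symm.trans ((Lp.coeFn_add _ _).trans ((holRep_ae f).add (holRep_ae g))))

theorem holRep_smul {n : ℕ} {Ω : TopologicalSpace.Opens (CSpace n)} (c : ℂ) (f : bergmanSpace Ω) :
    EqOn (holRep (c • f)) (c • holRep f) Ω :=
  eqOn_of_ae (holRep_diff _) ((holRep_diff f).const_smul c)
    ((holRep_ae _).symm.trans ((Lp.coeFn_smul _ _).trans ((holRep_ae f).const_smul c)))

theorem holRep_sub {n : ℕ} {Ω : TopologicalSpace.Opens (CSpace n)} (f g : bergmanSpace Ω) :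
    EqOn (holRep (f - g)) (holRep f - holRep g) Ω :=
  eqOn_of_ae (holRep_diff _) ((holRep_diff f).sub (holRep_diff g))
    ((holRep_ae _).symm.trans ((Lp.coeFn_sub _ _).trans ((holRep_ae f).sub (holRep_ae g))))

theorem norm_fderiv_holRep_le {n : ℕ} {r : ℝ} (hr : 0 < r) :
    ∃ C : ℝ, 0 ≤ C ∧ ∀ (Ω : TopologicalSpace.Opens (CSpace n)) (f : bergmanSpace Ω) (z : CSpace n),
      Metric.ball z r ⊆ Ω → ‖fderiv ℂ (holRep f) z‖ ≤ C * ‖f‖ := by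
  obtain ⟨C, hC, h⟩ := norm_holRep_le (n := n) (half_pos hr)
  refine ⟨C / (r / 4), by positivity, fun Ω f z hz => ?_⟩
  refine ContinuousLinearMap.opNorm_le_of_unit_norm (by positivity) fun v hv => ?_
  have hmem : ∀ t : ℂ, ‖t‖ ≤ r / 4 → Metric.ball (z + t • v) (r / 2) ⊆ Ω := by
    intro t ht
    refine (Metric.ball_subset_ball' ?_).trans hz
    simp only [dist_self_add_left, norm_smul, hv]; linarith
  have hin : ∀ t : ℂ, ‖t‖ ≤ r / 4 → z + t • v ∈ (Ω : Set (CSpace n)) := fun t ht =>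
    hmem t ht (Metric.mem_ball_self (by positivity))
  have hd := diffContOnCl_slice Ω.isOpen (holRep_diff f) z v hin
  have hz' : z ∈ (Ω : Set (CSpace n)) := hz (Metric.mem_ball_self hr)
  have hb := Complex.norm_deriv_le_of_forall_mem_sphere_norm_le (by positivity) hd
    (C := C * ‖f‖) (fun t ht => h Ω f _ (hmem t (by simpa using ht.le)))
  have hder : deriv (fun t : ℂ => holRep f (z + t • v)) 0 = fderiv ℂ (holRep f) z v := by
    have h1 : HasFDerivAt (holRep f) (fderiv ℂ (holRep f) z) (z + (0 : ℂ) • v) := by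
      simpa using ((holRep_diff f).differentiableAt (Ω.isOpen.mem_nhds hz')).hasFDerivAt
    have h2 : HasDerivAt (fun t : ℂ => z + t • v) v 0 := by
      simpa using ((hasDerivAt_id (0 : ℂ)).smul_const v).const_add z
    exact (h1.comp_hasDerivAt (0 : ℂ) h2).deriv
  rw [hder] at hb
  calc _ ≤ _ := hb
    _ = _ := by ring

/-- The Bergman space is a closed subspace of `L²(Ω)`. -/
theorem isClosed_bergmanSpace {n : ℕ} (Ω : TopologicalSpace.Opens (CSpace n)) :
    IsClosed (bergmanSpace Ω : Set (Lp ℂ 2 (volume.restrict (Ω : Set (CSpace n))))) := by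
  refine isClosed_of_closure_subset fun f hf => ?_
  obtain ⟨F, hF, hlim⟩ := mem_closure_iff_seq_limit.1 hf
  let G : ℕ → bergmanSpace Ω := fun k => ⟨F k, hF k⟩
  have hcau : CauchySeq G := by
    have : CauchySeq F := hlim.cauchySeq
    rw [Metric.cauchySeq_iff] at this ⊢
    exact this
  -- pointwise limits
  have hpt : ∀ z : CSpace n, ∃ a : ℂ, z ∈ (Ω : Set (CSpace n)) →
      Tendsto (fun k => holRep (G k) z) atTop (𝓝 a) := by
    intro z
    by_cases hz : z ∈ (Ω : Set (CSpace n))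
    · obtain ⟨r, hr, hball⟩ := Metric.isOpen_iff.1 Ω.isOpen z hz
      obtain ⟨C, hC, h⟩ := norm_holRep_le (n := n) hr
      have : CauchySeq (fun k => holRep (G k) z) := by
        rw [Metric.cauchySeq_iff] at hcau ⊢
        intro ε hε
        obtain ⟨N, hN⟩ := hcau (ε / (C + 1)) (by positivity)
        refine ⟨N, fun k hk l hl => ?_⟩
        have h1 := h Ω (G k - G l) z hball
        rw [holRep_sub _ _ hz] at h1
        have h2 := hN k hk l hl
        rw [dist_eq_norm] at h2 ⊢
        rw [lt_div_iff₀ (by positivity)] at h2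
        simp only [Pi.sub_apply] at h1
        nlinarith [norm_nonneg (G k - G l)]
      obtain ⟨a, ha⟩ := cauchySeq_tendsto_of_complete this
      exact ⟨a, fun _ => ha⟩
    · exact ⟨0, fun h => absurd h hz⟩
  choose g hg using hpt
  refine ⟨g, ?_, ?_⟩
  · intro z hz
    obtain ⟨r, hr, hball⟩ := Metric.isOpen_iff.1 Ω.isOpen z hz
    obtain ⟨C, hC, h⟩ := norm_fderiv_holRep_le (n := n) (half_pos hr)
    have hsub : ∀ x ∈ Metric.ball z (r / 2), Metric.ball x (r / 2) ⊆ Ω := by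
      intro x hx
      refine (Metric.ball_subset_ball' ?_).trans hball
      have : dist x z < r / 2 := hx
      linarith
    have hin : ∀ x ∈ Metric.ball z (r / 2), x ∈ (Ω : Set (CSpace n)) := fun x hx =>
      hsub x hx (Metric.mem_ball_self (by positivity))
    have hda : ∀ k, ∀ x ∈ Metric.ball z (r / 2), DifferentiableAt ℂ (holRep (G k)) x :=
      fun k x hx => (holRep_diff (G k)).differentiableAt (Ω.isOpen.mem_nhds (hin x hx))
    have huc : UniformCauchySeqOn (fun k => fderiv ℂ (holRep (G k))) atTop
        (Metric.ball z (r / 2)) := by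
      rw [Metric.uniformCauchySeqOn_iff]
      rw [Metric.cauchySeq_iff] at hcau
      intro ε hε
      obtain ⟨N, hN⟩ := hcau (ε / (C + 1)) (by positivity)
      refine ⟨N, fun k hk l hl x hx => ?_⟩
      have h1 := h Ω (G k - G l) x (hsub x hx)
      have heq : holRep (G k - G l) =ᶠ[𝓝 x] holRep (G k) - holRep (G l) :=
        (holRep_sub (G k) (G l)).eventuallyEq_of_mem (Ω.isOpen.mem_nhds (hin x hx))
      rw [heq.fderiv_eq, fderiv_sub (hda k x hx) (hda l x hx)] at h1
      have h2 := hN k hk l hl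
      rw [dist_eq_norm] at h2 ⊢
      rw [lt_div_iff₀ (by positivity)] at h2
      nlinarith [norm_nonneg (G k - G l)]
    have hlimd : ∀ x, ∃ L : CSpace n →L[ℂ] ℂ, x ∈ Metric.ball z (r / 2) →
        Tendsto (fun k => fderiv ℂ (holRep (G k)) x) atTop (𝓝 L) := by
      intro x
      by_cases hx : x ∈ Metric.ball z (r / 2)
      · obtain ⟨L, hL⟩ := cauchySeq_tendsto_of_complete (huc.cauchy_map hx)
        exact ⟨L, fun _ => hL⟩
      · exact ⟨0, fun h => absurd h hx⟩
    choose g' hg' using hlimd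
    have hunif := huc.tendstoUniformlyOn_of_tendsto (fun x hx => hg' x hx)
    have := hasFDerivAt_of_tendstoUniformlyOn Metric.isOpen_ball hunif
      (fun k x hx => (hda k x hx).hasFDerivAt) (fun x hx => hg x (hin x hx))
      (Metric.mem_ball_self (half_pos hr))
    exact this.differentiableAt.differentiableWithinAt
  · have hm := tendstoInMeasure_of_tendsto_Lp hlim
    obtain ⟨ns, hns, hae⟩ := hm.exists_seq_tendsto_ae
    have hall : ∀ᵐ x ∂(volume.restrict (Ω : Set (CSpace n))), ∀ k, F k x = holRep (G k) x :=
      ae_all_iff.2 fun k => holRep_ae (G k)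
    filter_upwards [hae, hall, ae_restrict_mem Ω.isOpen.measurableSet] with x h1 h2 h3
    refine tendsto_nhds_unique h1 ?_
    simp only [h2]
    exact (hg x h3).comp hns.tendsto_atTop

instance bergmanSpace_complete {n : ℕ} (Ω : TopologicalSpace.Opens (CSpace n)) :
    CompleteSpace (bergmanSpace Ω) :=
  (isClosed_bergmanSpace Ω).completeSpace_coe

/-- The Bergman projection: the orthogonal projection of `L²(Ω)` onto the Bergman space. -/
noncomputable def bergmanProjection {n : ℕ} (Ω : TopologicalSpace.Opens (CSpace n)) :
    Lp ℂ 2 (volume.restrict (Ω : Set (CSpace n))) →L[ℂ] Lp ℂ 2 (volume.restrict (Ω : Set (CSpace n))) :=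
  (bergmanSpace Ω).starProjection

/-- The Bergman space as a Hilbert space of functions on `Ω` with continuous point evaluations. -/
noncomputable instance bergmanRKHS {n : ℕ} (Ω : TopologicalSpace.Opens (CSpace n)) :
    RKHS ℂ (bergmanSpace Ω) Ω ℂ where
  coeCLM := ContinuousLinearMap.pi fun z : Ω =>
    LinearMap.mkContinuousOfExistsBound
      { toFun := fun f => holRep f z
        map_add' := fun f g => holRep_add f g z.2
        map_smul' := fun c f => holRep_smul c f z.2 }
      (by
        obtain ⟨r, hr, hball⟩ := Metric.isOpen_iff.1 Ω.isOpen z z.2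
        obtain ⟨C, -, h⟩ := norm_holRep_le (n := n) hr
        exact ⟨C, fun f => h Ω f z hball⟩)
  coeCLM_injective := by
    intro f g h
    have h' : ∀ z : Ω, holRep f z = holRep g z := fun z => congrFun h z
    apply Subtype.ext
    apply Lp.ext
    refine (holRep_ae f).trans (EventuallyEq.trans ?_ (holRep_ae g).symm)
    filter_upwards [ae_restrict_mem Ω.isOpen.measurableSet] with x hx
    exact h' ⟨x, hx⟩

/-- The Bergman kernel: the reproducing kernel of the Bergman space. It is holomorphic in `z`,
antiholomorphic in `w`, and `(Bv)(z) = ∫_Ω bergmanKernel Ω z w * v w dw`. -/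
noncomputable def bergmanKernel {n : ℕ} (Ω : TopologicalSpace.Opens (CSpace n)) (z w : Ω) : ℂ :=
  RKHS.kernel (bergmanSpace Ω) z w 1

/-! ### Smooth bounded pseudoconvex domains -/

/-- `ρ` is a smooth defining function of `Ω`. -/
structure IsSmoothDefiningFunction {n : ℕ} (Ω : Set (CSpace n)) (ρ : CSpace n → ℝ) : Prop where
  contDiff : ContDiff ℝ ∞ ρ
  domain_eq : Ω = {z | ρ z < 0}
  frontier_eq : frontier Ω = {z | ρ z = 0}
  fderiv_ne_zero : ∀ p ∈ frontier Ω, fderiv ℝ ρ p ≠ 0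

/-- Four times the Levi form `∑ ∂²ρ/∂z_j∂z̄_k (p) v_j v̄_k`, in real terms. -/
noncomputable def leviForm {n : ℕ} (ρ : CSpace n → ℝ) (p v : CSpace n) : ℝ :=
  iteratedFDeriv ℝ 2 ρ p ![v, v] +
    iteratedFDeriv ℝ 2 ρ p ![Complex.I • v, Complex.I • v]

/-- `Ω` is a bounded domain with smooth boundary that is (Levi) pseudoconvex: the Levi form of a
smooth defining function is nonnegative on the complex tangent space `∑ ∂ρ/∂z_j (p) v_j = 0` at
every boundary point `p`. -/
structure IsSmoothBoundedPseudoconvex {n : ℕ} (Ω : Set (CSpace n)) : Prop where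
  isConnected : IsConnected Ω
  isBounded : Bornology.IsBounded Ω
  pseudoconvex : ∃ ρ : CSpace n → ℝ, IsSmoothDefiningFunction Ω ρ ∧
    ∀ p ∈ frontier Ω, ∀ v : CSpace n,
      fderiv ℝ ρ p v = 0 → fderiv ℝ ρ p (Complex.I • v) = 0 → 0 ≤ leviForm ρ p v

/-- The signed distance to the boundary, negative inside `Ω`. -/
noncomputable def signedBoundaryDist {n : ℕ} (Ω : Set (CSpace n)) (z : CSpace n) : ℝ :=
  open Classical in
  if z ∈ Ω then -Metric.infDist z (frontier Ω) else Metric.infDist z (frontier Ω)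

/-- The isotropic distance `max {|r(z)|, |r(w)|, |z - w|}`. -/
noncomputable def isotropicDist {n : ℕ} (Ω : Set (CSpace n)) (z w : CSpace n) : ℝ :=
  max (max |signedBoundaryDist Ω z| |signedBoundaryDist Ω w|) ‖z - w‖

/-! ### Sobolev norms on an open set -/

/-- `φ ∈ C^∞_c(W)`. -/
structure IsTestFunction {n : ℕ} {F : Type*} [NormedAddCommGroup F] [NormedSpace ℝ F]
    (W : Set (CSpace n)) (φ : CSpace n → F) : Prop where
  contDiff : ContDiff ℝ ∞ φ
  hasCompactSupport : HasCompactSupport φ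
  tsupport_subset : tsupport φ ⊆ W

/-- The `2n` real coordinate directions: `(j, 0)` is that of `Re z_j`, `(j, 1)` that of `Im z_j`. -/
noncomputable def realDirection {n : ℕ} (a : Fin n × Fin 2) : CSpace n :=
  EuclideanSpace.single a.1 (if a.2 = 0 then 1 else Complex.I)

/-- `g` is the weak partial derivative of `f` on `W` in the coordinate directions
`I 0, …, I (k - 1)`. -/
def HasWeakPartial {n : ℕ} (W : Set (CSpace n)) {k : ℕ} (I : Fin k → Fin n × Fin 2)
    (f g : CSpace n → ℂ) : Prop :=
  LocallyIntegrableOn f W ∧ LocallyIntegrableOn g W ∧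
    ∀ φ : CSpace n → ℂ, IsTestFunction W φ →
      ∫ x in W, f x * iteratedFDeriv ℝ k φ x (fun i => realDirection (I i)) =
        (-1) ^ k * ∫ x in W, g x * φ x

/-- The square of the norm of `L²_s(W)`: the sum of the squared `L²` norms of the weak partial
derivatives of order at most `s`, with value `∞` if one of them does not exist (then the infimum
is over the empty set) or is not in `L²`. Weak derivatives are unique almost everywhere, so the
infimum is otherwise over a single class. -/
noncomputable def sobolevNormSq {n : ℕ} (W : Set (CSpace n)) (s : ℕ) (f : CSpace n → ℂ) : ℝ≥0∞ :=
  ∑ k ∈ Finset.range (s + 1), ∑ I : Fin k → Fin n × Fin 2,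
    ⨅ (g : CSpace n → ℂ) (_ : HasWeakPartial W I f g), eLpNorm g 2 (volume.restrict W) ^ 2

/-- `f ∈ L²_s(W)`. -/
def MemSobolev {n : ℕ} (W : Set (CSpace n)) (s : ℕ) (f : CSpace n → ℂ) : Prop :=
  sobolevNormSq W s f < ⊤

/-- The norm of `f` in `L²_{-m}(W)`, the dual of the closure of `C^∞_c(W)` in `L²_m(W)`, for
`f ∈ L²(W)`. -/
noncomputable def sobolevDualNorm {n : ℕ} (W : Set (CSpace n)) (m : ℕ) (f : CSpace n → ℂ) : ℝ≥0∞ :=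
  ⨆ (φ : CSpace n → ℂ) (_ : IsTestFunction W φ) (_ : sobolevNormSq W m φ ≤ 1),
    ‖∫ x in W, f x * conj (φ x)‖ₑ

/-! ### Local Condition R -/

/-- `χ ≺ χ'`: the cutoff `χ'` equals `1` on the support of `χ`. -/
def CutoffPrec {n : ℕ} (χ χ' : CSpace n → ℝ) : Prop :=
  ∀ x ∈ tsupport χ, χ' x = 1

/-- `Ω` satisfies local Condition R at `z₀`, with `U` as the neighborhood of `z₀`: for all `s, m`
there is `M` such that for all cutoffs `χ₁ ≺ χ₂ ≺ χ₃` in `C^∞_c(U)` the a priori estimate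
`‖χ₁Bu‖²_s ≤ c (‖χ₂u‖²_{s+M} + ‖χ₃Bu‖²_{-m} + ‖u‖²)` holds for `u ∈ L²_{s+M}(U ∩ Ω) ∩ L²(Ω)`.
Orders are integers; by monotonicity of the norms in the order, this is equivalent to the condition
with real orders. The last term is the usual error term of a pseudolocal estimate: without it, no
smooth bounded pseudoconvex domain would satisfy the condition. -/
def LocalConditionR {n : ℕ} (Ω : TopologicalSpace.Opens (CSpace n)) (z₀ : CSpace n)
    (U : Set (CSpace n)) : Prop :=
  IsOpen U ∧ z₀ ∈ U ∧
    ∀ s m : ℕ, ∃ M : ℕ, ∀ χ₁ χ₂ χ₃ : CSpace n → ℝ,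
      IsTestFunction U χ₁ → IsTestFunction U χ₂ → IsTestFunction U χ₃ →
      CutoffPrec χ₁ χ₂ → CutoffPrec χ₂ χ₃ →
      ∃ c : ℝ≥0, ∀ u : Lp ℂ 2 (volume.restrict (Ω : Set (CSpace n))),
        MemSobolev (U ∩ Ω) (s + M) u →
        sobolevNormSq Ω s (fun x => (χ₁ x : ℂ) * bergmanProjection Ω u x) ≤
          c * (sobolevNormSq Ω (s + M) (fun x => (χ₂ x : ℂ) * u x) +
            sobolevDualNorm Ω m (fun x => (χ₃ x : ℂ) * bergmanProjection Ω u x) ^ 2 +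
            eLpNorm u 2 (volume.restrict (Ω : Set (CSpace n))) ^ 2)

/-! ### The set on which the kernel is smooth, and its derivatives there -/

/-- `((Ω̄ ∩ U) × (Ω̄ ∩ U))` minus the diagonal of `bΩ ∩ U`. -/
def offBoundaryDiagonal {n : ℕ} (Ω U : Set (CSpace n)) : Set (CSpace n × CSpace n) :=
  ((closure Ω ∩ U) ×ˢ (closure Ω ∩ U)) \ {p | p.1 = p.2 ∧ p.1 ∈ frontier Ω ∩ U}

/-- `∂/∂z_j = ½ (∂/∂x_j - i ∂/∂y_j)` in the first variable, for functions on `S`. -/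
noncomputable def wirtingerFst {n : ℕ} (S : Set (CSpace n × CSpace n)) (j : Fin n)
    (F : CSpace n × CSpace n → ℂ) (p : CSpace n × CSpace n) : ℂ :=
  (1 / 2) * (fderivWithin ℝ F S p (EuclideanSpace.single j 1, 0) -
    Complex.I * fderivWithin ℝ F S p (EuclideanSpace.single j Complex.I, 0))

/-- `∂/∂w̄_j = ½ (∂/∂u_j + i ∂/∂v_j)` in the second variable, for functions on `S`. -/
noncomputable def wirtingerBarSnd {n : ℕ} (S : Set (CSpace n × CSpace n)) (j : Fin n)
    (F : CSpace n × CSpace n → ℂ) (p : CSpace n × CSpace n) : ℂ :=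
  (1 / 2) * (fderivWithin ℝ F S p (0, EuclideanSpace.single j 1) +
    Complex.I * fderivWithin ℝ F S p (0, EuclideanSpace.single j Complex.I))

/-- `D^α_z D^β_{w̄} F` for multi-indices `α`, `β`. -/
noncomputable def mixedWirtinger {n : ℕ} (S : Set (CSpace n × CSpace n)) (α β : Fin n → ℕ)
    (F : CSpace n × CSpace n → ℂ) : CSpace n × CSpace n → ℂ :=
  (List.finRange n).foldr (fun j G => (wirtingerFst S j)^[α j] G)
    ((List.finRange n).foldr (fun j G => (wirtingerBarSnd S j)^[β j] G) F)

/-! Let d be the real dimension of `CSpace n`. If the ball of radius ρ about w lies in Ω, the mean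
value property shows that the kernel function at w is the Bergman projection of a normalized radial
bump supported within ρ/2 of w (`exists_bergmanProjection_eq_kerFun`), whose L² norm is O(ρ^(-d)).
Let z be near p and w near q ≠ p. The bump vanishes where the cutoff χ₂ lives, so Condition R with m
= 0 bounds every Sobolev norm of the kernel function near p by that L² norm alone; the loss M costs
nothing. Evaluating a derivative of a holomorphic function at a point costs another ρ^(-d). Hence
the derivatives of every order k in z, along a coordinate direction, are O(ρ^(-N)) with N
independent of k (`LocalConditionR.exists_norm_dirDeriv_le`). Hermitian symmetry gives the same in
w.

These bounds concern pure derivatives in one variable and blow up at the boundary. Conjugating w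
turns the kernel into a holomorphic function f of both variables, and
`exists_norm_iteratedFDeriv_le_of_growth` removes the blow-up. The a-th difference of f with step h
in an inward direction e₁ is O(h^a ρ^(-N)), and by Cauchy's estimates its l-th derivative is bounded
as soon as h^a ≤ ρ^(N+l). So D^l f at x is controlled by its values at x + j h e₁ with 1 ≤ j ≤ a,
and these, by the same argument along an inward direction e₂ of the other variable, by its values at
x + j h e₁ + j' h e₂. Those points are about h away from the boundary in both variables, where D^l f
is O(h^(-N-l)). Since a is free, h may be a small power of ρ, and D^l f = O(ρ^(-1/2)) follows for
every l. This bound is integrable: integrating the derivative of order l + 1 along e₁ + e₂ bounds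
D^l f.

A function with bounded derivatives of all orders on a set with interior cones extends smoothly to
the closure (`HasInteriorCones.contDiffWithinAt_extendFrom`); a smooth boundary provides the cones.
The second claim is then compactness, because the isotropic distance is continuous and vanishes on
the boundary diagonal. -/

theorem exists_ball_bound {E F : Type*} [PseudoMetricSpace E] [SeminormedAddCommGroup F] {f : E → F}
    {D : Set E} (hD : IsOpen D) (hf : ContinuousOn f D) {x : E}
    (hx : x ∈ D) : ∃ r > 0, Metric.ball x r ⊆ D ∧ ∃ M, ∀ y ∈ Metric.ball x r, ‖f y‖ ≤ M := by
  have hc : ContinuousAt f x := hf.continuousAt (hD.mem_nhds hx)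
  have h1 : ∀ᶠ y in 𝓝 x, y ∈ D ∧ ‖f y‖ ≤ ‖f x‖ + 1 :=
    Filter.Eventually.and (hD.mem_nhds hx)
      ((hc.norm.eventually_lt continuousAt_const (by simp)).mono fun _ h => le_of_lt h)
  obtain ⟨r, hr, h⟩ := Metric.eventually_nhds_iff_ball.1 h1
  exact ⟨r, hr, fun y hy => (h y hy).1, _, fun y hy => (h y hy).2⟩

/-! ### Cauchy estimates, smoothness of holomorphic maps and Osgood's lemma. -/

section Holomorphic

variable {E F : Type} [NormedAddCommGroup E] [NormedSpace ℂ E] [NormedAddCommGroup F]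
  [NormedSpace ℂ F]

/-- Cauchy's estimate for the derivative of a holomorphic map between normed spaces. -/
theorem norm_fderiv_le_of_ball {f : E → F} {x : E} {r M : ℝ} (hr : 0 < r)
    (hf : DifferentiableOn ℂ f (Metric.ball x r)) (hM : ∀ y ∈ Metric.ball x r, ‖f y‖ ≤ M) :
    ‖fderiv ℂ f x‖ ≤ 2 * M / r := by
  have hM0 : 0 ≤ M := (norm_nonneg _).trans (hM x (Metric.mem_ball_self hr))
  refine ContinuousLinearMap.opNorm_le_of_unit_norm (by positivity) fun v hv => ?_
  have hmem : ∀ t : ℂ, ‖t‖ ≤ r / 2 → x + t • v ∈ Metric.ball x r := by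
    intro t ht
    simp only [Metric.mem_ball, dist_self_add_left, norm_smul, hv]
    linarith
  have hd : DiffContOnCl ℂ (fun t : ℂ => f (x + t • v)) (Metric.ball 0 (r / 2)) := by
    have : DifferentiableOn ℂ (fun t : ℂ => f (x + t • v)) (Metric.closedBall 0 (r / 2)) := by
      intro t ht
      have h1 : DifferentiableAt ℂ f (x + t • v) :=
        hf.differentiableAt (Metric.isOpen_ball.mem_nhds (hmem t (by simpa using ht)))
      have h2 : DifferentiableAt ℂ (fun t : ℂ => x + t • v) t := by fun_prop
      exact (DifferentiableAt.comp (g := f) t h1 h2).differentiableWithinAt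
    exact (this.mono Metric.closure_ball_subset_closedBall).diffContOnCl
  have hb := Complex.norm_deriv_le_of_forall_mem_sphere_norm_le (by positivity) hd
    (C := M) (fun t ht => hM _ (hmem t (by simpa using ht.le)))
  have hder : deriv (fun t : ℂ => f (x + t • v)) 0 = fderiv ℂ f x v := by
    have h1 : HasFDerivAt f (fderiv ℂ f x) (x + (0 : ℂ) • v) := by
      simpa using (hf.differentiableAt (Metric.ball_mem_nhds x hr)).hasFDerivAt
    have h2 : HasDerivAt (fun t : ℂ => x + t • v) v 0 := by
      simpa using ((hasDerivAt_id (0 : ℂ)).smul_const v).const_add x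
    exact (h1.comp_hasDerivAt (0 : ℂ) h2).deriv
  rw [hder] at hb
  calc _ ≤ _ := hb
    _ = _ := by field_simp

theorem norm_sub_le_of_ball {f : E → F} {x : E} {r M : ℝ} (hr : 0 < r)
    (hf : DifferentiableOn ℂ f (Metric.ball x r)) (hM : ∀ y ∈ Metric.ball x r, ‖f y‖ ≤ M)
    {y z : E} (hy : y ∈ Metric.ball x (r / 2)) (hz : z ∈ Metric.ball x (r / 2)) :
    ‖f y - f z‖ ≤ 4 * M / r * ‖y - z‖ := by
  refine (convex_ball x (r / 2)).norm_image_sub_le_of_norm_fderiv_le (𝕜 := ℂ) ?_ ?_ hz hy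
  · intro p hp
    exact hf.differentiableAt (Metric.isOpen_ball.mem_nhds
      (Metric.ball_subset_ball (by linarith) hp))
  · intro p hp
    have hsub : Metric.ball p (r / 2) ⊆ Metric.ball x r := by
      refine Metric.ball_subset_ball' ?_
      have : dist p x < r / 2 := hp
      linarith
    refine (norm_fderiv_le_of_ball (half_pos hr) (hf.mono hsub)
      (fun q hq => hM q (hsub hq))).trans (le_of_eq ?_)
    field_simp; ring

/-- Cauchy's estimate for y ↦ f (y + u) - f y, which `norm_sub_le_of_ball` bounds by a multiple of
‖u‖. -/
theorem norm_fderiv_sub_le_of_ball {f : E → F} {x : E} {r M : ℝ} (hr : 0 < r)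
    (hf : DifferentiableOn ℂ f (Metric.ball x r)) (hM : ∀ y ∈ Metric.ball x r, ‖f y‖ ≤ M)
    {u : E} (hu : ‖u‖ < r / 4) :
    ‖fderiv ℂ f (x + u) - fderiv ℂ f x‖ ≤ 32 * M / r ^ 2 * ‖u‖ := by
  have h1 : ∀ y ∈ Metric.ball x (r / 4), y + u ∈ Metric.ball x (r / 2) ∧
      y ∈ Metric.ball x (r / 2) := by
    intro y hy
    have hy' : dist y x < r / 4 := hy
    refine ⟨?_, Metric.ball_subset_ball (by linarith) hy⟩
    rw [Metric.mem_ball]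
    calc dist (y + u) x ≤ dist (y + u) y + dist y x := dist_triangle _ _ _
      _ < r / 2 := by simp only [dist_self_add_left]; linarith
  have hda : ∀ y ∈ Metric.ball x (r / 2), DifferentiableAt ℂ f y := fun y hy =>
    hf.differentiableAt (Metric.isOpen_ball.mem_nhds (Metric.ball_subset_ball (by linarith) hy))
  have hdb : ∀ y ∈ Metric.ball x (r / 4), DifferentiableAt ℂ (fun y => f (y + u)) y := by
    intro y hy
    exact (hda _ (h1 y hy).1).comp y (by fun_prop)
  have h2 := norm_fderiv_le_of_ball (f := fun y => f (y + u) - f y) (x := x) (r := r / 4)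
    (M := 4 * M / r * ‖u‖) (by positivity)
    (fun y hy => ((hdb y hy).sub (hda y (h1 y hy).2)).differentiableWithinAt)
    (fun y hy => by
      have := norm_sub_le_of_ball hr hf hM (h1 y hy).1 (h1 y hy).2
      simpa using this)
  have hx : x ∈ Metric.ball x (r / 4) := Metric.mem_ball_self (by positivity)
  rw [fderiv_fun_sub (hdb x hx) (hda x (h1 x hx).2), fderiv_comp_add_right] at h2
  refine h2.trans (le_of_eq ?_)
  field_simp; ring

/-- The second order Taylor estimate for holomorphic maps. -/
theorem norm_sub_sub_fderiv_le_of_ball {f : E → F} {x : E} {r M : ℝ} (hr : 0 < r)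
    (hf : DifferentiableOn ℂ f (Metric.ball x r)) (hM : ∀ y ∈ Metric.ball x r, ‖f y‖ ≤ M)
    {u : E} (hu : ‖u‖ < r / 4) :
    ‖f (x + u) - f x - fderiv ℂ f x u‖ ≤ 32 * M / r ^ 2 * ‖u‖ * ‖u‖ := by
  have hM0 : 0 ≤ M := (norm_nonneg _).trans (hM x (Metric.mem_ball_self hr))
  have hconv := convex_closedBall (E := E) x ‖u‖
  have := hconv.norm_image_sub_le_of_norm_fderiv_le' (𝕜 := ℂ) (f := f) (φ := fderiv ℂ f x)
    (C := 32 * M / r ^ 2 * ‖u‖) (x := x) (y := x + u) ?_ ?_ (by simp) (by simp)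
  · simpa using this
  · intro p hp
    refine hf.differentiableAt (Metric.isOpen_ball.mem_nhds ?_)
    have : dist p x ≤ ‖u‖ := hp
    rw [Metric.mem_ball]; linarith
  · intro p hp
    have h1 : ‖p - x‖ ≤ ‖u‖ := by simpa [dist_eq_norm] using hp
    have h2 := norm_fderiv_sub_le_of_ball hr hf hM (u := p - x) (by linarith)
    rw [add_sub_cancel] at h2
    exact h2.trans (by gcongr)

/-- Directional derivatives of holomorphic maps are holomorphic. -/
theorem differentiableOn_fderiv_apply [CompleteSpace F] {f : E → F} {D : Set E} (hD : IsOpen D)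
    (hf : DifferentiableOn ℂ f D) (v : E) : DifferentiableOn ℂ (fun x => fderiv ℂ f x v) D := by
  intro x hx
  obtain ⟨r, hr, hball, M, hM⟩ := exists_ball_bound hD hf.continuousOn hx
  have hM0 : 0 ≤ M := (norm_nonneg _).trans (hM x (Metric.mem_ball_self hr))
  set t : ℕ → ℂ := fun k => ((k : ℂ) + 1)⁻¹ with ht
  have ht0 : ∀ k, t k ≠ 0 := fun k => inv_ne_zero (by exact_mod_cast Nat.succ_ne_zero k)
  have htl : Tendsto t atTop (𝓝 0) := by
    have := tendsto_one_div_add_atTop_nhds_zero_nat (𝕜 := ℂ)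
    simpa [ht] using this
  have htn : Tendsto (fun k => ‖t k‖) atTop (𝓝 0) := by simpa using htl.norm
  have htv : ∀ᶠ k in atTop, ‖t k • v‖ < r / 2 / 4 := by
    have : Tendsto (fun k => ‖t k • v‖) atTop (𝓝 0) := by
      simpa [norm_smul] using htn.mul_const ‖v‖
    exact this.eventually_lt_const (by positivity)
  set C : ℝ := 32 * M / (r / 2) ^ 2 * ‖v‖ * ‖v‖ with hC
  have hC0 : 0 ≤ C := by positivity
  set g : ℕ → E → F := fun k y => (t k)⁻¹ • (f (y + t k • v) - f y) with hg
  have hsub : ∀ y ∈ Metric.ball x (r / 2), Metric.ball y (r / 2) ⊆ Metric.ball x r := by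
    intro y hy
    refine Metric.ball_subset_ball' ?_
    have : dist y x < r / 2 := hy
    linarith
  have hfd : DifferentiableOn ℂ f (Metric.ball x r) := hf.mono hball
  have hda : ∀ y ∈ Metric.ball x r, DifferentiableAt ℂ f y := fun y hy =>
    hfd.differentiableAt (Metric.isOpen_ball.mem_nhds hy)
  -- the difference quotients converge uniformly
  have hgl : ∀ k, ‖t k • v‖ < r / 2 / 4 → ∀ y ∈ Metric.ball x (r / 2),
      ‖g k y - fderiv ℂ f y v‖ ≤ C * ‖t k‖ := by
    intro k hk y hy
    have h := norm_sub_sub_fderiv_le_of_ball (half_pos hr) (hfd.mono (hsub y hy))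
      (fun q hq => hM q (hsub y hy hq)) hk
    have e : g k y - fderiv ℂ f y v =
        (t k)⁻¹ • (f (y + t k • v) - f y - fderiv ℂ f y (t k • v)) := by
      simp only [hg, map_smul, smul_sub, smul_smul, inv_mul_cancel₀ (ht0 k), one_smul]
    have hk0 : 0 < ‖t k‖ := norm_pos_iff.2 (ht0 k)
    rw [e, norm_smul, norm_inv, inv_mul_le_iff₀ hk0]
    refine h.trans (le_of_eq ?_)
    rw [hC, norm_smul]; ring
  have hgd : ∀ k, ‖t k • v‖ < r / 2 / 4 → ∀ y ∈ Metric.ball x (r / 2),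
      DifferentiableAt ℂ (g k) y := by
    intro k hk y hy
    have h1 : y + t k • v ∈ Metric.ball x r := by
      refine hsub y hy ?_
      simp only [Metric.mem_ball, dist_self_add_left]; linarith
    have h2 : y ∈ Metric.ball x r := Metric.ball_subset_ball (by linarith) hy
    have h3 : DifferentiableAt ℂ (fun y => f (y + t k • v)) y :=
      (hda _ h1).comp y (by fun_prop)
    exact (h3.sub (hda y h2)).const_smul _
  -- Uniform closeness of the quotients on the ball of radius r / 2 gives, by Cauchy's estimate,
  -- uniform closeness of their derivatives on the ball of radius r / 4.
  have huc : UniformCauchySeqOn (fun k => fderiv ℂ (g k)) atTop (Metric.ball x (r / 4)) := by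
    rw [Metric.uniformCauchySeqOn_iff]
    intro ε hε
    have hsmall : ∀ᶠ k in atTop, C * ‖t k‖ < ε * r / 32 := by
      have : Tendsto (fun k => C * ‖t k‖) atTop (𝓝 0) := by simpa using htn.const_mul C
      exact this.eventually_lt_const (by positivity)
    obtain ⟨N, hN⟩ := eventually_atTop.1 (hsmall.and htv)
    refine ⟨N, fun k hk l hl y hy => ?_⟩
    have hsub' : Metric.ball y (r / 4) ⊆ Metric.ball x (r / 2) := by
      refine Metric.ball_subset_ball' ?_
      have : dist y x < r / 4 := hy
      linarith
    have hy' : y ∈ Metric.ball x (r / 2) := hsub' (Metric.mem_ball_self (by positivity))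
    have h1 := norm_fderiv_le_of_ball (f := fun y => g k y - g l y) (x := y) (r := r / 4)
      (M := ε * r / 16) (by positivity)
      (fun q hq => ((hgd k (hN k hk).2 q (hsub' hq)).sub
        (hgd l (hN l hl).2 q (hsub' hq))).differentiableWithinAt)
      (fun q hq => by
        have e : g k q - g l q = (g k q - fderiv ℂ f q v) - (g l q - fderiv ℂ f q v) := by abel
        rw [e]
        refine (norm_sub_le _ _).trans ?_
        have a1 := hgl k (hN k hk).2 q (hsub' hq)
        have a2 := hgl l (hN l hl).2 q (hsub' hq)
        have a3 := (hN k hk).1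
        have a4 := (hN l hl).1
        linarith)
    rw [fderiv_fun_sub (hgd k (hN k hk).2 y hy') (hgd l (hN l hl).2 y hy')] at h1
    rw [dist_eq_norm]
    refine h1.trans_lt ?_
    have : 2 * (ε * r / 16) / (r / 4) = ε / 2 := by field_simp; ring
    rw [this]; linarith
  have hlimd : ∀ y, ∃ L : E →L[ℂ] F, y ∈ Metric.ball x (r / 4) →
      Tendsto (fun k => fderiv ℂ (g k) y) atTop (𝓝 L) := by
    intro y
    by_cases hy : y ∈ Metric.ball x (r / 4)
    · obtain ⟨L, hL⟩ := cauchySeq_tendsto_of_complete (huc.cauchy_map hy)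
      exact ⟨L, fun _ => hL⟩
    · exact ⟨0, fun h => absurd h hy⟩
  choose g' hg' using hlimd
  have hunif := huc.tendstoUniformlyOn_of_tendsto (fun y hy => hg' y hy)
  -- Only the tail from N on consists of quotients that are differentiable on the whole ball.
  obtain ⟨N, hN⟩ := eventually_atTop.1 htv
  have hunif' : TendstoUniformlyOn (fun k => fderiv ℂ (g (k + N))) g' atTop
      (Metric.ball x (r / 4)) := by
    intro u hu
    exact (tendsto_add_atTop_nat N).eventually (hunif u hu)
  have hlt : ∀ y ∈ Metric.ball x (r / 4), y ∈ Metric.ball x (r / 2) := fun y hy =>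
    Metric.ball_subset_ball (by linarith) hy
  have := hasFDerivAt_of_tendstoUniformlyOn (f := fun k => g (k + N))
    (g := fun y => fderiv ℂ f y v) Metric.isOpen_ball hunif'
    (fun k y hy => (hgd _ (hN _ (Nat.le_add_left N k)) y (hlt y hy)).hasFDerivAt)
    (fun y hy => by
      rw [tendsto_iff_norm_sub_tendsto_zero]
      refine squeeze_zero (fun _ => norm_nonneg _)
        (fun k => hgl _ (hN _ (Nat.le_add_left N k)) y (hlt y hy)) ?_
      have := (htn.const_mul C).comp (tendsto_add_atTop_nat N)
      simpa [Function.comp_def] using this)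
    (Metric.mem_ball_self (by positivity : (0 : ℝ) < r / 4))
  exact this.differentiableAt.differentiableWithinAt

/-- Finite dimension enters here: the regularity of `fderiv ℂ f` is tested one direction at a time,
and each directional derivative is again holomorphic. -/
theorem contDiffOn_of_holomorphic_nat [CompleteSpace F] [FiniteDimensional ℂ E] (k : ℕ) :
    ∀ {f : E → F} {D : Set E}, IsOpen D → DifferentiableOn ℂ f D → ContDiffOn ℂ k f D := by
  induction k with
  | zero => intro f D hD hf; exact contDiffOn_zero.2 hf.continuousOn
  | succ k ih =>
    intro f D hD hf
    have := (contDiffOn_succ_iff_fderiv_of_isOpen (𝕜 := ℂ) (n := k) (f := f) hD).2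
      ⟨hf, by simp, contDiffOn_clm_apply.2 fun v => ih hD (differentiableOn_fderiv_apply hD hf v)⟩
    exact_mod_cast this

/-- Holomorphic maps on finite dimensional spaces are smooth. -/
theorem contDiffOn_of_holomorphic [CompleteSpace F] [FiniteDimensional ℂ E] {f : E → F} {D : Set E} (hD : IsOpen D)
    (hf : DifferentiableOn ℂ f D) : ContDiffOn ℂ ∞ f D :=
  contDiffOn_infty.2 fun k => contDiffOn_of_holomorphic_nat k hD hf

theorem differentiableOn_fderiv [CompleteSpace F] [FiniteDimensional ℂ E] {f : E → F}
    {D : Set E} (hD : IsOpen D)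
    (hf : DifferentiableOn ℂ f D) : DifferentiableOn ℂ (fderiv ℂ f) D :=
  ((contDiffOn_of_holomorphic hD hf).fderiv_of_isOpen hD (m := 1) (by
    norm_cast)).differentiableOn (by simp)

/-- Cauchy's estimates for the higher derivatives. -/
theorem exists_norm_iteratedFDeriv_le_of_ball [FiniteDimensional ℂ E] (l : ℕ) :
    ∃ C : ℝ, 0 ≤ C ∧ ∀ {F : Type} [NormedAddCommGroup F] [NormedSpace ℂ F] [CompleteSpace F]
      {f : E → F} {x : E} {r M : ℝ}, 0 < r → DifferentiableOn ℂ f (Metric.ball x r) →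
      (∀ y ∈ Metric.ball x r, ‖f y‖ ≤ M) → ‖iteratedFDeriv ℂ l f x‖ ≤ C * M / r ^ l := by
  induction l with
  | zero =>
    refine ⟨1, by norm_num, fun hr hf hM => ?_⟩
    simpa using hM _ (Metric.mem_ball_self hr)
  | succ l ih =>
    obtain ⟨C, hC, h⟩ := ih
    refine ⟨C * 4 * 2 ^ l, by positivity, ?_⟩
    intro F _ _ _ f x r M hr hf hM
    -- The inductive hypothesis is applied to `fderiv ℂ f`, whose values lie in another space; hence
    -- the constant is chosen before F.
    rw [← norm_iteratedFDeriv_fderiv]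
    have := h (f := fderiv ℂ f) (x := x) (r := r / 2) (M := 4 * M / r) (half_pos hr)
      ((differentiableOn_fderiv Metric.isOpen_ball hf).mono
        (Metric.ball_subset_ball (by linarith)))
      (fun y hy => by
        have hsub : Metric.ball y (r / 2) ⊆ Metric.ball x r := by
          refine Metric.ball_subset_ball' ?_
          have : dist y x < r / 2 := hy
          linarith
        refine (norm_fderiv_le_of_ball (half_pos hr) (hf.mono hsub)
          (fun q hq => hM q (hsub hq))).trans (le_of_eq ?_)
        field_simp; ring)
    refine this.trans (le_of_eq ?_)
    rw [div_pow, pow_succ]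
    field_simp

/-- Osgood's lemma: a locally bounded, separately holomorphic function is holomorphic. -/
theorem differentiableAt_of_separately {E₁ E₂ : Type} [NormedAddCommGroup E₁] [NormedSpace ℂ E₁]
    [NormedAddCommGroup E₂] [NormedSpace ℂ E₂] {f : E₁ × E₂ → F} {p : E₁ × E₂} {r M : ℝ}
    (hr : 0 < r)
    (h₁ : ∀ w ∈ Metric.ball p.2 r, DifferentiableOn ℂ (fun z => f (z, w)) (Metric.ball p.1 r))
    (h₂ : ∀ z ∈ Metric.ball p.1 r, DifferentiableOn ℂ (fun w => f (z, w)) (Metric.ball p.2 r))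
    (hM : ∀ z ∈ Metric.ball p.1 r, ∀ w ∈ Metric.ball p.2 r, ‖f (z, w)‖ ≤ M) :
    DifferentiableAt ℂ f p := by
  obtain ⟨a, b⟩ := p
  simp only at h₁ h₂ hM
  have ha : a ∈ Metric.ball a r := Metric.mem_ball_self hr
  have hb : b ∈ Metric.ball b r := Metric.mem_ball_self hr
  have hM0 : 0 ≤ M := (norm_nonneg _).trans (hM a ha b hb)
  set A := fderiv ℂ (fun z => f (z, b)) a with hA
  set B := fderiv ℂ (fun w => f (a, w)) b with hB
  refine HasFDerivAt.differentiableAt (f' := A.comp (ContinuousLinearMap.fst ℂ E₁ E₂) +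
    B.comp (ContinuousLinearMap.snd ℂ E₁ E₂)) ?_
  rw [hasFDerivAt_iff_isLittleO_nhds_zero]
  have key : ∀ᶠ h in 𝓝 (0 : E₁ × E₂), ‖f ((a, b) + h) - f (a, b) -
      (A.comp (ContinuousLinearMap.fst ℂ E₁ E₂) + B.comp (ContinuousLinearMap.snd ℂ E₁ E₂)) h‖
      ≤ 100 * M / r ^ 2 * ‖‖h‖ ^ 2‖ := by
    filter_upwards [Metric.ball_mem_nhds (0 : E₁ × E₂) (by positivity : 0 < r / 4)] with h hh
    obtain ⟨u, v⟩ := h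
    have hh' : ‖(u, v)‖ < r / 4 := by simpa using hh
    have hu : ‖u‖ ≤ ‖(u, v)‖ := norm_fst_le (u, v)
    have hv : ‖v‖ ≤ ‖(u, v)‖ := norm_snd_le (u, v)
    have hbv : b + v ∈ Metric.ball b r := by
      simp only [Metric.mem_ball, dist_self_add_left]; linarith
    have t1 := norm_sub_sub_fderiv_le_of_ball hr (h₁ _ hbv) (fun z hz => hM z hz _ hbv)
      (u := u) (by linarith)
    have t2 := norm_sub_sub_fderiv_le_of_ball hr (h₂ _ ha) (fun w hw => hM _ ha w hw)
      (u := v) (by linarith)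
    have t3 := norm_fderiv_le_of_ball (f := fun z => f (z, b + v) - f (z, b)) (x := a) (r := r)
      (M := 4 * M / r * ‖v‖) hr ((h₁ _ hbv).sub (h₁ _ hb)) (fun z hz => by
        have := norm_sub_le_of_ball hr (h₂ z hz) (fun w hw => hM z hz w hw)
          (y := b + v) (z := b)
          (by simp only [Metric.mem_ball, dist_self_add_left]; linarith)
          (Metric.mem_ball_self (half_pos hr))
        simpa using this)
    rw [fderiv_fun_sub ((h₁ _ hbv).differentiableAt (Metric.ball_mem_nhds a hr))
      ((h₁ _ hb).differentiableAt (Metric.ball_mem_nhds a hr))] at t3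
    -- Taylor remainder in u at height b + v, variation with v of the derivative in u, Taylor
    -- remainder in v at a. The middle term is of second order by Cauchy's estimate for z ↦ f (z, b
    -- + v) - f (z, b), which is O(‖v‖).
    have e : f ((a, b) + (u, v)) - f (a, b) -
        (A.comp (ContinuousLinearMap.fst ℂ E₁ E₂) + B.comp (ContinuousLinearMap.snd ℂ E₁ E₂)) (u, v)
        = (f (a + u, b + v) - f (a, b + v) - fderiv ℂ (fun z => f (z, b + v)) a u) +
          (fderiv ℂ (fun z => f (z, b + v)) a - A) u + (f (a, b + v) - f (a, b) - B v) := by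
      simp only [Prod.mk_add_mk, add_apply, ContinuousLinearMap.comp_apply,
        ContinuousLinearMap.coe_fst', ContinuousLinearMap.coe_snd', sub_apply]
      abel
    rw [e]
    have t4 : ‖(fderiv ℂ (fun z => f (z, b + v)) a - A) u‖ ≤ 2 * (4 * M / r * ‖v‖) / r * ‖u‖ :=
      ContinuousLinearMap.le_of_opNorm_le _ t3 u
    have n0 := norm_nonneg (u, v)
    have h1 : 32 * M / r ^ 2 * ‖u‖ * ‖u‖ ≤ 32 * M / r ^ 2 * ‖(u, v)‖ * ‖(u, v)‖ := by gcongr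
    have h2 : 32 * M / r ^ 2 * ‖v‖ * ‖v‖ ≤ 32 * M / r ^ 2 * ‖(u, v)‖ * ‖(u, v)‖ := by gcongr
    have h3 : 2 * (4 * M / r * ‖v‖) / r * ‖u‖ ≤ 2 * (4 * M / r * ‖(u, v)‖) / r * ‖(u, v)‖ := by
      gcongr
    -- 32 + 32 + 8 = 72; the other 28 only rounds the constant up to 100.
    have h4 : 100 * M / r ^ 2 * ‖‖(u, v)‖ ^ 2‖ = 32 * M / r ^ 2 * ‖(u, v)‖ * ‖(u, v)‖ +
        32 * M / r ^ 2 * ‖(u, v)‖ * ‖(u, v)‖ + 2 * (4 * M / r * ‖(u, v)‖) / r * ‖(u, v)‖ +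
        28 * M / r ^ 2 * ‖(u, v)‖ ^ 2 := by
      rw [Real.norm_of_nonneg (by positivity)]; field_simp; ring
    have h5 : 0 ≤ 28 * M / r ^ 2 * ‖(u, v)‖ ^ 2 := by positivity
    rw [h4]
    refine (norm_add₃_le).trans ?_
    linarith
  refine (Asymptotics.IsBigO.of_bound _ key).trans_isLittleO ?_
  exact (Asymptotics.isLittleO_norm_pow_id one_lt_two)

end Holomorphic

/-! ### Forward differences on the real line. -/

section FiniteDifferences

variable {F : Type*} [NormedAddCommGroup F] [NormedSpace ℝ F]

theorem hasDerivAt_fwdDiff_iter {f f' : ℝ → F} {h : ℝ} (k : ℕ) :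
    ∀ {a : ℝ}, (∀ j ≤ k, HasDerivAt f (f' (a + j * h)) (a + j * h)) →
      HasDerivAt ((fwdDiff h)^[k] f) ((fwdDiff h)^[k] f' a) a := by
  induction k with
  | zero => intro a H; simpa using H 0 le_rfl
  | succ k ih =>
    intro a H
    simp only [Function.iterate_succ_apply']
    have h1 : HasDerivAt ((fwdDiff h)^[k] f) ((fwdDiff h)^[k] f' (a + h)) (a + h) :=
      ih fun j hj => by
        have := H (j + 1) (by omega)
        push_cast at this
        rwa [show a + h + j * h = a + (j + 1) * h by ring]
    have h2 := ih (a := a) fun j hj => H j (by omega)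
    exact (h1.comp_add_const a h).sub h2

/-- The `k`-th forward difference is controlled by the `k`-th derivative. -/
theorem norm_fwdDiff_iter_le {h M : ℝ} (hh : 0 ≤ h) (k : ℕ) :
    ∀ {φ : ℕ → ℝ → F} {a : ℝ},
      (∀ j < k, ∀ t ∈ Icc a (a + k * h), HasDerivAt (φ j) (φ (j + 1) t) t) →
      (∀ t ∈ Icc a (a + k * h), ‖φ k t‖ ≤ M) → ‖(fwdDiff h)^[k] (φ 0) a‖ ≤ h ^ k * M := by
  induction k with
  | zero => intro φ a _ H; simpa using H a (by simp)
  | succ k ih =>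
    intro φ a hd hM
    simp only [Function.iterate_succ_apply']
    have hmem : ∀ b ∈ Icc a (a + h), ∀ t ∈ Icc b (b + k * h), t ∈ Icc a (a + (k + 1 : ℕ) * h) := by
      intro b hb t ht
      push_cast
      exact ⟨hb.1.trans ht.1, ht.2.trans (by linarith [hb.2])⟩
    -- The next difference is the increment over [a, a + h] of the k-th difference of φ 0, whose
    -- derivative is the k-th difference of φ 1.
    have h1 : ∀ b ∈ Icc a (a + h), ‖(fwdDiff h)^[k] (φ 1) b‖ ≤ h ^ k * M := fun b hb =>
      ih (φ := fun j => φ (j + 1)) (a := b)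
        (fun j hj t ht => hd (j + 1) (by omega) t (hmem b hb t ht))
        (fun t ht => hM t (hmem b hb t ht))
    have h2 : ∀ b ∈ Icc a (a + h), HasDerivWithinAt ((fwdDiff h)^[k] (φ 0))
        ((fwdDiff h)^[k] (φ 1) b) (Icc a (a + h)) b := fun b hb =>
      (hasDerivAt_fwdDiff_iter k fun j hj => hd 0 (by omega) _ (hmem b hb _
        ⟨by simpa using mul_nonneg (Nat.cast_nonneg j) hh, by gcongr⟩)).hasDerivWithinAt
    have := (convex_Icc a (a + h)).norm_image_sub_le_of_norm_hasDerivWithin_le h2 h1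
      (x := a) (y := a + h) ⟨le_rfl, by linarith⟩ ⟨by linarith, le_rfl⟩
    rw [fwdDiff]
    refine this.trans (le_of_eq ?_)
    rw [add_sub_cancel_left, Real.norm_of_nonneg hh]; ring

end FiniteDifferences

/-! ### From polynomial growth of uniform order to bounded derivatives. -/

section Growth

theorem iteratedFDeriv_finset_sum_apply {𝕜 E F ι : Type*} [NontriviallyNormedField 𝕜]
    [NormedAddCommGroup E] [NormedSpace 𝕜 E] [NormedAddCommGroup F] [NormedSpace 𝕜 F]
    {f : ι → E → F} {i : ℕ} {x : E} (u : Finset ι) (h : ∀ j ∈ u, ContDiffAt 𝕜 i (f j) x) :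
    iteratedFDeriv 𝕜 i (fun y => ∑ j ∈ u, f j y) x = ∑ j ∈ u, iteratedFDeriv 𝕜 i (f j) x := by
  classical
  induction u using Finset.induction_on with
  | empty =>
    simp only [Finset.sum_empty]
    rw [iteratedFDeriv_fun_zero]
    rfl
  | insert a s ha ih =>
    simp only [Finset.sum_insert ha]
    rw [← ih fun j hj => h j (Finset.mem_insert_of_mem hj)]
    exact iteratedFDeriv_add_apply (h a (Finset.mem_insert_self a s))
      (ContDiffAt.sum fun j hj => h j (Finset.mem_insert_of_mem hj))

theorem hasDerivAt_iteratedDeriv {F : Type*} [NormedAddCommGroup F] [NormedSpace ℝ F] {φ : ℝ → F}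
    {t : ℝ} (h : ContDiffAt ℝ ∞ φ t) (j : ℕ) :
    HasDerivAt (iteratedDeriv j φ) (iteratedDeriv (j + 1) φ t) t := by
  rw [iteratedDeriv_succ]
  refine DifferentiableAt.hasDerivAt ?_
  have h1 : DifferentiableAt ℝ (iteratedFDeriv ℝ j φ) t :=
    h.differentiableAt_iteratedFDeriv (by exact_mod_cast ENat.natCast_lt_top j)
  have h2 : iteratedDeriv j φ = fun s => iteratedFDeriv ℝ j φ s fun _ => (1 : ℝ) := by
    ext s; rw [iteratedDeriv_eq_iteratedFDeriv]
  rw [h2]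
  exact h1.continuousMultilinear_apply_const _

/-- All derivatives of `f` in the direction `e` grow at most like the power `-N` of the radius of
balls contained in `D`, near `x₀`. -/
def HasDirectionalGrowth {E : Type} [NormedAddCommGroup E] [NormedSpace ℝ E]
    (f : E → ℂ) (D : Set E) (x₀ e : E) (r : ℝ) (N : ℕ) : Prop :=
  ∀ k : ℕ, ∃ C : ℝ, 0 ≤ C ∧ ∀ x ∈ Metric.ball x₀ r, ∀ ρ : ℝ, 0 < ρ → ρ ≤ r →
    Metric.ball x ρ ⊆ D → ‖iteratedDeriv k (fun t : ℝ => f (x + t • e)) 0‖ ≤ C / ρ ^ N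

/-- Near `x₀`, translation by small nonnegative multiples of `e` maps balls in `D` into `D`. -/
def TranslatesInto {E : Type} [NormedAddCommGroup E] [NormedSpace ℝ E]
    (D : Set E) (x₀ e : E) (r : ℝ) : Prop :=
  ∀ x ∈ Metric.ball x₀ r, ∀ ρ : ℝ, 0 < ρ → ρ ≤ r → Metric.ball x ρ ⊆ D →
    ∀ t : ℝ, 0 ≤ t → t ≤ r → Metric.ball (x + t • e) ρ ⊆ D

/-- Near `x₀`, moving in both directions `e₁` and `e₂` leads inside `D`. -/
def MovesInside {E : Type} [NormedAddCommGroup E] [NormedSpace ℝ E]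
    (D : Set E) (x₀ e₁ e₂ : E) (η r : ℝ) : Prop :=
  ∀ x ∈ Metric.ball x₀ r, x ∈ D → ∀ s t : ℝ, 0 < s → s ≤ r → 0 < t → t ≤ r →
    Metric.ball (x + s • e₁ + t • e₂) (η * min s t) ⊆ D

/-- The term j = 0 has coefficient ±1, and the other binomial coefficients add up to 2 ^ a - 1. -/
theorem norm_sum_choose_le {G : Type*} [SeminormedAddCommGroup G] [NormedSpace ℂ G] (a : ℕ)
    (v : ℕ → G) {B C : ℝ} (hB : ∀ j, 1 ≤ j → j ≤ a → ‖v j‖ ≤ B) (hB0 : 0 ≤ B)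
    (hC : ‖∑ j ∈ Finset.range (a + 1), (((-1) ^ (a - j) * (a.choose j : ℤ) : ℤ) : ℂ) • v j‖ ≤ C) :
    ‖v 0‖ ≤ C + 2 ^ a * B := by
  rw [Finset.sum_range_succ'] at hC
  set s := ∑ j ∈ Finset.range a,
    (((-1) ^ (a - (j + 1)) * (a.choose (j + 1) : ℤ) : ℤ) : ℂ) • v (j + 1) with hs
  have h1 : ‖s‖ ≤ 2 ^ a * B := by
    calc ‖s‖ ≤ ∑ j ∈ Finset.range a, (a.choose (j + 1) : ℝ) * B := by
          refine norm_sum_le_of_le _ fun j hj => ?_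
          rw [norm_smul]
          have : ‖(((-1) ^ (a - (j + 1)) * (a.choose (j + 1) : ℤ) : ℤ) : ℂ)‖ = a.choose (j + 1) := by
            push_cast; simp
          rw [this]
          have := hB (j + 1) (by omega) (by have := Finset.mem_range.1 hj; omega)
          gcongr
      _ ≤ 2 ^ a * B := by
          rw [← Finset.sum_mul]
          gcongr
          have := Nat.sum_range_choose a
          rw [Finset.sum_range_succ'] at this
          have h2 : ∑ j ∈ Finset.range a, a.choose (j + 1) ≤ 2 ^ a := by omega
          exact_mod_cast h2
  have h2 : ‖(((-1) ^ (a - 0) * (a.choose 0 : ℤ) : ℤ) : ℂ) • v 0‖ = ‖v 0‖ := by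
    rw [norm_smul]; push_cast; simp
  rw [← h2]
  set q := (((-1) ^ (a - 0) * (a.choose 0 : ℤ) : ℤ) : ℂ) • v 0
  calc ‖q‖ = ‖(s + q) - s‖ := by rw [add_sub_cancel_left]
    _ ≤ ‖s + q‖ + ‖s‖ := norm_sub_le _ _
    _ ≤ _ := add_le_add hC h1

variable {E : Type} [NormedAddCommGroup E] [NormedSpace ℂ E] [NormedSpace ℝ E]
  [IsScalarTower ℝ ℂ E] [FiniteDimensional ℂ E]

theorem contDiffAt_line {f : E → ℂ} {D : Set E} (hD : IsOpen D) (hf : DifferentiableOn ℂ f D)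
    {x e : E} {t : ℝ} (h : x + t • e ∈ D) : ContDiffAt ℝ ∞ (fun s : ℝ => f (x + s • e)) t := by
  have h1 : ContDiffAt ℝ ∞ f (x + t • e) :=
    ((contDiffOn_of_holomorphic hD hf).contDiffAt (hD.mem_nhds h)).restrict_scalars ℝ
  exact h1.comp t (by fun_prop)

/-- A finite difference in the direction `e` trades the growth of a derivative at `x` for its values
at points farther inside. -/
theorem exists_norm_iteratedFDeriv_le_of_translates {f : E → ℂ} {D : Set E} (hD : IsOpen D)
    (hf : DifferentiableOn ℂ f D) {x₀ e : E} {r : ℝ} {N : ℕ}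
    (hg : HasDirectionalGrowth f D x₀ e r N) (ht : TranslatesInto D x₀ e r) (l a : ℕ) :
    ∃ C : ℝ, 0 ≤ C ∧ ∀ x ∈ Metric.ball x₀ (r / 4), ∀ ρ : ℝ, 0 < ρ → ρ ≤ r → Metric.ball x ρ ⊆ D →
      ∀ h : ℝ, 0 < h → h ^ a ≤ ρ ^ (N + l) → a * h ≤ r → a * h * ‖e‖ ≤ r / 4 →
      ∀ B : ℝ, 0 ≤ B → (∀ j : ℕ, 1 ≤ j → j ≤ a → ‖iteratedFDeriv ℂ l f (x + (j * h) • e)‖ ≤ B) →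
      ‖iteratedFDeriv ℂ l f x‖ ≤ C + 2 ^ a * B := by
  obtain ⟨C₁, hC₁, H₁⟩ := hg a
  obtain ⟨C₂, hC₂, H₂⟩ := exists_norm_iteratedFDeriv_le_of_ball (E := E) l
  refine ⟨C₂ * (2 ^ N * C₁) * 2 ^ l, by positivity, ?_⟩
  intro x hx ρ hρ hρr hball h hh hha hhr hhe B hB hBj
  have hx' : dist x x₀ < r / 4 := hx
  have hsub : ∀ y ∈ Metric.ball x (ρ / 2), Metric.ball y (ρ / 2) ⊆ D := fun y hy => by
    refine (Metric.ball_subset_ball' ?_).trans hball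
    have : dist y x < ρ / 2 := hy
    linarith
  -- r / 4 + ρ / 2 is at most 3 r / 4; the remaining r / 4 is room for translations, of length at
  -- most a h ‖e‖.
  have hyx₀ : ∀ y ∈ Metric.ball x (ρ / 2), dist y x₀ < r * (3 / 4) := fun y hy => by
    have h1 : dist y x < ρ / 2 := hy
    linarith [dist_triangle y x x₀]
  have htr : ∀ y ∈ Metric.ball x (ρ / 2), ∀ t : ℝ, 0 ≤ t → t ≤ a * h →
      Metric.ball (y + t • e) (ρ / 2) ⊆ D := fun y hy t ht0 hta =>
    ht y (by have := hyx₀ y hy; rw [Metric.mem_ball]; linarith) _ (by positivity) (by linarith)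
      (hsub y hy) t ht0 (hta.trans hhr)
  have hmemD : ∀ y ∈ Metric.ball x (ρ / 2), ∀ t : ℝ, 0 ≤ t → t ≤ a * h → y + t • e ∈ D :=
    fun y hy t ht0 hta => htr y hy t ht0 hta (Metric.mem_ball_self (by positivity))
  set c : ℕ → ℂ := fun j => (((-1) ^ (a - j) * (a.choose j : ℤ) : ℤ) : ℂ) with hc
  -- The a-th forward difference of f with step h, as a function of the base point. Its smallness
  -- uses that the growth exponent N is the same for all orders: h ^ a then beats ρ ^ (-N), and also
  -- the ρ ^ (-l) lost in Cauchy's estimate.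
  set G : E → ℂ := fun y => ∑ j ∈ Finset.range (a + 1), c j • f (y + ((j : ℝ) * h) • e) with hG
  have hjle : ∀ j ∈ Finset.range (a + 1), (0 : ℝ) ≤ j * h ∧ (j : ℝ) * h ≤ a * h := by
    intro j hj
    have : (j : ℝ) ≤ a := by exact_mod_cast Nat.lt_succ_iff.1 (Finset.mem_range.1 hj)
    exact ⟨by positivity, by gcongr⟩
  have hGM : ∀ y ∈ Metric.ball x (ρ / 2), ‖G y‖ ≤ h ^ a * (C₁ / (ρ / 2) ^ N) := by
    intro y hy
    set φ : ℝ → ℂ := fun t => f (y + t • e) with hφ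
    have h1 := norm_fwdDiff_iter_le (φ := fun j => iteratedDeriv j φ) (a := 0) (h := h)
      (M := C₁ / (ρ / 2) ^ N) hh.le a ?_ ?_
    · rw [iteratedDeriv_zero, fwdDiff_iter_eq_sum_shift] at h1
      have : G y = ∑ k ∈ Finset.range (a + 1), ((-1) ^ (a - k) * (a.choose k : ℤ)) • φ (0 + k • h) := by
        simp only [hG, hφ, zero_add, nsmul_eq_mul, zsmul_eq_mul, smul_eq_mul, hc]
      rwa [this]
    · intro j hj t ht'
      refine hasDerivAt_iteratedDeriv (contDiffAt_line hD hf ?_) j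
      exact hmemD y hy t ht'.1 (by simpa using ht'.2)
    · intro t ht'
      have h2 := H₁ (y + t • e) ?_ (ρ / 2) (by positivity) (by linarith)
        (htr y hy t ht'.1 (by simpa using ht'.2))
      · have h3 := congrFun (iteratedDeriv_comp_const_add a φ t) 0
        rw [add_zero] at h3
        rw [← h3]
        simpa only [hφ, add_smul, add_assoc] using h2
      · have h3 := hyx₀ y hy
        have h4 : dist (y + t • e) y ≤ a * h * ‖e‖ := by
          rw [dist_self_add_left, norm_smul, Real.norm_of_nonneg ht'.1]
          have := ht'.2
          gcongr
          simpa using this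
        rw [Metric.mem_ball]
        linarith [dist_triangle (y + t • e) y x₀]
  have hfj : ∀ j ∈ Finset.range (a + 1), ∀ y ∈ Metric.ball x (ρ / 2),
      DifferentiableAt ℂ (fun y => f (y + ((j : ℝ) * h) • e)) y := by
    intro j hj y hy
    have : DifferentiableAt ℂ f (y + ((j : ℝ) * h) • e) :=
      hf.differentiableAt (hD.mem_nhds (hmemD y hy _ (hjle j hj).1 (hjle j hj).2))
    exact this.comp y (by fun_prop)
  have hGd : DifferentiableOn ℂ G (Metric.ball x (ρ / 2)) := fun y hy =>
    (DifferentiableAt.fun_sum fun j hj => (hfj j hj y hy).const_smul (c j)).differentiableWithinAt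
  have hxρ : x ∈ Metric.ball x (ρ / 2) := Metric.mem_ball_self (by positivity)
  have h3 := H₂ (by positivity) hGd hGM
  have hcd : ∀ j ∈ Finset.range (a + 1), ContDiffAt ℂ l (fun y => f (y + ((j : ℝ) * h) • e)) x := by
    intro j hj
    have hd : DifferentiableOn ℂ (fun y => f (y + ((j : ℝ) * h) • e)) (Metric.ball x (ρ / 2)) :=
      fun y hy => (hfj j hj y hy).differentiableWithinAt
    exact (contDiffOn_of_holomorphic_nat l Metric.isOpen_ball hd).contDiffAt
      (Metric.ball_mem_nhds x (by positivity))
  have h4 : iteratedFDeriv ℂ l G x =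
      ∑ j ∈ Finset.range (a + 1), c j • iteratedFDeriv ℂ l f (x + ((j : ℝ) * h) • e) := by
    rw [hG, iteratedFDeriv_finset_sum_apply _ fun j hj => (hcd j hj).const_smul (c j)]
    refine Finset.sum_congr rfl fun j hj => ?_
    rw [iteratedFDeriv_const_smul_apply' (hcd j hj), iteratedFDeriv_comp_add_right]
  rw [h4] at h3
  have h5 := norm_sum_choose_le a (fun j => iteratedFDeriv ℂ l f (x + ((j : ℝ) * h) • e)) hBj hB h3
  simp only [Nat.cast_zero, zero_mul, zero_smul, add_zero] at h5
  refine h5.trans (add_le_add_left ?_ _)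
  have h6 : h ^ a / ρ ^ (N + l) ≤ 1 := by rw [div_le_one (by positivity)]; exact hha
  calc C₂ * (h ^ a * (C₁ / (ρ / 2) ^ N)) / (ρ / 2) ^ l
      = C₂ * (2 ^ N * C₁) * 2 ^ l * (h ^ a / ρ ^ (N + l)) := by
        rw [div_pow, div_pow, pow_add]; field_simp
    _ ≤ C₂ * (2 ^ N * C₁) * 2 ^ l * 1 := by gcongr
    _ = _ := mul_one _

/-- The difference estimate is used along e₁ and then along e₂, with a step h proportional to ρ ^ (1
/ P). The points reached are about h away from the complement of D, where Cauchy's estimate gives h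
^ (-N - l). The choice P = 2 (N + l) turns this into ρ ^ (-1/2), and a = P (N + l) ensures h ^ a ≤ ρ
^ (N + l). -/
theorem exists_norm_iteratedFDeriv_le_div_sqrt {f : E → ℂ} {D : Set E} (hD : IsOpen D)
    (hf : DifferentiableOn ℂ f D) {x₀ e₁ e₂ : E} {r η : ℝ} {N : ℕ} (hN : 1 ≤ N) (hr : 0 < r)
    (hr1 : r ≤ 1) (hη : 0 < η) (hη1 : η ≤ 1)
    (hg₁ : HasDirectionalGrowth f D x₀ e₁ r N) (hg₂ : HasDirectionalGrowth f D x₀ e₂ r N)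
    (ht₁ : TranslatesInto D x₀ e₁ r) (ht₂ : TranslatesInto D x₀ e₂ r)
    (hm : MovesInside D x₀ e₁ e₂ η r) (l : ℕ) :
    ∃ C : ℝ, 0 ≤ C ∧ ∀ x ∈ Metric.ball x₀ (r / 8), ∀ ρ : ℝ, 0 < ρ → ρ ≤ r →
      Metric.ball x ρ ⊆ D → ‖iteratedFDeriv ℂ l f x‖ ≤ C / √ρ := by
  set P : ℕ := 2 * (N + l) with hP
  set a : ℕ := P * (N + l) with ha
  obtain ⟨Ca, hCa, Ha⟩ := exists_norm_iteratedFDeriv_le_of_translates hD hf hg₁ ht₁ l a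
  obtain ⟨Cb, hCb, Hb⟩ := exists_norm_iteratedFDeriv_le_of_translates hD hf hg₂ ht₂ l a
  -- Order zero: the growth of f itself.
  obtain ⟨C₀, hC₀, H₀⟩ := hg₁ 0
  obtain ⟨C₂, hC₂, H₂⟩ := exists_norm_iteratedFDeriv_le_of_ball (E := E) l
  have hNl : 1 ≤ N + l := by omega
  have hP1 : 1 ≤ P := by omega
  have ha1 : 1 ≤ a := Nat.mul_pos hP1 hNl
  have ha1' : (1 : ℝ) ≤ a := by exact_mod_cast ha1
  set R : ℝ := 1 + ‖e₁‖ + ‖e₂‖ with hR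
  have hR1 : 1 ≤ R := by have := norm_nonneg e₁; have := norm_nonneg e₂; linarith
  -- Keeps every displacement j h ‖e₁‖ and j h ‖e₂‖ below r / 16, so that two of them, from a point
  -- within r / 8 of x₀, end within r / 4.
  set κ : ℝ := r / (16 * a * R) with hκ
  have hκ0 : 0 < κ := by positivity
  have hκ1 : κ ≤ 1 := by
    rw [hκ, div_le_one (by positivity)]
    have : 1 ≤ a * R := one_le_mul_of_one_le_of_one_le ha1' hR1
    nlinarith
  set C₃ : ℝ := C₂ * C₀ / (η * κ / 2) ^ (N + l) with hC₃
  have hC₃0 : 0 ≤ C₃ := by positivity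
  refine ⟨Ca + 2 ^ a * (Cb + 2 ^ a * C₃), by positivity, ?_⟩
  intro x hx ρ hρ hρr hball
  have hx' : dist x x₀ < r / 8 := hx
  set τ : ℝ := ρ ^ ((P : ℝ)⁻¹) with hτ
  have hτ0 : 0 < τ := Real.rpow_pos_of_pos hρ _
  have hτP : τ ^ P = ρ := Real.rpow_inv_natCast_pow hρ.le (by omega)
  have hρ1 : ρ ≤ 1 := hρr.trans hr1
  have hτ1 : τ ≤ 1 := Real.rpow_le_one hρ.le hρ1 (by positivity)
  have hτs : τ ^ (N + l) = √ρ := by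
    rw [eq_comm, Real.sqrt_eq_iff_mul_self_eq hρ.le (by positivity), ← pow_add, ← hτP, hP]
    congr 1; ring
  set h : ℝ := κ * τ with hh
  have hh0 : 0 < h := by positivity
  have hha : h ^ a ≤ ρ ^ (N + l) := by
    rw [← hτP, ← pow_mul, hh, mul_pow]
    exact mul_le_of_le_one_left (by positivity) (pow_le_one₀ hκ0.le hκ1)
  have hahR : a * h * R ≤ r / 16 := by
    have : a * h * R = r / 16 * τ := by rw [hh, hκ]; field_simp
    rw [this]
    exact mul_le_of_le_one_right (by positivity) hτ1
  have hah : a * h ≤ r / 16 := by nlinarith [mul_pos (by positivity : (0 : ℝ) < a) hh0]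
  have hae₁ : a * h * ‖e₁‖ ≤ r / 16 := by
    refine le_trans ?_ hahR
    have := norm_nonneg e₂
    gcongr; linarith
  have hae₂ : a * h * ‖e₂‖ ≤ r / 16 := by
    refine le_trans ?_ hahR
    have := norm_nonneg e₁
    gcongr; linarith
  have hh1 : h ≤ r / 16 := by nlinarith
  have hjh : ∀ j : ℕ, 1 ≤ j → j ≤ a → h ≤ j * h ∧ j * h ≤ a * h := by
    intro j hj hja
    have h1 : (1 : ℝ) ≤ j := by exact_mod_cast hj
    have h2 : (j : ℝ) ≤ a := by exact_mod_cast hja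
    exact ⟨by nlinarith, by gcongr⟩
  have hdist : ∀ (y e : E) (j : ℕ), 1 ≤ j → j ≤ a → a * h * ‖e‖ ≤ r / 16 →
      dist (y + (j * h) • e) y ≤ r / 16 := by
    intro y e j hj hja he
    rw [dist_self_add_left, norm_smul, Real.norm_of_nonneg (by positivity)]
    refine le_trans ?_ he
    have := (hjh j hj hja).2
    gcongr
  have hBp : ∀ j j' : ℕ, 1 ≤ j → j ≤ a → 1 ≤ j' → j' ≤ a →
      ‖iteratedFDeriv ℂ l f (x + (j * h) • e₁ + (j' * h) • e₂)‖ ≤ C₃ / √ρ := by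
    intro j j' hj hja hj' hja'
    set p := x + (j * h) • e₁ + (j' * h) • e₂ with hp
    have hpb : Metric.ball p (η * h) ⊆ D := by
      refine (Metric.ball_subset_ball ?_).trans (hm x (by rw [Metric.mem_ball]; linarith)
        (hball (Metric.mem_ball_self hρ)) (j * h) (j' * h) (by positivity)
        (by have := (hjh j hj hja).2; linarith) (by positivity)
        (by have := (hjh j' hj' hja').2; linarith))
      gcongr
      exact le_min (hjh j hj hja).1 (hjh j' hj' hja').1
    have hpd : dist p x₀ ≤ r / 4 := by
      have h1 := hdist x e₁ j hj hja hae₁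
      have h2 := hdist (x + (j * h) • e₁) e₂ j' hj' hja' hae₂
      have h3 := dist_triangle p (x + (j * h) • e₁) x₀
      have h4 := dist_triangle (x + (j * h) • e₁) x x₀
      linarith
    have hηh : η * h ≤ r / 16 := (mul_le_of_le_one_left hh0.le hη1).trans hh1
    have hηh0 : 0 < η * h := by positivity
    have hsub : Metric.ball p (η * h / 2) ⊆ D := (Metric.ball_subset_ball (by linarith)).trans hpb
    have h5 := H₂ (by positivity : 0 < η * h / 2) (hf.mono hsub) (M := C₀ / (η * h / 2) ^ N) ?_
    · refine h5.trans (le_of_eq ?_)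
      rw [hC₃, ← hτs, hh, div_div, ← mul_pow, show η * κ / 2 * τ = η * (κ * τ) / 2 by ring, pow_add]
      field_simp
    · intro y hy
      have hy' : dist y p < η * h / 2 := hy
      have := H₀ y (by rw [Metric.mem_ball]; linarith [dist_triangle y p x₀]) (η * h / 2)
        (by positivity) (by linarith)
        ((Metric.ball_subset_ball' (by linarith)).trans hpb)
      simpa using this
  have hsq : 0 < √ρ := Real.sqrt_pos.2 hρ
  have hx1 : ∀ j : ℕ, 1 ≤ j → j ≤ a →
      ‖iteratedFDeriv ℂ l f (x + (j * h) • e₁)‖ ≤ Cb + 2 ^ a * (C₃ / √ρ) := by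
    intro j hj hja
    -- The radius ρ is still admissible at the shifted point: translation along e₁ keeps balls of
    -- radius ρ inside D.
    refine Hb (x + (j * h) • e₁) ?_ ρ hρ hρr ?_ h hh0 hha (by linarith) (by linarith) _
      (by positivity) fun j' hj' hja' => hBp j j' hj hja hj' hja'
    · have h1 := hdist x e₁ j hj hja hae₁
      rw [Metric.mem_ball]
      linarith [dist_triangle (x + (j * h) • e₁) x x₀]
    · exact ht₁ x (by rw [Metric.mem_ball]; linarith) ρ hρ hρr hball _ (by positivity)
        (by have := (hjh j hj hja).2; linarith)
  have hx0 := Ha x (by rw [Metric.mem_ball]; linarith) ρ hρ hρr hball h hh0 hha (by linarith)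
    (by linarith) _ (by positivity) hx1
  refine hx0.trans ?_
  have hs1 : √ρ ≤ 1 := Real.sqrt_le_one.2 hρ1
  have hle : ∀ c : ℝ, 0 ≤ c → c ≤ c / √ρ := fun c hc => le_div_self hc hsq hs1
  calc Ca + 2 ^ a * (Cb + 2 ^ a * (C₃ / √ρ))
      ≤ Ca / √ρ + 2 ^ a * (Cb / √ρ + 2 ^ a * (C₃ / √ρ)) := by
        gcongr
        · exact hle _ hCa
        · exact hle _ hCb
    _ = _ := by ring

/-- Polynomial growth of all derivatives in the two directions `e₁` and `e₂`, of an order that does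
not depend on the derivative, forces all derivatives to be bounded. -/
theorem exists_norm_iteratedFDeriv_le_of_growth {f : E → ℂ} {D : Set E} (hD : IsOpen D)
    (hf : DifferentiableOn ℂ f D) {x₀ e₁ e₂ : E} {r η : ℝ} {N : ℕ} (hN : 1 ≤ N) (hr : 0 < r)
    (hr1 : r ≤ 1) (hη : 0 < η) (hη1 : η ≤ 1)
    (hg₁ : HasDirectionalGrowth f D x₀ e₁ r N) (hg₂ : HasDirectionalGrowth f D x₀ e₂ r N)
    (ht₁ : TranslatesInto D x₀ e₁ r) (ht₂ : TranslatesInto D x₀ e₂ r)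
    (hm : MovesInside D x₀ e₁ e₂ η r) :
    ∃ r' > 0, ∀ l : ℕ, ∃ C : ℝ, ∀ x ∈ Metric.ball x₀ r', x ∈ D → ‖iteratedFDeriv ℂ l f x‖ ≤ C := by
  refine ⟨r / 16, by positivity, fun l => ?_⟩
  obtain ⟨C₀, hC₀, H₀⟩ := exists_norm_iteratedFDeriv_le_div_sqrt hD hf hN hr hr1 hη hη1 hg₁ hg₂
    ht₁ ht₂ hm l
  obtain ⟨C₁, hC₁, H₁⟩ := exists_norm_iteratedFDeriv_le_div_sqrt hD hf hN hr hr1 hη hη1 hg₁ hg₂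
    ht₁ ht₂ hm (l + 1)
  set e := e₁ + e₂ with he
  set τ : ℝ := r / (16 * (1 + ‖e‖)) with hτ
  have he0 := norm_nonneg e
  have hτ0 : 0 < τ := by positivity
  have hτe : τ * (1 + ‖e‖) = r / 16 := by rw [hτ]; field_simp
  have hτr : τ ≤ r / 16 := by nlinarith
  refine ⟨C₀ / √(η * τ) + 2 * (C₁ * ‖e‖ / √η) * √τ, fun x hx hxD => ?_⟩
  have hx' : dist x x₀ < r / 16 := hx
  -- Along the diagonal direction e = e₁ + e₂ the distance to the complement of D grows at least
  -- like η t, whatever the position of x.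
  have hin : ∀ t, 0 < t → t ≤ τ → Metric.ball (x + t • e) (η * t) ⊆ D := by
    intro t ht htτ
    have := hm x (by rw [Metric.mem_ball]; linarith) hxD t t ht (by linarith) ht (by linarith)
    rwa [min_self, add_assoc, ← smul_add] at this
  have hnear : ∀ t, 0 ≤ t → t ≤ τ → x + t • e ∈ Metric.ball x₀ (r / 8) := by
    intro t ht htτ
    have h1 : dist (x + t • e) x ≤ r / 16 := by
      rw [dist_self_add_left, norm_smul, Real.norm_of_nonneg ht]
      nlinarith
    rw [Metric.mem_ball]
    linarith [dist_triangle (x + t • e) x x₀]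
  set g : ℝ → E [×l]→L[ℂ] ℂ := fun t => iteratedFDeriv ℂ l f (x + t • e) with hg
  have hmem : ∀ t, 0 ≤ t → t ≤ τ → x + t • e ∈ D := by
    intro t ht htτ
    rcases ht.eq_or_lt with rfl | ht
    · simpa using hxD
    · exact hin t ht htτ (Metric.mem_ball_self (by positivity))
  have hgd : ∀ t, 0 ≤ t → t ≤ τ →
      HasDerivAt g (fderiv ℂ (iteratedFDeriv ℂ l f) (x + t • e) e) t := by
    intro t ht htτ
    have h1 : DifferentiableAt ℂ (iteratedFDeriv ℂ l f) (x + t • e) :=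
      ((contDiffOn_of_holomorphic hD hf).contDiffAt
        (hD.mem_nhds (hmem t ht htτ))).differentiableAt_iteratedFDeriv
        (by exact_mod_cast ENat.natCast_lt_top l)
    have h2 := (h1.hasFDerivAt.restrictScalars ℝ)
    have h3 : HasDerivAt (fun t : ℝ => x + t • e) e t := by
      simpa using ((hasDerivAt_id t).smul_const e).const_add x
    exact h2.comp_hasDerivAt t h3
  have hgb : ∀ t, 0 < t → t ≤ τ →
      ‖fderiv ℂ (iteratedFDeriv ℂ l f) (x + t • e) e‖ ≤ C₁ * ‖e‖ / √η / √t := by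
    intro t ht htτ
    refine (ContinuousLinearMap.le_opNorm _ _).trans ?_
    rw [norm_fderiv_iteratedFDeriv]
    have h1 := H₁ (x + t • e) (hnear t ht.le htτ) (η * t) (by positivity)
      ((mul_le_of_le_one_left ht.le hη1).trans (by linarith)) (hin t ht htτ)
    rw [Real.sqrt_mul hη.le] at h1
    calc _ ≤ C₁ / (√η * √t) * ‖e‖ := by gcongr
      _ = _ := by field_simp
  set A := C₁ * ‖e‖ / √η with hA
  have hA0 : 0 ≤ A := by positivity
  -- Integrates the bound A / √t, with 2 A √t as majorant. The majorant is not differentiable at 0,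
  -- so the integration starts at ε > 0 and ε tends to 0 afterwards.
  have hstep : ∀ ε, 0 < ε → ε ≤ τ → ‖g τ - g ε‖ ≤ 2 * A * √τ := by
    intro ε hε hετ
    have hB : ∀ t ∈ Ico ε τ, HasDerivAt (fun t => 2 * A * √t) (A / √t) t := by
      intro t ht
      have ht0 : 0 < t := hε.trans_le ht.1
      have h1 := (Real.hasDerivAt_sqrt ht0.ne').const_mul (2 * A)
      have h2 : 2 * A * (1 / (2 * √t)) = A / √t := by
        have := Real.sqrt_pos.2 ht0
        rw [div_eq_mul_inv A]
        field_simp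
      rwa [h2] at h1
    refine image_norm_le_of_norm_deriv_right_le_deriv_boundary' (f := fun t => g t - g ε)
      (f' := fun t => fderiv ℂ (iteratedFDeriv ℂ l f) (x + t • e) e) (a := ε) (b := τ)
      (B := fun t => 2 * A * √t) (B' := fun t => A / √t) ?_ ?_ ?_ ?_ ?_ ?_ ⟨hετ, le_rfl⟩
    · intro t ht
      exact ((hgd t (hε.le.trans ht.1) ht.2).continuousAt.sub
        continuousAt_const).continuousWithinAt
    · intro t ht
      exact ((hgd t (hε.le.trans ht.1) ht.2.le).sub_const _).hasDerivWithinAt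
    · simp only [sub_self, norm_zero]; positivity
    · fun_prop
    · intro t ht; exact (hB t ht).hasDerivWithinAt
    · intro t ht; exact hgb t (hε.trans_le ht.1) ht.2.le
  have hlim : Tendsto (fun ε => ‖g τ - g ε‖) (𝓝[>] 0) (𝓝 ‖g τ - g 0‖) :=
    (((hgd 0 le_rfl hτ0.le).continuousAt.const_sub (g τ)).norm).mono_left nhdsWithin_le_nhds
  have h0 : ‖g τ - g 0‖ ≤ 2 * A * √τ := by
    refine le_of_tendsto hlim ?_
    filter_upwards [Ioc_mem_nhdsGT hτ0] with ε hε using hstep ε hε.1 hε.2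
  have hτb := H₀ (x + τ • e) (hnear τ hτ0.le le_rfl) (η * τ) (by positivity)
    ((mul_le_of_le_one_left hτ0.le hη1).trans (by linarith)) (hin τ hτ0 le_rfl)
  have hg0 : g 0 = iteratedFDeriv ℂ l f x := by simp [hg]
  rw [← hg0]
  calc ‖g 0‖ = ‖g τ - (g τ - g 0)‖ := by rw [sub_sub_cancel]
    _ ≤ ‖g τ‖ + ‖g τ - g 0‖ := norm_sub_le _ _
    _ ≤ _ := add_le_add hτb h0

end Growth

/-! ### Smooth extension to the closure of a set with interior cones. -/

section Extension

variable {E : Type} [NormedAddCommGroup E] [NormedSpace ℝ E]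

/-- Near `p`, the set `D` contains a truncated open cone with axis `e` at each of its points. -/
def HasInteriorCones (D : Set E) (p e : E) (η r : ℝ) : Prop :=
  ∀ x ∈ Metric.ball p r, x ∈ D → ∀ t : ℝ, 0 < t → t ≤ r → Metric.ball (x + t • e) (η * t) ⊆ D

theorem HasInteriorCones.of_mem_ball {D : Set E} {p e : E} {η r : ℝ}
    (h : HasInteriorCones D p e η r) {q : E} (hq : q ∈ Metric.ball p (r / 2)) :
    HasInteriorCones D q e η (r / 2) := fun x hx hxD t ht htr => by
  have hq' : dist q p < r / 2 := hq
  have := dist_nonneg (x := q) (y := p)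
  exact h x (Metric.ball_subset_ball' (by linarith) hx) hxD t ht (by linarith)

/-- A function with bounded derivative on a set with interior cones is locally Lipschitz up to the
boundary. -/
theorem HasInteriorCones.exists_norm_sub_le {D : Set E} {p e : E} {η r : ℝ} (hη : 0 < η)
    (hc : HasInteriorCones D p e η r) :
    ∃ C κ : ℝ, 0 ≤ C ∧ 0 < κ ∧ κ ≤ 1 ∧ ∀ {F : Type} [NormedAddCommGroup F] [NormedSpace ℝ F]
      {f : E → F} {s M : ℝ}, 0 < s → s ≤ r → 0 ≤ M → (∀ x ∈ D, DifferentiableAt ℝ f x) →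
      (∀ x ∈ Metric.ball p s, x ∈ D → ‖fderiv ℝ f x‖ ≤ M) →
      ∀ x ∈ Metric.ball p (κ * s), x ∈ D → ∀ y ∈ Metric.ball p (κ * s), y ∈ D →
        ‖f y - f x‖ ≤ C * M * ‖y - x‖ := by
  have he := norm_nonneg e
  -- Chosen to fit the whole path into the ball of radius s: κ s for the starting point, the shift
  -- along e, and 4 κ s for the ball about the shifted point (see `hsum`).
  set κ : ℝ := (5 + 4 * (‖e‖ + 1) / η)⁻¹ with hκ
  have hκ0 : 0 < κ := by positivity
  have hκe : κ * (5 + 4 * (‖e‖ + 1) / η) = 1 := inv_mul_cancel₀ (by positivity)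
  have hκ1 : κ ≤ 1 := inv_le_one_of_one_le₀ (by
    have : 0 ≤ 4 * (‖e‖ + 1) / η := by positivity
    linarith)
  refine ⟨1 + 4 * ‖e‖ / η, κ, by positivity, hκ0, hκ1, ?_⟩
  intro F _ _ f s M hs hsr hM hf hfM x hx hxD y hy hyD
  rcases eq_or_ne x y with rfl | hxy
  · simp
  set d := ‖y - x‖ with hd
  have hd0 : 0 < d := norm_pos_iff.2 (sub_ne_zero.2 hxy.symm)
  have hx' : dist x p < κ * s := hx
  have hy' : dist y p < κ * s := hy
  have hd2 : d < 2 * (κ * s) := by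
    rw [hd, ← dist_eq_norm]
    linarith [dist_triangle_right y x p]
  -- The path from x to y goes inward along e for time t, then across, then back. Since η t = 2 d,
  -- the ball in the cone at x contains y + t • e, and being convex it contains the crossing.
  set t : ℝ := 2 * d / η with ht
  have ht0 : 0 < t := by positivity
  have hηt : η * t = 2 * d := by rw [ht]; field_simp
  have htκ : t < 4 * (κ * s) / η := by
    rw [ht]; exact div_lt_div_of_pos_right (by linarith) hη
  have hsum : κ * s + (4 * (κ * s) / η) * (‖e‖ + 1) + 4 * (κ * s) = s := by
    calc _ = κ * (5 + 4 * (‖e‖ + 1) / η) * s := by field_simp; ring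
      _ = s := by rw [hκe, one_mul]
  have hκs : 0 < κ * s := by positivity
  have hte : t * (‖e‖ + 1) ≤ (4 * (κ * s) / η) * (‖e‖ + 1) := by gcongr
  have htr : t ≤ r := by nlinarith
  have hsegmem : ∀ z, dist z p < κ * s → z ∈ D → ∀ q ∈ segment ℝ z (z + t • e),
      q ∈ D ∧ q ∈ Metric.ball p s := by
    intro z hz hzD q hq
    rw [segment_eq_image'] at hq
    obtain ⟨θ, ⟨hθ0, hθ1⟩, rfl⟩ := hq
    simp only [add_sub_cancel_left, smul_smul]
    have hθt : θ * t ≤ t := mul_le_of_le_one_left ht0.le hθ1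
    constructor
    · rcases hθ0.eq_or_lt with rfl | hθ
      · simpa using hzD
      · exact hc z (by rw [Metric.mem_ball]; nlinarith) hzD (θ * t) (by positivity)
          (hθt.trans htr) (Metric.mem_ball_self (by positivity))
    · have h1 : dist (z + (θ * t) • e) z ≤ t * ‖e‖ := by
        rw [dist_self_add_left, norm_smul, Real.norm_of_nonneg (by positivity)]
        gcongr
      rw [Metric.mem_ball]
      have := dist_triangle (z + (θ * t) • e) z p
      nlinarith
  have hseg : ∀ z, dist z p < κ * s → z ∈ D → ‖f (z + t • e) - f z‖ ≤ M * (t * ‖e‖) := by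
    intro z hz hzD
    have := (convex_segment z (z + t • e)).norm_image_sub_le_of_norm_fderiv_le (𝕜 := ℝ) (f := f)
      (C := M) (fun q hq => hf q (hsegmem z hz hzD q hq).1)
      (fun q hq => hfM q (hsegmem z hz hzD q hq).2 (hsegmem z hz hzD q hq).1)
      (left_mem_segment ℝ _ _) (right_mem_segment ℝ _ _)
    rwa [add_sub_cancel_left, norm_smul, Real.norm_of_nonneg ht0.le] at this
  have h1 := hseg x hx' hxD
  have h2 := hseg y hy' hyD
  have hballD : Metric.ball (x + t • e) (η * t) ⊆ D :=
    hc x (by rw [Metric.mem_ball]; nlinarith) hxD t ht0 htr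
  have hballs : Metric.ball (x + t • e) (η * t) ⊆ Metric.ball p s := by
    refine Metric.ball_subset_ball' ?_
    have h1 : dist (x + t • e) x = t * ‖e‖ := by
      rw [dist_self_add_left, norm_smul, Real.norm_of_nonneg ht0.le]
    have := dist_triangle (x + t • e) x p
    nlinarith
  have h3 : ‖f (y + t • e) - f (x + t • e)‖ ≤ M * d := by
    have := (convex_ball (x + t • e) (η * t)).norm_image_sub_le_of_norm_fderiv_le (𝕜 := ℝ) (f := f)
      (C := M) (x := x + t • e) (y := y + t • e) (fun q hq => hf q (hballD hq))
      (fun q hq => hfM q (hballs hq) (hballD hq))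
      (Metric.mem_ball_self (by positivity))
      (by rw [Metric.mem_ball, dist_add_right, dist_eq_norm, hηt]; linarith)
    simpa using this
  have h4 : f y - f x = (f (x + t • e) - f x) + (f (y + t • e) - f (x + t • e)) -
      (f (y + t • e) - f y) := by abel
  rw [h4]
  calc _ ≤ ‖f (x + t • e) - f x‖ + ‖f (y + t • e) - f (x + t • e)‖ + ‖f (y + t • e) - f y‖ :=
        (norm_sub_le _ _).trans (add_le_add_left (norm_add_le _ _) _)
    _ ≤ M * (t * ‖e‖) + M * d + M * (t * ‖e‖) := by gcongr
    _ = _ := by rw [ht]; field_simp; ring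

/-- A Lipschitz map sends the Cauchy filter `𝓝[D] q` to a Cauchy filter, so the limit behind
`extendFrom` exists. -/
theorem tendsto_extendFrom_of_norm_sub_le {E F : Type} [NormedAddCommGroup E]
    [NormedAddCommGroup F] [CompleteSpace F]
    {D : Set E} {f : E → F} {p q : E} {s K : ℝ} (hK : 0 ≤ K)
    (h : ∀ x ∈ Metric.ball p s, x ∈ D → ∀ y ∈ Metric.ball p s, y ∈ D → ‖f y - f x‖ ≤ K * ‖y - x‖)
    (hq : q ∈ Metric.ball p s) (hqD : q ∈ closure D) :
    Tendsto f (𝓝[D] q) (𝓝 (extendFrom D f q)) := by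
  refine tendsto_extendFrom ?_
  have : NeBot (𝓝[D] q) := mem_closure_iff_nhdsWithin_neBot.1 hqD
  have hcau : Cauchy (𝓝[D] q) := cauchy_nhds.mono nhdsWithin_le_nhds
  have hl : LipschitzOnWith ⟨K, hK⟩ f (D ∩ Metric.ball p s) :=
    LipschitzOnWith.of_dist_le_mul fun x hx y hy => by
      rw [dist_eq_norm, dist_eq_norm]
      exact h y hy.2 hy.1 x hx.2 hx.1
  have hle : 𝓝[D] q ≤ 𝓟 (D ∩ Metric.ball p s) := by
    rw [le_principal_iff]
    exact inter_mem self_mem_nhdsWithin (nhdsWithin_le_nhds (Metric.isOpen_ball.mem_nhds hq))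
  exact cauchy_iff_exists_le_nhds.1 (hcau.map_of_le hl.uniformContinuousOn hle)

/-- With L the limit of the derivative at p, the derivative of f - L is small near p. The Lipschitz
estimate has the same constant C at every scale, so the increments of f - L are at most ε times the
distance; limits carry this to the closure. -/
theorem HasInteriorCones.hasFDerivWithinAt_extendFrom {F : Type} [NormedAddCommGroup F]
    [NormedSpace ℝ F] [CompleteSpace F] {D : Set E} (hD : IsOpen D) {p e : E} {η r M₁ M₂ : ℝ}
    (hη : 0 < η) (hr : 0 < r) (hc : HasInteriorCones D p e η r) (hp : p ∈ closure D) {f : E → F}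
    (hf : ContDiffOn ℝ ∞ f D) (h₁ : ∀ x ∈ Metric.ball p r, x ∈ D → ‖fderiv ℝ f x‖ ≤ M₁)
    (h₂ : ∀ x ∈ Metric.ball p r, x ∈ D → ‖fderiv ℝ (fderiv ℝ f) x‖ ≤ M₂) :
    HasFDerivWithinAt (extendFrom D f) (extendFrom D (fderiv ℝ f) p) (closure D) p := by
  obtain ⟨C, κ, hC, hκ, hκ1, H⟩ := hc.exists_norm_sub_le hη
  have hκr : 0 < κ * r := by positivity
  obtain ⟨z, hzD, hz⟩ : ∃ z ∈ D, z ∈ Metric.ball p r := by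
    obtain ⟨z, hz, hzD⟩ := mem_closure_iff_nhds.1 hp _ (Metric.ball_mem_nhds p hr)
    exact ⟨z, hzD, hz⟩
  have hM₁ : 0 ≤ M₁ := (norm_nonneg _).trans (h₁ z hz hzD)
  have hM₂ : 0 ≤ M₂ := le_trans (norm_nonneg (fderiv ℝ (fderiv ℝ f) z)) (h₂ z hz hzD)
  have hfd : ∀ x ∈ D, DifferentiableAt ℝ f x := fun x hx =>
    (hf.differentiableOn (by simp)).differentiableAt (hD.mem_nhds hx)
  have hfd' : ∀ x ∈ D, DifferentiableAt ℝ (fderiv ℝ f) x := fun x hx =>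
    ((hf.fderiv_of_isOpen hD (m := 1) (by norm_cast)).differentiableOn (by simp)).differentiableAt
      (hD.mem_nhds hx)
  have hlim : ∀ q ∈ Metric.ball p (κ * r), q ∈ closure D →
      Tendsto f (𝓝[D] q) (𝓝 (extendFrom D f q)) := fun q hq hqD =>
    tendsto_extendFrom_of_norm_sub_le (by positivity) (H hr le_rfl hM₁ hfd h₁) hq hqD
  set L := extendFrom D (fderiv ℝ f) p with hL
  have hlimL : Tendsto (fderiv ℝ f) (𝓝[D] p) (𝓝 L) :=
    tendsto_extendFrom_of_norm_sub_le (by positivity) (H hr le_rfl hM₂ hfd' h₂)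
      (Metric.mem_ball_self hκr) hp
  refine HasFDerivWithinAt.of_isLittleO (Asymptotics.IsLittleO.of_bound fun ε hε => ?_)
  have hnear : ∀ᶠ x in 𝓝[D] p, ‖fderiv ℝ f x - L‖ < ε / (C + 1) := by
    have := (Metric.tendsto_nhds.1 hlimL) (ε / (C + 1)) (by positivity)
    simpa only [dist_eq_norm] using this
  obtain ⟨δ', hδ', hδ⟩ := Metric.eventually_nhds_iff_ball.1 (eventually_nhdsWithin_iff.1 hnear)
  set δ := min δ' r with hδd
  have hδ0 : 0 < δ := lt_min hδ' hr
  have hκδ : 0 < κ * δ := by positivity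
  have key : ∀ x ∈ Metric.ball p (κ * δ), x ∈ D → ∀ y ∈ Metric.ball p (κ * δ), y ∈ D →
      ‖(f y - L y) - (f x - L x)‖ ≤ C * (ε / (C + 1)) * ‖y - x‖ := by
    refine H (f := fun y => f y - L y) hδ0 (min_le_right _ _) (by positivity)
      (fun x hx => (hfd x hx).sub L.differentiableAt) fun x hx hxD => ?_
    rw [fderiv_fun_sub (hfd x hxD) L.differentiableAt, L.fderiv]
    exact (hδ x (Metric.ball_subset_ball (min_le_left _ _) hx) hxD).le
  have hin : ∀ q, q ∈ Metric.ball p (κ * δ) → q ∈ Metric.ball p (κ * r) := fun q hq =>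
    Metric.ball_subset_ball (by gcongr; exact min_le_right _ _) hq
  have hpin : p ∈ Metric.ball p (κ * δ) := Metric.mem_ball_self hκδ
  have hlim2 : ∀ q ∈ Metric.ball p (κ * δ), q ∈ closure D →
      Tendsto (fun y => f y - L y) (𝓝[D] q) (𝓝 (extendFrom D f q - L q)) := fun q hq hqD =>
    (hlim q (hin q hq) hqD).sub (L.continuous.continuousAt.mono_left nhdsWithin_le_nhds)
  have hid : ∀ q : E, Tendsto (fun y : E => y) (𝓝[D] q) (𝓝 q) := fun q =>
    tendsto_id.mono_left nhdsWithin_le_nhds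
  have hevD : ∀ q ∈ Metric.ball p (κ * δ), ∀ᶠ y in 𝓝[D] q, y ∈ Metric.ball p (κ * δ) ∧ y ∈ D :=
    fun q hq => Filter.Eventually.and
      (nhdsWithin_le_nhds (Metric.isOpen_ball.mem_nhds hq)) self_mem_nhdsWithin
  have step : ∀ q ∈ Metric.ball p (κ * δ), q ∈ closure D →
      ‖(extendFrom D f q - L q) - (extendFrom D f p - L p)‖ ≤ C * (ε / (C + 1)) * ‖q - p‖ := by
    intro q hq hqD
    have : NeBot (𝓝[D] q) := mem_closure_iff_nhdsWithin_neBot.1 hqD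
    have : NeBot (𝓝[D] p) := mem_closure_iff_nhdsWithin_neBot.1 hp
    -- Limits in two turns within D: y → q, and for each such y, x → p.
    refine le_of_tendsto_of_tendsto ((hlim2 q hq hqD).sub_const _).norm
      (((hid q).sub_const p).norm.const_mul _) ?_
    filter_upwards [hevD q hq] with y hy
    refine le_of_tendsto_of_tendsto ((hlim2 p hpin hp).const_sub _).norm
      (((hid p).const_sub y).norm.const_mul _) ?_
    filter_upwards [hevD p hpin] with x hx
    exact key x hx.1 hx.2 y hy.1 hy.2
  have hCε : C * (ε / (C + 1)) ≤ ε := by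
    rw [mul_div_assoc', div_le_iff₀ (by positivity)]; nlinarith
  filter_upwards [self_mem_nhdsWithin, nhdsWithin_le_nhds (Metric.ball_mem_nhds p hκδ)]
    with q hqD hq
  have := step q hq hqD
  calc ‖extendFrom D f q - extendFrom D f p - L (q - p)‖
      = ‖(extendFrom D f q - L q) - (extendFrom D f p - L p)‖ := by rw [map_sub]; congr 1; abel
    _ ≤ _ := this.trans (by gcongr)

/-- A smooth function all of whose derivatives are bounded near a boundary point with interior cones
extends smoothly up to the boundary. -/
theorem HasInteriorCones.contDiffWithinAt_extendFrom {D : Set E} (hD : IsOpen D) {p e : E}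
    {η r : ℝ} (hη : 0 < η) (hr : 0 < r) (hc : HasInteriorCones D p e η r) (hp : p ∈ closure D)
    (n : ℕ) : ∀ {F : Type} [NormedAddCommGroup F] [NormedSpace ℝ F] [CompleteSpace F] {f : E → F},
      ContDiffOn ℝ ∞ f D →
      (∀ l : ℕ, ∃ M : ℝ, ∀ x ∈ Metric.ball p r, x ∈ D → ‖iteratedFDeriv ℝ l f x‖ ≤ M) →
      ContDiffWithinAt ℝ n (extendFrom D f) (closure D) p := by
  -- The derivative of the extension is the extension of the derivative, and `fderiv ℝ f` satisfies
  -- the same hypotheses as f; the induction on n rests on this.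
  have hder : ∀ {F : Type} [NormedAddCommGroup F] [NormedSpace ℝ F] [CompleteSpace F] {f : E → F},
      ContDiffOn ℝ ∞ f D →
      (∀ l : ℕ, ∃ M : ℝ, ∀ x ∈ Metric.ball p r, x ∈ D → ‖iteratedFDeriv ℝ l f x‖ ≤ M) →
      ∀ q ∈ closure D ∩ Metric.ball p (r / 2),
        HasFDerivWithinAt (extendFrom D f) (extendFrom D (fderiv ℝ f) q) (closure D) q := by
    intro F _ _ _ f hf hb q hq
    obtain ⟨M₁, h₁⟩ := hb 1
    obtain ⟨M₂, h₂⟩ := hb 2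
    have hsub : ∀ x ∈ Metric.ball q (r / 2), x ∈ Metric.ball p r := fun x hx =>
      Metric.ball_subset_ball' (by have : dist q p < r / 2 := hq.2; linarith) hx
    refine (hc.of_mem_ball hq.2).hasFDerivWithinAt_extendFrom hD hη (half_pos hr) hq.1 hf
      (M₁ := M₁) (M₂ := M₂) (fun x hx hxD => ?_) (fun x hx hxD => ?_)
    · rw [← norm_iteratedFDeriv_one]; exact h₁ x (hsub x hx) hxD
    · rw [← norm_iteratedFDeriv_one, norm_iteratedFDeriv_fderiv]; exact h₂ x (hsub x hx) hxD
  have hpin : p ∈ Metric.ball p (r / 2) := Metric.mem_ball_self (half_pos hr)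
  have hmem : closure D ∩ Metric.ball p (r / 2) ∈ 𝓝[closure D] p :=
    inter_mem self_mem_nhdsWithin (nhdsWithin_le_nhds (Metric.ball_mem_nhds p (half_pos hr)))
  induction n with
  | zero =>
    intro F _ _ _ f hf hb
    refine (contDiffWithinAt_zero hp).2 ⟨_, hmem, fun q hq => ?_⟩
    exact (hder hf hb q hq.2).continuousWithinAt.mono inter_subset_left
  | succ n ih =>
    intro F _ _ _ f hf hb
    have := (contDiffWithinAt_succ_iff_hasFDerivWithinAt (𝕜 := ℝ) (n := n)
      (f := extendFrom D f) (s := closure D) (x := p) (by simp)).2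
      ⟨closure D ∩ Metric.ball p (r / 2), by rwa [insert_eq_of_mem hp], by simp,
        extendFrom D (fderiv ℝ f), fun q hq => (hder hf hb q hq).mono inter_subset_left,
        (ih (f := fderiv ℝ f) (hf.fderiv_of_isOpen hD (by norm_cast)) fun l => by
          obtain ⟨M, hM⟩ := hb (l + 1)
          exact ⟨M, fun x hx hxD => by
            rw [norm_iteratedFDeriv_fderiv]; exact hM x hx hxD⟩).mono inter_subset_left⟩
    exact_mod_cast this

end Extension

/-! ### Interior cones: points of the closure, products and translations. -/

section Cones

variable {E : Type} [NormedAddCommGroup E] [NormedSpace ℝ E]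

theorem HasInteriorCones.mono {D : Set E} {p e : E} {η η' r r' : ℝ}
    (h : HasInteriorCones D p e η r) (hη : η' ≤ η) (hr : r' ≤ r) :
    HasInteriorCones D p e η' r' := fun x hx hxD t ht htr =>
  (Metric.ball_subset_ball (by gcongr)).trans
    (h x (Metric.ball_subset_ball hr hx) hxD t ht (htr.trans hr))

/-- Puts interior points on the same footing as boundary points; there any short direction serves as
axis. -/
theorem hasInteriorCones_of_ball {D : Set E} {p e : E} {r : ℝ} (he : ‖e‖ ≤ 1)
    (h : Metric.ball p (3 * r) ⊆ D) : HasInteriorCones D p e 1 r := by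
  intro x hx _ t ht htr
  refine (Metric.ball_subset_ball' ?_).trans h
  have h1 : dist x p < r := hx
  have h2 : dist (x + t • e) x ≤ t := by
    rw [dist_self_add_left, norm_smul, Real.norm_of_nonneg ht.le]
    exact mul_le_of_le_one_right ht.le he
  linarith [dist_triangle (x + t • e) x p]

/-- Lying in the cone is an open condition on its vertex, so p can be replaced by a nearby vertex in
D. -/
theorem HasInteriorCones.closure_subset {D : Set E} {p e : E} {η r : ℝ} (hr : 0 < r)
    (h : HasInteriorCones D p e η r) (hp : p ∈ closure D) {t : ℝ} (ht : 0 < t) (htr : t ≤ r) :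
    Metric.ball (p + t • e) (η * t) ⊆ D := by
  intro y hy
  have hev : ∀ᶠ x in 𝓝 p, x ∈ Metric.ball p r ∧ y ∈ Metric.ball (x + t • e) (η * t) := by
    refine Filter.Eventually.and (Metric.ball_mem_nhds p hr) ?_
    have hc : Continuous fun x : E => dist y (x + t • e) := by fun_prop
    exact hc.continuousAt.eventually_lt continuousAt_const hy
  obtain ⟨x, hx, hxD⟩ := mem_closure_iff_nhds.1 hp _ hev
  exact h x hx.1 hxD t ht htr hx.2

/-- All vectors near r • e are tangent to D at p, by the cone at p, and a set with interior spans.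
-/
theorem HasInteriorCones.uniqueDiffWithinAt {D : Set E} {p e : E} {η r : ℝ} (hη : 0 < η)
    (hr : 0 < r) (h : HasInteriorCones D p e η r) (hp : p ∈ closure D) :
    UniqueDiffWithinAt ℝ D p := by
  refine ⟨?_, hp⟩
  have hsub : Metric.ball (r • e) (η * r) ⊆ tangentConeAt ℝ D p := by
    intro v hv
    have hseg : openSegment ℝ p (p + v) ⊆ D := by
      intro q hq
      rw [openSegment_eq_image'] at hq
      obtain ⟨θ, ⟨hθ0, hθ1⟩, rfl⟩ := hq
      refine h.closure_subset hr hp (t := θ * r) (by positivity)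
        (mul_le_of_le_one_left hr.le hθ1.le) ?_
      have hv' : dist v (r • e) < η * r := hv
      simp only [add_sub_cancel_left, Metric.mem_ball, dist_add_left]
      rw [mul_smul, dist_smul₀, Real.norm_of_nonneg hθ0.le]
      nlinarith
    simpa using mem_tangentConeAt_of_openSegment_subset hseg
  have : Submodule.span ℝ (tangentConeAt ℝ D p) = ⊤ := by
    refine Submodule.eq_top_of_nonempty_interior' _ ⟨r • e, ?_⟩
    exact interior_mono (hsub.trans Submodule.subset_span)
      (by rw [Metric.isOpen_ball.interior_eq]; exact Metric.mem_ball_self (by positivity))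
  rw [this]
  exact dense_univ

variable {E₁ E₂ : Type} [NormedAddCommGroup E₁] [NormedSpace ℝ E₁] [NormedAddCommGroup E₂]
  [NormedSpace ℝ E₂] {A : Set E₁} {B : Set E₂} {p₁ e₁ : E₁} {p₂ e₂ : E₂} {η r : ℝ}

theorem HasInteriorCones.prod (h₁ : HasInteriorCones A p₁ e₁ η r)
    (h₂ : HasInteriorCones B p₂ e₂ η r) :
    HasInteriorCones (A ×ˢ B) (p₁, p₂) (e₁, e₂) η r := by
  rintro ⟨x, y⟩ hx hxD t ht htr
  rw [← ball_prod_same] at hx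
  simp only [Prod.smul_mk, Prod.mk_add_mk]
  rw [← ball_prod_same]
  exact prod_mono (h₁ x hx.1 hxD.1 t ht htr) (h₂ y hx.2 hxD.2 t ht htr)

/-- Each direction moves one factor only, while a ball in the product needs room in both; hence the
minimum of s and t. -/
theorem HasInteriorCones.movesInside (h₁ : HasInteriorCones A p₁ e₁ η r)
    (h₂ : HasInteriorCones B p₂ e₂ η r) (hη : 0 ≤ η) :
    MovesInside (A ×ˢ B) (p₁, p₂) (e₁, 0) (0, e₂) η r := by
  rintro ⟨x, y⟩ hx hxD s t hs hsr ht htr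
  rw [← ball_prod_same] at hx
  simp only [Prod.smul_mk, Prod.mk_add_mk, smul_zero, add_zero]
  rw [← ball_prod_same]
  refine prod_mono ((Metric.ball_subset_ball ?_).trans (h₁ x hx.1 hxD.1 s hs hsr))
    ((Metric.ball_subset_ball ?_).trans (h₂ y hx.2 hxD.2 t ht htr))
  · exact mul_le_mul_of_nonneg_left (min_le_left _ _) hη
  · exact mul_le_mul_of_nonneg_left (min_le_right _ _) hη

theorem HasInteriorCones.add_smul_mem {D : Set E} {p e : E} (h : HasInteriorCones D p e η r)
    (hη : 0 < η) {y : E} (hy : y ∈ Metric.ball p r) (hyD : y ∈ D) {t : ℝ} (ht : 0 ≤ t)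
    (htr : t ≤ r) : y + t • e ∈ D := by
  rcases ht.eq_or_lt with rfl | ht
  · simpa using hyD
  · exact h y hy hyD t ht htr (Metric.mem_ball_self (by positivity))

/-- A point y of the translated ball comes from y - t • e in D, and the cone at that point leads
back to y. The radius is halved so that the whole ball stays where cones exist. -/
theorem HasInteriorCones.translatesInto {D : Set E} {p e : E}
    (h : HasInteriorCones D p e η r) (hη : 0 < η) : TranslatesInto D p e (r / 2) := by
  intro x hx ρ hρ hρr hball t ht htr y hy
  have hy' : y - t • e ∈ Metric.ball x ρ := by
    rw [Metric.mem_ball, dist_eq_norm] at hy ⊢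
    rwa [sub_sub, add_comm (t • e)]
  have hx' : dist x p < r / 2 := hx
  have := h.add_smul_mem hη (y := y - t • e)
    (Metric.ball_subset_ball' (by linarith) hy') (hball hy') ht (by linarith)
  simpa using this

theorem TranslatesInto.prod_fst {r : ℝ} (h : TranslatesInto A p₁ e₁ r) (B : Set E₂) (p₂ : E₂) :
    TranslatesInto (A ×ˢ B) (p₁, p₂) (e₁, 0) r := by
  rintro ⟨x, y⟩ hx ρ hρ hρr hball t ht htr
  rw [← ball_prod_same] at hx hball
  simp only [Prod.smul_mk, Prod.mk_add_mk, smul_zero, add_zero]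
  rw [← ball_prod_same]
  have hne : (Metric.ball x ρ ×ˢ Metric.ball y ρ).Nonempty :=
    ⟨(x, y), Metric.mem_ball_self hρ, Metric.mem_ball_self hρ⟩
  rcases (prod_subset_prod_iff.1 hball) with hb | hb | hb
  · exact prod_mono (h x hx.1 ρ hρ hρr hb.1 t ht htr) hb.2
  · exact absurd ⟨x, Metric.mem_ball_self hρ⟩ (not_nonempty_iff_eq_empty.2 hb)
  · exact absurd ⟨y, Metric.mem_ball_self hρ⟩ (not_nonempty_iff_eq_empty.2 hb)

theorem TranslatesInto.prod_snd {r : ℝ} (h : TranslatesInto B p₂ e₂ r) (A : Set E₁) (p₁ : E₁) :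
    TranslatesInto (A ×ˢ B) (p₁, p₂) (0, e₂) r := by
  rintro ⟨x, y⟩ hx ρ hρ hρr hball t ht htr
  rw [← ball_prod_same] at hx hball
  simp only [Prod.smul_mk, Prod.mk_add_mk, smul_zero, add_zero]
  rw [← ball_prod_same]
  rcases (prod_subset_prod_iff.1 hball) with hb | hb | hb
  · exact prod_mono hb.1 (h y hx.2 ρ hρ hρr hb.2 t ht htr)
  · exact absurd ⟨x, Metric.mem_ball_self hρ⟩ (not_nonempty_iff_eq_empty.2 hb)
  · exact absurd ⟨y, Metric.mem_ball_self hρ⟩ (not_nonempty_iff_eq_empty.2 hb)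

/-- A linear isometry carries interior cones to interior cones. -/
theorem HasInteriorCones.preimage (c : E₂ ≃ₗᵢ[ℝ] E₁) (h : HasInteriorCones A p₁ e₁ η r) :
    HasInteriorCones (c ⁻¹' A) (c.symm p₁) (c.symm e₁) η r := by
  intro x hx hxD t ht htr y hy
  refine h (c x) ?_ hxD t ht htr ?_
  · rw [Metric.mem_ball] at hx ⊢
    rwa [← c.dist_map, c.apply_symm_apply] at hx
  · rw [Metric.mem_ball] at hy ⊢
    rw [← c.dist_map] at hy
    simpa using hy

end Cones

/-! ### Cones of a smooth domain, and complex conjugation of the coordinates. -/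

section Domain

variable {n : ℕ}

theorem norm_realDirection (a : Fin n × Fin 2) : ‖realDirection a‖ = 1 := by
  unfold realDirection
  split_ifs <;> simp

/-- The cone axes must be coordinate directions, up to sign, because the Sobolev norms contain
coordinate derivatives only. -/
theorem exists_apply_realDirection_ne_zero {L : CSpace n →L[ℝ] ℝ} (hL : L ≠ 0) :
    ∃ a, L (realDirection a) ≠ 0 := by
  by_contra! h
  refine hL (ContinuousLinearMap.ext fun v => ?_)
  have hv : v = ∑ j, ((v j).re • realDirection (j, 0) + (v j).im • realDirection (j, 1)) := by
    have h1 : ∀ j, (v j).re • realDirection (j, 0) + (v j).im • realDirection (j, 1) =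
        EuclideanSpace.single j (v j) := by
      intro j
      ext i
      rcases eq_or_ne i j with rfl | hij
      · simp [realDirection, Complex.re_add_im]
      · simp [realDirection, hij]
    simp only [h1]
    ext i
    simp [Finset.sum_apply, Pi.single_apply]
  rw [hv]
  simp [h]

/-- A set with a smooth defining function has interior cones in a coordinate direction at each
boundary point. -/
theorem IsSmoothDefiningFunction.exists_hasInteriorCones {Ω : Set (CSpace n)} {ρ : CSpace n → ℝ}
    (h : IsSmoothDefiningFunction Ω ρ) {p : CSpace n} (hp : p ∈ frontier Ω) :
    ∃ (a : Fin n × Fin 2) (σ : ℝ) (η r : ℝ), |σ| = 1 ∧ 0 < η ∧ η ≤ 1 ∧ 0 < r ∧ r ≤ 1 ∧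
      HasInteriorCones Ω p (σ • realDirection a) η r := by
  set L := fderiv ℝ ρ p with hL
  obtain ⟨a, ha⟩ := exists_apply_realDirection_ne_zero (h.fderiv_ne_zero p hp)
  obtain ⟨σ, hσ, hσL⟩ : ∃ σ : ℝ, |σ| = 1 ∧ L (σ • realDirection a) = -|L (realDirection a)| := by
    rcases lt_or_gt_of_ne ha with hneg | hpos
    · exact ⟨1, by simp, by rw [one_smul, abs_of_neg hneg]; ring⟩
    · exact ⟨-1, by simp, by rw [neg_one_smul, map_neg, abs_of_pos hpos]⟩
  set b := |L (realDirection a)| with hb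
  have hb0 : 0 < b := abs_pos.2 ha
  set e := σ • realDirection a with he
  have hen : ‖e‖ = 1 := by rw [he, norm_smul, norm_realDirection, Real.norm_eq_abs, hσ, one_mul]
  -- Strict differentiability makes the linear approximation valid at all base points x near p and
  -- not only at p.
  have hstrict : HasStrictFDerivAt ρ L p := h.contDiff.contDiffAt.hasStrictFDerivAt (by simp)
  have hev := hstrict.isLittleO.def (c := b / 8) (by positivity)
  obtain ⟨R, hR, hRT⟩ := Metric.eventually_nhds_iff_ball.1 hev
  -- The decrease b t along e has to outweigh the deviation ‖L‖ η t ≤ b t / 4 from the axis and the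
  -- error (b / 8) (2 t) of the linear approximation.
  set η := min 1 (b / (4 * (‖L‖ + 1))) with hη
  have hη0 : 0 < η := lt_min one_pos (by positivity)
  have hη1 : η ≤ 1 := min_le_left _ _
  have hLη : ‖L‖ * η ≤ b / 4 := by
    have h1 : η ≤ b / (4 * (‖L‖ + 1)) := min_le_right _ _
    calc ‖L‖ * η ≤ (‖L‖ + 1) * (b / (4 * (‖L‖ + 1))) := by gcongr; linarith
      _ = b / 4 := by field_simp
  refine ⟨a, σ, η, min (R / 4) 1, hσ, hη0, hη1, lt_min (by positivity) one_pos, min_le_right _ _, ?_⟩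
  intro x hx hxΩ t ht htr y hy
  have hx' : dist x p < R / 4 := lt_of_lt_of_le hx (min_le_left _ _)
  have htR : t ≤ R / 4 := htr.trans (min_le_left _ _)
  rw [h.domain_eq] at hxΩ ⊢
  have hxΩ : ρ x < 0 := hxΩ
  show ρ y < 0
  have hy' : dist y (x + t • e) < η * t := hy
  set u := y - x - t • e with hu
  have hun : ‖u‖ < η * t := by
    rw [hu, sub_sub, ← dist_eq_norm]; exact hy'
  have hηt : η * t ≤ t := mul_le_of_le_one_left ht.le hη1
  have hyx : y - x = t • e + u := by rw [hu]; abel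
  have hyxn : ‖y - x‖ ≤ 2 * t := by
    rw [hyx]
    refine (norm_add_le _ _).trans ?_
    rw [norm_smul, hen, Real.norm_of_nonneg ht.le]; linarith
  have h1 := hRT (y, x) (by
    rw [← ball_prod_same]
    refine ⟨?_, ?_⟩ <;> rw [Metric.mem_ball]
    · have := dist_triangle y x p
      rw [dist_eq_norm y x] at this
      linarith
    · linarith)
  simp only at h1
  have h2 : L (y - x) ≤ -(3 / 4 * b) * t := by
    rw [hyx, map_add, map_smul, hσL, smul_eq_mul]
    have h3 : L u ≤ ‖L‖ * ‖u‖ := (le_abs_self _).trans (L.le_opNorm u)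
    have h4 : ‖L‖ * ‖u‖ ≤ ‖L‖ * (η * t) := by gcongr
    nlinarith
  have h5 : ρ y - ρ x - L (y - x) ≤ b / 8 * (2 * t) :=
    (le_abs_self _).trans (h1.trans (by gcongr))
  nlinarith [mul_pos hb0 ht]

theorem IsSmoothDefiningFunction.exists_hasInteriorCones_of_mem_closure {Ω : Set (CSpace n)}
    {ρ : CSpace n → ℝ} (h : IsSmoothDefiningFunction Ω ρ) (hΩ : IsOpen Ω)
    (hne : (frontier Ω).Nonempty) {p : CSpace n} (hp : p ∈ closure Ω) :
    ∃ (a : Fin n × Fin 2) (σ : ℝ) (η r : ℝ), |σ| = 1 ∧ 0 < η ∧ η ≤ 1 ∧ 0 < r ∧ r ≤ 1 ∧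
      HasInteriorCones Ω p (σ • realDirection a) η r := by
  by_cases hpΩ : p ∈ Ω
  · obtain ⟨q, hq⟩ := hne
    -- The boundary point only supplies an index a, that is, excludes n = 0.
    obtain ⟨a, -⟩ := h.exists_hasInteriorCones hq
    obtain ⟨R, hR, hball⟩ := Metric.isOpen_iff.1 hΩ p hpΩ
    refine ⟨a, 1, 1, min (R / 3) 1, by simp, one_pos, le_rfl, lt_min (by positivity) one_pos,
      min_le_right _ _, hasInteriorCones_of_ball (by simp [norm_realDirection]) ?_⟩
    refine (Metric.ball_subset_ball ?_).trans hball
    have := min_le_left (R / 3) 1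
    linarith
  · exact h.exists_hasInteriorCones ⟨hp, by rwa [hΩ.interior_eq]⟩

/-- Coordinatewise complex conjugation. -/
noncomputable def conjSpace (n : ℕ) : CSpace n ≃ₗᵢ[ℝ] CSpace n :=
  LinearIsometryEquiv.piLpCongrRight 2 fun _ => Complex.conjLIE

@[simp]
theorem conjSpace_apply (z : CSpace n) (j : Fin n) : conjSpace n z j = conj (z j) := rfl

@[simp]
theorem conjSpace_conjSpace (z : CSpace n) : conjSpace n (conjSpace n z) = z := by
  ext j; simp

@[simp]
theorem conjSpace_symm : (conjSpace n).symm = conjSpace n := by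
  ext z : 1
  rw [LinearIsometryEquiv.symm_apply_eq, conjSpace_conjSpace]

theorem conjSpace_smul (a : ℂ) (z : CSpace n) : conjSpace n (a • z) = conj a • conjSpace n z := by
  ext j; simp

/-- The real derivative v ↦ conj (L (conj v)) is complex linear, as the two conjugations cancel. -/
theorem DifferentiableAt.conj_conjSpace {g : CSpace n → ℂ} {w : CSpace n}
    (h : DifferentiableAt ℂ g (conjSpace n w)) :
    DifferentiableAt ℂ (fun w => conj (g (conjSpace n w))) w := by
  set L := fderiv ℂ g (conjSpace n w) with hL
  have h1 : HasFDerivAt g (L.restrictScalars ℝ) (conjSpace n w) := h.hasFDerivAt.restrictScalars ℝ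
  have h2 : HasFDerivAt (fun w => conj (g (conjSpace n w))) _ w := (Complex.conjCLE.toContinuousLinearMap.hasFDerivAt.comp w
    (h1.comp w (conjSpace n).toContinuousLinearEquiv.toContinuousLinearMap.hasFDerivAt))
  let L' : CSpace n →L[ℂ] ℂ :=
    { toFun := fun v => conj (L (conjSpace n v))
      map_add' := fun u v => by simp
      map_smul' := fun a v => by simp [conjSpace_smul]
      cont := Complex.continuous_conj.comp (L.continuous.comp (conjSpace n).continuous) }
  have h3 : HasFDerivAt (fun w => conj (g (conjSpace n w))) L' w :=
    hasFDerivAt_of_restrictScalars ℝ h2 (ContinuousLinearMap.ext fun v => rfl)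
  exact h3.differentiableAt

end Domain

/-! ### Three forms of an iterated derivative in one direction. -/

section DirectionalDerivatives

/-- The derivative in the direction `v`. -/
noncomputable def dirDeriv {E F : Type*} [NormedAddCommGroup E] [NormedSpace ℝ E]
    [NormedAddCommGroup F] [NormedSpace ℝ F] (v : E) (f : E → F) : E → F :=
  fun x => fderiv ℝ f x v

variable {E F : Type*} [NormedAddCommGroup E] [NormedSpace ℝ E]
    [NormedAddCommGroup F] [NormedSpace ℝ F]

theorem contDiffOn_dirDeriv_iterate {f : E → F} {D : Set E} (hD : IsOpen D)
    (hf : ContDiffOn ℝ ∞ f D) (v : E) (k : ℕ) : ContDiffOn ℝ ∞ ((dirDeriv v)^[k] f) D := by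
  induction k generalizing f with
  | zero => exact hf
  | succ k ih =>
    rw [Function.iterate_succ_apply]
    refine ih ?_
    have h : ContDiffOn ℝ ∞ (fderiv ℝ f) D := hf.fderiv_of_isOpen hD (by norm_cast)
    exact h.clm_apply contDiffOn_const

theorem contDiff_dirDeriv_iterate {f : E → F} (hf : ContDiff ℝ ∞ f) (v : E) (k : ℕ) :
    ContDiff ℝ ∞ ((dirDeriv v)^[k] f) :=
  contDiffOn_univ.1 (contDiffOn_dirDeriv_iterate isOpen_univ hf.contDiffOn v k)

theorem tsupport_dirDeriv_subset (f : E → F) (v : E) : tsupport (dirDeriv v f) ⊆ tsupport f :=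
  tsupport_fderiv_apply_subset ℝ v

theorem tsupport_dirDeriv_iterate_subset (f : E → F) (v : E) (k : ℕ) :
    tsupport ((dirDeriv v)^[k] f) ⊆ tsupport f := by
  induction k with
  | zero => exact subset_rfl
  | succ k ih =>
    rw [Function.iterate_succ_apply']
    exact (tsupport_dirDeriv_subset _ v).trans ih

theorem iteratedFDeriv_const_apply_eq {f : E → F} (hf : ContDiff ℝ ∞ f) (v : E) (k : ℕ) (x : E) :
    iteratedFDeriv ℝ k f x (fun _ => v) = (dirDeriv v)^[k] f x := by
  induction k generalizing x with
  | zero => simp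
  | succ k ih =>
    rw [Function.iterate_succ_apply', iteratedFDeriv_succ_apply_left]
    have h1 : (dirDeriv v)^[k] f = fun x => iteratedFDeriv ℝ k f x fun _ => v :=
      funext fun x => (ih x).symm
    have h2 : DifferentiableAt ℝ (iteratedFDeriv ℝ k f) x :=
      hf.contDiffAt.differentiableAt_iteratedFDeriv (by exact_mod_cast ENat.natCast_lt_top k)
    rw [dirDeriv, h1, fderiv_continuousMultilinear_apply_const_apply h2]
    rfl

/-- Links the derivatives along lines in `HasDirectionalGrowth` with the iterated directional
derivatives that Condition R controls. -/
theorem iteratedDeriv_line_eq {f : E → F} {D : Set E} (hD : IsOpen D) (hf : ContDiffOn ℝ ∞ f D)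
    (x v : E) (k : ℕ) : ∀ {t : ℝ}, x + t • v ∈ D →
      iteratedDeriv k (fun s : ℝ => f (x + s • v)) t = (dirDeriv v)^[k] f (x + t • v) := by
  induction k with
  | zero => intro t _; simp
  | succ k ih =>
    intro t ht
    have hc : Continuous fun s : ℝ => x + s • v := by fun_prop
    have hev : iteratedDeriv k (fun s : ℝ => f (x + s • v)) =ᶠ[𝓝 t]
        fun s => (dirDeriv v)^[k] f (x + s • v) := by
      filter_upwards [hc.continuousAt.preimage_mem_nhds (hD.mem_nhds ht)] with s hs using ih hs
    rw [iteratedDeriv_succ, hev.deriv_eq, Function.iterate_succ_apply']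
    have h1 : HasFDerivAt ((dirDeriv v)^[k] f) (fderiv ℝ ((dirDeriv v)^[k] f) (x + t • v))
        (x + t • v) :=
      (((contDiffOn_dirDeriv_iterate hD hf v k).differentiableOn (by simp)).differentiableAt
        (hD.mem_nhds ht)).hasFDerivAt
    have h2 : HasDerivAt (fun s : ℝ => x + s • v) v t := by
      simpa using ((hasDerivAt_id t).smul_const v).const_add x
    exact (h1.comp_hasDerivAt t h2).deriv

end DirectionalDerivatives

/-! ### Weak derivatives and Sobolev norms of smooth functions. -/

section WeakDerivatives

variable {n : ℕ}

theorem integrable_mul_of_tsupport_subset {W : Set (CSpace n)} {f ψ : CSpace n → ℂ}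
    (hf : ContinuousOn f W) (hψ : Continuous ψ) (hc : HasCompactSupport ψ) (hs : tsupport ψ ⊆ W) :
    Integrable (fun x => f x * ψ x) volume := by
  have h1 : IntegrableOn (fun x => f x * ψ x) (tsupport ψ) volume :=
    ((hf.mono hs).mul hψ.continuousOn).integrableOn_compact hc
  refine (integrableOn_iff_integrable_of_support_subset ?_).1 h1
  exact (Function.support_mul_subset_right _ _).trans (subset_tsupport ψ)

theorem setIntegral_mul_eq_of_tsupport_subset {W : Set (CSpace n)} (f : CSpace n → ℂ)
    {ψ : CSpace n → ℂ} (hs : tsupport ψ ⊆ W) :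
    ∫ x in W, f x * ψ x = ∫ x, f x * ψ x := by
  refine setIntegral_eq_integral_of_forall_compl_eq_zero fun x hx => ?_
  rw [image_eq_zero_of_notMem_tsupport fun h => hx (hs h), mul_zero]

theorem integral_mul_dirDeriv {W : Set (CSpace n)} (hW : IsOpen W) {f ψ : CSpace n → ℂ}
    (hf : ContDiffOn ℝ ∞ f W) (hψ : IsTestFunction W ψ) (v : CSpace n) :
    ∫ x, f x * dirDeriv v ψ x = -∫ x, dirDeriv v f x * ψ x := by
  have hcψ : Continuous (dirDeriv v ψ) := (contDiff_dirDeriv_iterate hψ.contDiff v 1).continuous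
  have hsψ := tsupport_dirDeriv_subset ψ v
  refine integral_mul_fderiv_eq_neg_fderiv_mul_of_integrable ?_ ?_ ?_ ?_ ?_
  · exact integrable_mul_of_tsupport_subset
      (contDiffOn_dirDeriv_iterate hW hf v 1).continuousOn hψ.contDiff.continuous
      hψ.hasCompactSupport hψ.tsupport_subset
  · exact integrable_mul_of_tsupport_subset hf.continuousOn hcψ
      (hψ.hasCompactSupport.of_isClosed_subset (isClosed_tsupport _) hsψ)
      (hsψ.trans hψ.tsupport_subset)
  · exact integrable_mul_of_tsupport_subset hf.continuousOn hψ.contDiff.continuous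
      hψ.hasCompactSupport hψ.tsupport_subset
  · intro x hx
    exact (hf.differentiableOn (by simp)).differentiableAt (hW.mem_nhds (hψ.tsupport_subset hx))
  · intro x _
    exact hψ.contDiff.differentiable (by simp) x

theorem IsTestFunction.dirDeriv_iterate {W : Set (CSpace n)} {ψ : CSpace n → ℂ}
    (hψ : IsTestFunction W ψ) (v : CSpace n) (k : ℕ) : IsTestFunction W ((dirDeriv v)^[k] ψ) where
  contDiff := contDiff_dirDeriv_iterate hψ.contDiff v k
  hasCompactSupport := hψ.hasCompactSupport.of_isClosed_subset (isClosed_tsupport _)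
    (tsupport_dirDeriv_iterate_subset ψ v k)
  tsupport_subset := (tsupport_dirDeriv_iterate_subset ψ v k).trans hψ.tsupport_subset

theorem integral_mul_dirDeriv_iterate {W : Set (CSpace n)} (hW : IsOpen W) (v : CSpace n) (k : ℕ) :
    ∀ {f ψ : CSpace n → ℂ}, ContDiffOn ℝ ∞ f W → IsTestFunction W ψ →
      ∫ x, f x * (dirDeriv v)^[k] ψ x = (-1) ^ k * ∫ x, (dirDeriv v)^[k] f x * ψ x := by
  induction k with
  | zero => intro f ψ _ _; simp
  | succ k ih =>
    intro f ψ hf hψ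
    rw [Function.iterate_succ_apply', integral_mul_dirDeriv hW hf (hψ.dirDeriv_iterate v k),
      ih (f := dirDeriv v f) (contDiffOn_dirDeriv_iterate hW hf v 1) hψ,
      ← Function.iterate_succ_apply, pow_succ]
    ring

/-- Compactly supported smooth functions have weak derivatives of the same kind. -/
theorem exists_integral_mul_iteratedFDeriv (k : ℕ) :
    ∀ (v : Fin k → CSpace n) {f : CSpace n → ℂ}, IsTestFunction univ f →
      ∃ g : CSpace n → ℂ, IsTestFunction univ g ∧ ∀ φ : CSpace n → ℂ, IsTestFunction univ φ →
        ∫ x, f x * iteratedFDeriv ℝ k φ x v = (-1) ^ k * ∫ x, g x * φ x := by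
  induction k with
  | zero =>
    intro v f hf
    exact ⟨f, hf, fun φ _ => by simp⟩
  | succ k ih =>
    intro v f hf
    obtain ⟨g, hg, h⟩ := ih (fun i => v i.succ) (hf.dirDeriv_iterate (v 0) 1)
    refine ⟨g, hg, fun φ hφ => ?_⟩
    set ψ : CSpace n → ℂ := fun x => iteratedFDeriv ℝ k φ x fun i => v i.succ with hψ
    have hψt : IsTestFunction univ ψ := by
      refine ⟨?_, ?_, subset_univ _⟩
      · have h1 : ContDiff ℝ ∞ (iteratedFDeriv ℝ k φ) :=
          hφ.contDiff.iteratedFDeriv_right (by norm_cast)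
        exact (ContinuousMultilinearMap.apply ℝ (fun _ : Fin k => CSpace n) ℂ
          (fun i => v i.succ)).contDiff.comp h1
      · refine (hφ.hasCompactSupport.iteratedFDeriv k (𝕜 := ℝ)).comp_left
          (g := fun L : CSpace n [×k]→L[ℝ] ℂ => L fun i => v i.succ) (by simp)
    have h2 : ∀ x, iteratedFDeriv ℝ (k + 1) φ x v = dirDeriv (v 0) ψ x := by
      intro x
      have h3 : DifferentiableAt ℝ (iteratedFDeriv ℝ k φ) x :=
        hφ.contDiff.contDiffAt.differentiableAt_iteratedFDeriv
          (by exact_mod_cast ENat.natCast_lt_top k)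
      rw [iteratedFDeriv_succ_apply_left, dirDeriv, hψ,
        fderiv_continuousMultilinear_apply_const_apply h3]
      rfl
    simp only [h2]
    rw [integral_mul_dirDeriv isOpen_univ hf.contDiff.contDiffOn hψt]
    have := h φ hφ
    rw [show (dirDeriv (v 0))^[1] f = dirDeriv (v 0) f from rfl] at this
    rw [this, pow_succ]; ring

theorem IsTestFunction.mono {F : Type*} [NormedAddCommGroup F] [NormedSpace ℝ F]
    {W W' : Set (CSpace n)} {φ : CSpace n → F} (h : IsTestFunction W φ) (hW : W ⊆ W') :
    IsTestFunction W' φ := ⟨h.contDiff, h.hasCompactSupport, h.tsupport_subset.trans hW⟩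

theorem tsupport_iteratedFDeriv_apply_subset {k : ℕ} (φ : CSpace n → ℂ) (v : Fin k → CSpace n) :
    tsupport (fun x => iteratedFDeriv ℝ k φ x v) ⊆ tsupport φ := by
  refine (closure_mono fun x hx => ?_ : _ ⊆ tsupport (iteratedFDeriv ℝ k φ)).trans
    (tsupport_iteratedFDeriv_subset k)
  rw [Function.mem_support] at hx ⊢
  exact fun h => hx (by rw [h]; rfl)

/-- Makes the bumps admissible in Condition R for every order, hence for every loss M. -/
theorem IsTestFunction.memSobolev {f u : CSpace n → ℂ} (hf : IsTestFunction univ f)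
    {W : Set (CSpace n)} (hu : u =ᵐ[volume.restrict W] f) (s : ℕ) :
    MemSobolev W s u := by
  unfold MemSobolev sobolevNormSq
  refine ENNReal.sum_lt_top.2 fun k _ => ENNReal.sum_lt_top.2 fun I _ => ?_
  obtain ⟨g, hg, h⟩ := exists_integral_mul_iteratedFDeriv k (fun i => realDirection (I i)) hf
  have hgi : Integrable g volume := hg.contDiff.continuous.integrable_of_hasCompactSupport
    hg.hasCompactSupport
  have hfi : Integrable f volume := hf.contDiff.continuous.integrable_of_hasCompactSupport
    hf.hasCompactSupport
  have hui : IntegrableOn u W volume := (hfi.integrableOn (s := W)).congr hu.symm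
  have hw : HasWeakPartial W I u g := by
    refine ⟨hui.locallyIntegrableOn, hgi.integrableOn.locallyIntegrableOn, fun φ hφ => ?_⟩
    have h1 : ∫ x in W, u x * iteratedFDeriv ℝ k φ x (fun i => realDirection (I i)) =
        ∫ x in W, f x * iteratedFDeriv ℝ k φ x (fun i => realDirection (I i)) := by
      refine integral_congr_ae ?_
      filter_upwards [hu] with x hx
      rw [hx]
    rw [h1, setIntegral_mul_eq_of_tsupport_subset f
      (((tsupport_iteratedFDeriv_apply_subset φ _)).trans hφ.tsupport_subset),
      setIntegral_mul_eq_of_tsupport_subset g hφ.tsupport_subset]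
    exact h φ (hφ.mono (subset_univ _))
  refine (iInf₂_le g hw).trans_lt ?_
  have hm : MemLp g 2 (volume.restrict W) :=
    (hg.contDiff.continuous.memLp_of_hasCompactSupport hg.hasCompactSupport).restrict W
  exact ENNReal.pow_lt_top hm.2

theorem sobolevNormSq_eq_zero {W : Set (CSpace n)} {u : CSpace n → ℂ}
    (hu : u =ᵐ[volume.restrict W] 0) (s : ℕ) : sobolevNormSq W s u = 0 := by
  unfold sobolevNormSq
  refine Finset.sum_eq_zero fun k _ => Finset.sum_eq_zero fun I _ => le_antisymm ?_ bot_le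
  have hui : IntegrableOn u W volume := (integrable_zero _ _ _).congr hu.symm
  have hw : HasWeakPartial W I u 0 := by
    refine ⟨hui.locallyIntegrableOn, (integrable_zero _ _ _).locallyIntegrable.locallyIntegrableOn _,
      fun φ _ => ?_⟩
    have : ∫ x in W, u x * iteratedFDeriv ℝ k φ x (fun i => realDirection (I i)) = 0 := by
      rw [← integral_zero (CSpace n) ℂ (μ := volume.restrict W)]
      refine integral_congr_ae ?_
      filter_upwards [hu] with x hx
      simp [hx]
    rw [this]; simp
  exact (iInf₂_le (0 : CSpace n → ℂ) hw).trans (by simp)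

/-- On an open set where a function is smooth, its weak derivatives are the classical ones. -/
theorem HasWeakPartial.ae_eq_dirDeriv_iterate {Ω W : Set (CSpace n)} (hW : IsOpen W) (hWΩ : W ⊆ Ω)
    {k : ℕ} {I : Fin k → Fin n × Fin 2} {e : CSpace n} (hI : ∀ i, realDirection (I i) = e)
    {f g h : CSpace n → ℂ} (hg : HasWeakPartial Ω I f g)
    (hh : ContDiffOn ℝ ∞ h W) (hfh : f =ᵐ[volume.restrict W] h) :
    g =ᵐ[volume.restrict W] (dirDeriv e)^[k] h := by
  have hcd := (contDiffOn_dirDeriv_iterate hW hh e k).continuousOn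
  have hloc : LocallyIntegrableOn (fun x => g x - (dirDeriv e)^[k] h x) W volume :=
    (hg.2.1.mono_set hWΩ).sub (hcd.locallyIntegrableOn hW.measurableSet)
  -- Fundamental lemma of the calculus of variations: for test functions in W, f may be replaced by
  -- h and classical integration by parts applies.
  have key := hW.ae_eq_zero_of_integral_contDiff_smul_eq_zero hloc ?_
  · rw [Filter.EventuallyEq, ae_restrict_iff' hW.measurableSet]
    filter_upwards [key] with x hx hxW
    exact sub_eq_zero.1 (hx hxW)
  · intro φ hφ hφc hφs
    set ψ : CSpace n → ℂ := fun x => (φ x : ℂ) with hψ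
    have hsupp : tsupport ψ ⊆ tsupport φ := closure_mono fun x hx => by
      rw [Function.mem_support] at hx ⊢
      exact fun h0 => hx (by simp [hψ, h0])
    have hψt : IsTestFunction W ψ :=
      ⟨Complex.ofRealCLM.contDiff.comp hφ, hφc.of_isClosed_subset (isClosed_tsupport _) hsupp,
        hsupp.trans hφs⟩
    have hψk := hψt.dirDeriv_iterate e k
    have h1 := hg.2.2 ψ (hψt.mono hWΩ)
    simp only [hI, iteratedFDeriv_const_apply_eq hψt.contDiff] at h1
    rw [setIntegral_mul_eq_of_tsupport_subset f (hψk.mono hWΩ).tsupport_subset,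
      setIntegral_mul_eq_of_tsupport_subset g (hψt.mono hWΩ).tsupport_subset,
      ← setIntegral_mul_eq_of_tsupport_subset f hψk.tsupport_subset] at h1
    have h2 : ∫ x in W, f x * (dirDeriv e)^[k] ψ x = ∫ x in W, h x * (dirDeriv e)^[k] ψ x := by
      refine integral_congr_ae ?_
      filter_upwards [hfh] with x hx
      rw [hx]
    rw [h2, setIntegral_mul_eq_of_tsupport_subset h hψk.tsupport_subset,
      integral_mul_dirDeriv_iterate hW e k hh hψt] at h1
    have h3 : ∫ x, (dirDeriv e)^[k] h x * ψ x = ∫ x, g x * ψ x :=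
      mul_left_cancel₀ (pow_ne_zero k (by norm_num)) h1
    have h4 : Integrable (fun x => (dirDeriv e)^[k] h x * ψ x) volume :=
      integrable_mul_of_tsupport_subset hcd hψt.contDiff.continuous hψt.hasCompactSupport
        hψt.tsupport_subset
    have h5 : Integrable (fun x => g x * ψ x) volume := by
      have h6 : IntegrableOn g (tsupport ψ) volume :=
        hg.2.1.integrableOn_compact_subset (hψt.mono hWΩ).tsupport_subset hψt.hasCompactSupport
      have h7 : IntegrableOn (fun x => g x * ψ x) (tsupport ψ) volume :=
        h6.mul_continuousOn hψt.contDiff.continuous.continuousOn hψt.hasCompactSupport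
      refine (integrableOn_iff_integrable_of_support_subset ?_).1 h7
      exact (Function.support_mul_subset_right _ _).trans (subset_tsupport ψ)
    calc ∫ x, φ x • (g x - (dirDeriv e)^[k] h x)
        = ∫ x, (g x * ψ x - (dirDeriv e)^[k] h x * ψ x) := by
          congr 1; ext x; rw [Complex.real_smul, hψ]; ring
      _ = 0 := by rw [integral_sub h5 h4, h3, sub_self]

theorem eLpNorm_sq_le_sobolevNormSq_zero {W : Set (CSpace n)} (hW : IsOpen W) {f : CSpace n → ℂ}
    (hf : ContDiff ℝ ∞ f) : eLpNorm f 2 (volume.restrict W) ^ 2 ≤ sobolevNormSq W 0 f := by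
  unfold sobolevNormSq
  simp only [zero_add, Finset.range_one, Finset.sum_singleton]
  refine le_trans ?_ (Finset.single_le_sum (fun _ _ => bot_le)
    (Finset.mem_univ (fun i => Fin.elim0 i : Fin 0 → Fin n × Fin 2)))
  refine le_iInf₂ fun g hg => ?_
  -- There are no indices when k = 0, so the direction 0 is arbitrary.
  have key := hg.ae_eq_dirDeriv_iterate hW subset_rfl (e := 0) (fun i => i.elim0) hf.contDiffOn
    (ae_eq_refl f)
  rw [Function.iterate_zero_apply] at key
  rw [eLpNorm_congr_ae key]

end WeakDerivatives

/-! ### Mean value inequality and radial mean value property. -/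

section MeanValue

variable {n : ℕ}

/-- Point values of holomorphic functions are controlled by `L²` norms on balls, with at most a power
of the radius as constant. -/
theorem exists_norm_le_eLpNorm_ball (n : ℕ) : ∃ C : ℝ≥0, ∀ (g : CSpace n → ℂ) (z : CSpace n) (ρ : ℝ),
    0 < ρ → ρ ≤ 1 → DifferentiableOn ℂ g (Metric.ball z ρ) →
    ENNReal.ofReal (ρ ^ Module.finrank ℝ (CSpace n)) * ‖g z‖ₑ ≤
      C * eLpNorm g 2 (volume.restrict (Metric.ball z ρ)) := by
  set d := Module.finrank ℝ (CSpace n) with hd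
  set V := volume (Metric.ball (0 : CSpace n) 1) with hV
  have hV0 : V ≠ 0 := (Metric.measure_ball_pos volume _ one_pos).ne'
  have hVt : V ≠ ⊤ := measure_ball_lt_top.ne
  -- 2 ^ d comes from the mean over the ball of radius ρ / 2. In Cauchy–Schwarz the volume of the
  -- ball of radius ρ is replaced by V, which is not sharp in ρ; only a fixed power matters.
  set C : ℝ≥0∞ := ENNReal.ofReal (2 ^ d) * V⁻¹ * V ^ (1 / 2 : ℝ) with hC
  have hCt : C ≠ ⊤ := by
    rw [hC]
    have := ENNReal.inv_ne_top.2 hV0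
    finiteness
  refine ⟨C.toNNReal, fun g z ρ hρ hρ1 hg => ?_⟩
  rw [ENNReal.coe_toNNReal hCt]
  have h1 := holomorphic_norm_le_lintegral (Ω := Metric.ball z ρ) Metric.isOpen_ball hg z
    (r := ρ / 2) (Metric.closedBall_subset_ball (by linarith))
  have h2 : ∫⁻ x in Metric.ball z ρ, ‖g x‖ₑ ≤
      eLpNorm g 2 (volume.restrict (Metric.ball z ρ)) * V ^ (1 / 2 : ℝ) := by
    have hm : AEStronglyMeasurable g (volume.restrict (Metric.ball z ρ)) :=
      hg.continuousOn.aestronglyMeasurable Metric.isOpen_ball.measurableSet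
    have := eLpNorm_le_eLpNorm_mul_rpow_measure_univ (μ := volume.restrict (Metric.ball z ρ))
      (p := 1) (q := 2) (by norm_num) hm
    rw [eLpNorm_one_eq_lintegral_enorm] at this
    refine this.trans ?_
    rw [Measure.restrict_apply_univ, Measure.addHaar_ball_center]
    have hle : volume (Metric.ball (0 : CSpace n) ρ) ≤ V :=
      measure_mono (Metric.ball_subset_ball hρ1)
    norm_num
    gcongr
  rw [Measure.addHaar_ball_of_pos volume (0 : CSpace n) (half_pos hρ), ← hd, ← hV] at h1
  have h3 : ENNReal.ofReal (ρ ^ d) = ENNReal.ofReal (2 ^ d) * ENNReal.ofReal ((ρ / 2) ^ d) := by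
    rw [← ENNReal.ofReal_mul (by positivity), ← mul_pow]
    congr 2; ring
  calc ENNReal.ofReal (ρ ^ d) * ‖g z‖ₑ
      = ENNReal.ofReal (2 ^ d) * V⁻¹ * (ENNReal.ofReal ((ρ / 2) ^ d) * V * ‖g z‖ₑ) := by
        rw [h3]
        calc _ = ENNReal.ofReal (2 ^ d) * ENNReal.ofReal ((ρ / 2) ^ d) * 1 * ‖g z‖ₑ := by ring
          _ = _ := by rw [← ENNReal.inv_mul_cancel hV0 hVt]; ring
    _ ≤ ENNReal.ofReal (2 ^ d) * V⁻¹ *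
        (eLpNorm g 2 (volume.restrict (Metric.ball z ρ)) * V ^ (1 / 2 : ℝ)) := by
        exact mul_le_mul_right (h1.trans h2) _
    _ = _ := by rw [hC]; ring

/-- A smooth radial function supported in the closed ball of radius `ρ` about the origin. -/
noncomputable def radialBump (ρ : ℝ) (x : CSpace n) : ℝ :=
  Real.smoothTransition (1 - ‖x‖ ^ 2 / ρ ^ 2)

theorem contDiff_radialBump (ρ : ℝ) : ContDiff ℝ ∞ (radialBump (n := n) ρ) := by
  refine Real.smoothTransition.contDiff.comp (contDiff_const.sub (ContDiff.div_const ?_ _))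
  have : (fun x : CSpace n => ‖x‖ ^ 2) = fun x => ∑ i, ((x i).re * (x i).re + (x i).im * (x i).im) := by
    ext x
    rw [EuclideanSpace.norm_sq_eq]
    refine Finset.sum_congr rfl fun i _ => ?_
    rw [← Complex.normSq_eq_norm_sq, Complex.normSq_apply]
  rw [this]
  have hp : ∀ i : Fin n, ContDiff ℝ ∞ fun x : CSpace n => x i := fun i =>
    ((EuclideanSpace.proj i : CSpace n →L[ℂ] ℂ).restrictScalars ℝ).contDiff
  refine ContDiff.sum fun i _ => ?_
  have hre : ContDiff ℝ ∞ fun x : CSpace n => (x i).re := Complex.reCLM.contDiff.comp (hp i)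
  have him : ContDiff ℝ ∞ fun x : CSpace n => (x i).im := Complex.imCLM.contDiff.comp (hp i)
  exact (hre.mul hre).add (him.mul him)

theorem radialBump_nonneg (ρ : ℝ) (x : CSpace n) : 0 ≤ radialBump ρ x :=
  Real.smoothTransition.nonneg _

theorem radialBump_le_one (ρ : ℝ) (x : CSpace n) : radialBump ρ x ≤ 1 :=
  Real.smoothTransition.le_one _

theorem radialBump_congr (ρ : ℝ) {x y : CSpace n} (h : ‖x‖ = ‖y‖) :
    radialBump ρ x = radialBump ρ y := by simp only [radialBump, h]

theorem radialBump_eq_zero {ρ : ℝ} (hρ : 0 < ρ) {x : CSpace n} (h : ρ ≤ ‖x‖) :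
    radialBump ρ x = 0 := by
  refine Real.smoothTransition.zero_of_nonpos ?_
  rw [sub_nonpos, le_div_iff₀ (by positivity), one_mul]
  gcongr

theorem support_radialBump_subset {ρ : ℝ} (hρ : 0 < ρ) :
    Function.support (radialBump (n := n) ρ) ⊆ Metric.ball 0 ρ := by
  intro x hx
  by_contra h
  exact hx (radialBump_eq_zero hρ (by simpa using h))

theorem hasCompactSupport_radialBump {ρ : ℝ} (hρ : 0 < ρ) :
    HasCompactSupport (radialBump (n := n) ρ) :=
  HasCompactSupport.of_support_subset_isCompact (isCompact_closedBall 0 ρ)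
    ((support_radialBump_subset hρ).trans Metric.ball_subset_closedBall)

theorem integral_radialBump_one_pos : 0 < ∫ x : CSpace n, radialBump 1 x := by
  refine (contDiff_radialBump 1).continuous.integral_pos_of_hasCompactSupport_nonneg_nonzero
    (hasCompactSupport_radialBump one_pos) (radialBump_nonneg 1) (x := 0) ?_
  simp [radialBump]

theorem integral_radialBump {ρ : ℝ} (hρ : 0 < ρ) : ∫ x : CSpace n, radialBump ρ x =
    ρ ^ Module.finrank ℝ (CSpace n) * ∫ x : CSpace n, radialBump 1 x := by
  have h : ∀ x : CSpace n, radialBump ρ x = radialBump 1 (ρ⁻¹ • x) := by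
    intro x
    simp only [radialBump, norm_smul, Real.norm_of_nonneg (inv_nonneg.2 hρ.le)]
    congr 2
    field_simp
  simp only [h]
  rw [Measure.integral_comp_inv_smul, abs_of_nonneg (by positivity), smul_eq_mul]

/-- The mean value property of holomorphic functions, with a radial weight. -/
theorem integral_radialBump_mul {g : CSpace n → ℂ} {w : CSpace n} {ρ R : ℝ} (hρ : 0 < ρ)
    (hρR : ρ < R) (hg : DifferentiableOn ℂ g (Metric.ball w R)) :
    ∫ x, (radialBump ρ (x - w) : ℂ) * g x = (∫ x : CSpace n, radialBump ρ x : ℝ) * g w := by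
  -- The rotations x ↦ e^{iθ} x preserve the integral of G and the weight. Averaging over θ first
  -- replaces g (w + x) by g w, by the mean value property on the complex line through w in the
  -- direction x.
  set G : CSpace n → ℂ := fun x => (radialBump ρ x : ℂ) * g (w + x) with hG
  have hGs : ∀ x, ρ ≤ ‖x‖ → G x = 0 := fun x hx => by
    simp [hG, radialBump_eq_zero hρ hx]
  have hGc : Continuous G := by
    rw [continuous_iff_continuousAt]
    intro x
    by_cases hx : ‖x‖ < R
    · have h1 : ContinuousAt g (w + x) :=
        hg.continuousOn.continuousAt (Metric.isOpen_ball.mem_nhds (by simpa using hx))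
      have h2 : ContinuousAt (fun x => g (w + x)) x :=
        ContinuousAt.comp (f := fun x => w + x) h1 (by fun_prop)
      exact (Complex.continuous_ofReal.comp (contDiff_radialBump ρ).continuous).continuousAt.mul h2
    · have : G =ᶠ[𝓝 x] fun _ => 0 := by
        have hx' : ρ < ‖x‖ := by linarith
        filter_upwards [continuous_norm.continuousAt.eventually_const_lt hx'] with y hy
        exact hGs y hy.le
      exact continuousAt_const.congr this.symm
  have hGsupp : HasCompactSupport G := by
    refine HasCompactSupport.of_support_subset_isCompact (isCompact_closedBall 0 ρ) fun x hx => ?_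
    by_contra h
    exact hx (hGs x (by
      have : ρ < ‖x‖ := by simpa using h
      exact this.le))
  obtain ⟨M, hM⟩ := hGsupp.exists_bound_of_continuous hGc
  set μ : Measure ℝ := volume.restrict (Ioc 0 (2 * Real.pi)) with hμ
  have hint : Integrable (Function.uncurry fun (x : CSpace n) (θ : ℝ) => G (circleMap 0 1 θ • x))
      ((volume : Measure (CSpace n)).prod μ) := by
    have hb : Integrable (fun p : CSpace n × ℝ => (Metric.closedBall (0 : CSpace n) ρ).indicator
        (fun _ => M) p.1) ((volume : Measure (CSpace n)).prod μ) := by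
      have : Integrable ((Metric.closedBall (0 : CSpace n) ρ).indicator (fun _ => M)) volume :=
        (integrable_indicator_iff Metric.isClosed_closedBall.measurableSet).2
          (integrableOn_const (isCompact_closedBall 0 ρ).measure_lt_top.ne)
      exact this.comp_fst μ
    refine hb.mono' ?_ (Filter.Eventually.of_forall ?_)
    · refine Continuous.aestronglyMeasurable ?_
      exact hGc.comp (by fun_prop)
    · rintro ⟨x, θ⟩
      simp only [Function.uncurry_apply_pair]
      by_cases hx : x ∈ Metric.closedBall (0 : CSpace n) ρ
      · rw [indicator_of_mem hx]; exact hM _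
      · rw [indicator_of_notMem hx]
        have : ρ < ‖x‖ := by simpa using hx
        rw [hGs _ (by simpa [norm_smul] using this.le)]
        simp
  have hswap := integral_integral_swap hint
  have hrot : ∀ θ : ℝ, ∫ x : CSpace n, G (circleMap 0 1 θ • x) = ∫ x, G x := by
    intro θ
    let e : CSpace n ≃ₗᵢ[ℝ] CSpace n :=
      { (LinearEquiv.smulOfNeZero ℂ (CSpace n) (circleMap 0 1 θ) (by simp)).restrictScalars ℝ with
        norm_map' := fun v => by simp [norm_smul] }
    exact e.measurePreserving.integral_comp e.toHomeomorph.measurableEmbedding G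
  have hmean : ∀ x : CSpace n, ∫ θ, G (circleMap 0 1 θ • x) ∂μ =
      (2 * Real.pi : ℝ) * ((radialBump ρ x : ℂ) * g w) := by
    intro x
    have h1 : ∀ θ, G (circleMap 0 1 θ • x) = (radialBump ρ x : ℂ) * g (w + circleMap 0 1 θ • x) := by
      intro θ
      simp only [hG]
      rw [radialBump_congr ρ (y := x) (by simp [norm_smul])]
    simp only [h1]
    rw [integral_const_mul]
    by_cases hx : ρ ≤ ‖x‖
    · simp [radialBump_eq_zero hρ hx]
    · have hd := diffContOnCl_slice Metric.isOpen_ball hg w x (R := 1) (by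
        intro t ht
        simp only [Metric.mem_ball, dist_self_add_left, norm_smul]
        push Not at hx
        nlinarith [norm_nonneg x, norm_nonneg t])
      have hca := DiffContOnCl.circleAverage (R := 1) (c := 0)
        (f := fun t : ℂ => g (w + t • x)) (by simpa using hd)
      simp only [zero_smul, add_zero] at hca
      rw [Real.circleAverage_def, intervalIntegral.integral_of_le (by positivity),
        inv_smul_eq_iff₀ (by positivity)] at hca
      rw [hμ, hca, Complex.real_smul]
      ring
  simp only [hrot, hmean] at hswap
  rw [integral_const_mul, integral_mul_const] at hswap
  have hμu : ∫ _ : ℝ, (∫ x, G x) ∂μ = (2 * Real.pi : ℝ) * ∫ x, G x := by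
    rw [integral_const, hμ]
    simp [Measure.real, Real.pi_pos.le]
  rw [hμu] at hswap
  have hπ : ((2 * Real.pi : ℝ) : ℂ) ≠ 0 := by exact_mod_cast (by positivity : (2 * Real.pi : ℝ) ≠ 0)
  have h2 := mul_left_cancel₀ hπ hswap
  rw [← integral_add_left_eq_self _ w]
  simp only [add_sub_cancel_left]
  rw [← h2, integral_complex_ofReal]

end MeanValue

/-! ### Symmetry and size of a scalar reproducing kernel. -/

section ReproducingKernel

variable {H X : Type*} [NormedAddCommGroup H] [InnerProductSpace ℂ H] [CompleteSpace H]
  [RKHS ℂ H X ℂ]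

theorem RKHS.inner_kerFun_one (x : X) (f : H) :
    inner ℂ f (RKHS.kerFun H x (1 : ℂ)) = conj (f x) := by
  rw [RKHS.inner_kerFun, RCLike.inner_apply, one_mul]

theorem RKHS.conj_kernel_one (x y : X) :
    conj (RKHS.kernel H x y (1 : ℂ)) = RKHS.kernel H y x (1 : ℂ) := by
  rw [← RKHS.kerFun_apply, ← RKHS.kerFun_apply, ← RKHS.inner_kerFun_one, ← inner_conj_symm,
    RKHS.inner_kerFun_one, Complex.conj_conj]

theorem RKHS.norm_kernel_one_le {x y : X} {C : ℝ} (hx : ∀ f : H, ‖f x‖ ≤ C * ‖f‖)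
    (hy : ∀ f : H, ‖f y‖ ≤ C * ‖f‖) (hC : 0 ≤ C) : ‖RKHS.kernel H x y (1 : ℂ)‖ ≤ C * C := by
  have hk : ∀ z : X, (∀ f : H, ‖f z‖ ≤ C * ‖f‖) → ‖RKHS.kerFun H z‖ ≤ C := fun z hz => by
    rw [← ContinuousLinearMap.adjoint.norm_map]
    exact ContinuousLinearMap.opNorm_le_bound _ hC fun f => by
      rw [RKHS.adjoint_kerFun]; exact hz f
  rw [← RKHS.kerFun_apply]
  refine (hx _).trans (mul_le_mul_of_nonneg_left ?_ hC)
  exact ((RKHS.kerFun H y).le_opNorm 1).trans (by simpa using hk y hy)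

end ReproducingKernel

/-! ### Condition R and the growth of the kernel in one variable. -/

section BergmanKernel

variable {n : ℕ} {Ω : TopologicalSpace.Opens (CSpace n)}

/-- The Bergman kernel function at `w`, as an element of the Bergman space. -/
noncomputable def bergmanKerFun (w : Ω) : bergmanSpace Ω :=
  RKHS.kerFun (bergmanSpace Ω) w (1 : ℂ)

theorem bergmanKernel_eq_holRep (z w : Ω) :
    bergmanKernel Ω z w = holRep (bergmanKerFun w) z :=
  (RKHS.kerFun_apply (bergmanSpace Ω) w (1 : ℂ) z).symm

theorem inner_bergmanKerFun (w : Ω) (f : bergmanSpace Ω) :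
    inner ℂ (f : Lp ℂ 2 (volume.restrict (Ω : Set (CSpace n))))
      (bergmanKerFun w : Lp ℂ 2 (volume.restrict (Ω : Set (CSpace n)))) = conj (holRep f w) :=
  RKHS.inner_kerFun_one (H := bergmanSpace Ω) w f

theorem conj_bergmanKernel (z w : Ω) : conj (bergmanKernel Ω z w) = bergmanKernel Ω w z :=
  RKHS.conj_kernel_one (H := bergmanSpace Ω) z w

theorem exists_norm_bergmanKernel_le {r : ℝ} (hr : 0 < r) : ∃ C : ℝ, ∀ z w : Ω,
    Metric.ball (z : CSpace n) r ⊆ Ω → Metric.ball (w : CSpace n) r ⊆ Ω →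
      ‖bergmanKernel Ω z w‖ ≤ C := by
  obtain ⟨C, hC, h⟩ := norm_holRep_le (n := n) hr
  exact ⟨C * C, fun z w hz hw => RKHS.norm_kernel_one_le (H := bergmanSpace Ω)
    (fun f => h Ω f z hz) (fun f => h Ω f w hw) hC⟩
/-- The kernel function at `w` is the Bergman projection of a smooth function supported near `w`. -/
theorem exists_bergmanProjection_eq_kerFun (hΩ : Bornology.IsBounded (Ω : Set (CSpace n))) :
    ∃ C : ℝ≥0, ∀ (w : Ω) (ρ : ℝ), 0 < ρ → Metric.ball (w : CSpace n) ρ ⊆ Ω →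
      ∃ (φ : CSpace n → ℂ) (u : Lp ℂ 2 (volume.restrict (Ω : Set (CSpace n)))),
        IsTestFunction univ φ ∧ (∀ x, x ∉ Metric.ball (w : CSpace n) (ρ / 2) → φ x = 0) ∧
        u =ᵐ[volume.restrict (Ω : Set (CSpace n))] φ ∧
        bergmanProjection Ω u = bergmanKerFun w ∧
        ENNReal.ofReal (ρ ^ Module.finrank ℝ (CSpace n)) *
          eLpNorm u 2 (volume.restrict (Ω : Set (CSpace n))) ≤ C := by
  set d := Module.finrank ℝ (CSpace n) with hd
  set J : ℝ := ∫ x : CSpace n, radialBump 1 x with hJ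
  have hJ0 : 0 < J := integral_radialBump_one_pos
  have hvol : volume (Ω : Set (CSpace n)) ≠ ⊤ := hΩ.measure_lt_top.ne
  set C : ℝ≥0∞ := volume (Ω : Set (CSpace n)) ^ (1 / 2 : ℝ) * ENNReal.ofReal (2 ^ d * J⁻¹) with hC
  have hCt : C ≠ ⊤ := by rw [hC]; finiteness
  refine ⟨C.toNNReal, fun w ρ hρ hball => ?_⟩
  have hρ2 : 0 < ρ / 2 := half_pos hρ
  set N : ℝ := (ρ / 2) ^ d * J with hN
  have hN0 : 0 < N := by positivity
  have hNint : ∫ x : CSpace n, radialBump (ρ / 2) x = N := integral_radialBump hρ2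
  set φ : CSpace n → ℂ := fun x => ((N⁻¹ * radialBump (ρ / 2) (x - (w : CSpace n)) : ℝ) : ℂ) with hφ
  have hφ0 : ∀ x, x ∉ Metric.ball (w : CSpace n) (ρ / 2) → φ x = 0 := by
    intro x hx
    have : ρ / 2 ≤ ‖x - (w : CSpace n)‖ := by rw [← dist_eq_norm]; simpa using hx
    simp [hφ, radialBump_eq_zero hρ2 this]
  have hφt : IsTestFunction univ φ := by
    refine ⟨?_, ?_, subset_univ _⟩
    · refine Complex.ofRealCLM.contDiff.comp (contDiff_const.mul ?_)
      exact (contDiff_radialBump _).comp (contDiff_id.sub contDiff_const)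
    · refine HasCompactSupport.of_support_subset_isCompact
        (isCompact_closedBall (w : CSpace n) (ρ / 2)) fun x hx => ?_
      by_contra h
      exact hx (hφ0 x fun h' => h (Metric.ball_subset_closedBall h'))
  have hφL : MemLp φ 2 (volume.restrict (Ω : Set (CSpace n))) :=
    (hφt.contDiff.continuous.memLp_of_hasCompactSupport hφt.hasCompactSupport).restrict _
  have hu := hφL.coeFn_toLp
  refine ⟨φ, hφL.toLp φ, hφt, hφ0, hu, ?_, ?_⟩
  -- The difference between the bump and the kernel function is orthogonal to the Bergman space: the
  -- inner product of any g there with either of them is conj (g w).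
  · refine Submodule.eq_starProjection_of_mem_orthogonal (Subtype.mem _) ?_
    rw [Submodule.mem_orthogonal]
    intro g hg
    rw [inner_sub_right, sub_eq_zero]
    have h1 := inner_bergmanKerFun w ⟨g, hg⟩
    refine Eq.trans ?_ h1.symm
    rw [L2.inner_def]
    have h2 : ∫ x in (Ω : Set (CSpace n)), inner ℂ (g x) ((hφL.toLp φ) x) =
        ∫ x in (Ω : Set (CSpace n)), conj (φ x * holRep ⟨g, hg⟩ x) := by
      refine integral_congr_ae ?_
      filter_upwards [hu, holRep_ae ⟨g, hg⟩] with x hx1 hx2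
      rw [hx1, show g x = holRep ⟨g, hg⟩ x from hx2, RCLike.inner_apply, map_mul]
      simp only [hφ, Complex.conj_ofReal]
    rw [h2, integral_conj]
    congr 1
    have h3 : ∫ x in (Ω : Set (CSpace n)), φ x * holRep ⟨g, hg⟩ x =
        ∫ x, φ x * holRep ⟨g, hg⟩ x := by
      refine setIntegral_eq_integral_of_forall_compl_eq_zero fun x hx => ?_
      rw [hφ0 x fun h => hx (hball (Metric.ball_subset_ball (by linarith) h)), zero_mul]
    have h4 : ∀ x, φ x * holRep ⟨g, hg⟩ x =
        (N : ℂ)⁻¹ * ((radialBump (ρ / 2) (x - (w : CSpace n)) : ℂ) * holRep ⟨g, hg⟩ x) := by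
      intro x; simp only [hφ]; push_cast; ring
    rw [h3]
    simp only [h4]
    rw [integral_const_mul, integral_radialBump_mul hρ2 (by linarith : ρ / 2 < ρ)
      ((holRep_diff ⟨g, hg⟩).mono hball), hNint, inv_mul_cancel_left₀]
    exact_mod_cast hN0.ne'
  · rw [ENNReal.coe_toNNReal hCt, eLpNorm_congr_ae hu]
    -- Supremum times the square root of the volume of Ω, which gives the power -d of ρ.
    have h1 : eLpNorm φ 2 (volume.restrict (Ω : Set (CSpace n))) ≤
        volume (Ω : Set (CSpace n)) ^ (1 / 2 : ℝ) * ENNReal.ofReal N⁻¹ := by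
      have := eLpNorm_le_of_ae_bound (p := 2) (μ := volume.restrict (Ω : Set (CSpace n))) (f := φ)
        (C := N⁻¹) (Filter.Eventually.of_forall fun x => by
          simp only [hφ, Complex.norm_real]
          rw [Real.norm_of_nonneg (mul_nonneg (by positivity) (radialBump_nonneg _ _))]
          exact mul_le_of_le_one_right (by positivity) (radialBump_le_one _ _))
      simpa using this
    calc _ ≤ ENNReal.ofReal (ρ ^ d) *
          (volume (Ω : Set (CSpace n)) ^ (1 / 2 : ℝ) * ENNReal.ofReal N⁻¹) := by gcongr
      _ = volume (Ω : Set (CSpace n)) ^ (1 / 2 : ℝ) * ENNReal.ofReal (ρ ^ d * N⁻¹) := by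
          rw [ENNReal.ofReal_mul (by positivity)]; ring
      _ = C := by
          rw [hC, hN]
          congr 2
          rw [div_pow]
          field_simp
      _ ≤ C := le_rfl

/-- For m = 0 the competitors have L² norm at most 1, and Cauchy–Schwarz applies. -/
theorem sobolevDualNorm_zero_le {f : CSpace n → ℂ} {W : Set (CSpace n)} (hW : IsOpen W)
    (hf : AEStronglyMeasurable f (volume.restrict W)) :
    sobolevDualNorm W 0 f ≤ eLpNorm f 2 (volume.restrict W) := by
  unfold sobolevDualNorm
  refine iSup_le fun φ => iSup_le fun hφ => iSup_le fun h1 => ?_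
  have h2 : eLpNorm φ 2 (volume.restrict W) ≤ 1 := by
    have h3 := (eLpNorm_sq_le_sobolevNormSq_zero hW hφ.contDiff).trans h1
    by_contra! h4
    exact absurd h3 (not_le.2 (one_lt_pow₀ h4 two_ne_zero))
  have hφm : AEStronglyMeasurable (fun x => conj (φ x)) (volume.restrict W) :=
    (Complex.continuous_conj.comp hφ.contDiff.continuous).aestronglyMeasurable
  have h5 := eLpNorm_smul_le_mul_eLpNorm (p := 2) (q := 2) (r := 1) hφm hf
  rw [eLpNorm_one_eq_lintegral_enorm] at h5
  have h6 : eLpNorm (fun x => conj (φ x)) 2 (volume.restrict W) =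
      eLpNorm φ 2 (volume.restrict W) :=
    eLpNorm_congr_norm_ae (Filter.Eventually.of_forall fun x => by simp)
  calc _ ≤ ∫⁻ x in W, ‖f x * conj (φ x)‖ₑ := enorm_integral_le_lintegral_enorm _
    _ ≤ eLpNorm f 2 (volume.restrict W) * 1 := by
        refine h5.trans ?_
        rw [h6]; gcongr
    _ = _ := mul_one _

theorem differentiableOn_dirDeriv_iterate {W : Set (CSpace n)} (hW : IsOpen W) {h : CSpace n → ℂ}
    (hh : DifferentiableOn ℂ h W) (v : CSpace n) (k : ℕ) :
    DifferentiableOn ℂ ((dirDeriv v)^[k] h) W := by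
  induction k with
  | zero => exact hh
  | succ k ih =>
    rw [Function.iterate_succ_apply']
    refine (differentiableOn_fderiv_apply hW ih v).congr fun x hx => ?_
    rw [dirDeriv, (ih.differentiableAt (hW.mem_nhds hx)).fderiv_restrictScalars ℝ]
    rfl

/-- Point values of the derivatives of a holomorphic function are controlled by a local Sobolev
norm. -/
theorem exists_enorm_dirDeriv_iterate_le (n : ℕ) : ∃ C : ℝ≥0, ∀ (V W : Set (CSpace n))
    (f h : CSpace n → ℂ) (a : Fin n × Fin 2) (k : ℕ) (z : CSpace n) (ρ : ℝ), IsOpen V → IsOpen W →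
    W ⊆ V → DifferentiableOn ℂ h W → f =ᵐ[volume.restrict W] h → 0 < ρ → ρ ≤ 1 →
    Metric.ball z ρ ⊆ W →
      (ENNReal.ofReal (ρ ^ Module.finrank ℝ (CSpace n)) *
        ‖(dirDeriv (realDirection a))^[k] h z‖ₑ) ^ 2 ≤ (C : ℝ≥0∞) ^ 2 * sobolevNormSq V k f := by
  obtain ⟨C₁, h₁⟩ := exists_norm_le_eLpNorm_ball n
  -- C₁ + 1 is nonzero, which allows division by it below.
  refine ⟨C₁ + 1, fun V W f h a k z ρ hV hW hWV hh hfh hρ hρ1 hzW => ?_⟩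
  set D := (dirDeriv (realDirection a))^[k] h with hD
  have hhW : ContDiffOn ℝ ∞ h W := (contDiffOn_of_holomorphic hW hh).restrict_scalars ℝ
  -- The derivative is itself holomorphic, so the mean value inequality applies to it directly and
  -- takes the place of a Sobolev embedding.
  have hpoint := h₁ D z ρ hρ hρ1 ((differentiableOn_dirDeriv_iterate hW hh _ k).mono hzW)
  set X : ℝ≥0∞ := ENNReal.ofReal (ρ ^ Module.finrank ℝ (CSpace n)) * ‖D z‖ₑ with hX
  have hC0 : ((C₁ + 1 : ℝ≥0) : ℝ≥0∞) ^ 2 ≠ 0 := by positivity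
  have hCt : ((C₁ + 1 : ℝ≥0) : ℝ≥0∞) ^ 2 ≠ ⊤ := by finiteness
  rw [mul_comm, ← ENNReal.div_le_iff hC0 hCt]
  -- Of the whole sum only the pure derivative of order k in the direction a is kept.
  unfold sobolevNormSq
  refine le_trans ?_ (Finset.single_le_sum (fun _ _ => bot_le)
    (Finset.mem_range.2 (Nat.lt_succ_self k)))
  refine le_trans ?_ (Finset.single_le_sum (fun _ _ => bot_le)
    (Finset.mem_univ (fun _ => a : Fin k → Fin n × Fin 2)))
  refine le_iInf₂ fun g hg => ?_
  rw [ENNReal.div_le_iff hC0 hCt, ← mul_pow]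
  gcongr
  have hgD : g =ᵐ[volume.restrict W] D :=
    hg.ae_eq_dirDeriv_iterate hW hWV (fun _ => rfl) hhW hfh
  calc X ≤ C₁ * eLpNorm D 2 (volume.restrict (Metric.ball z ρ)) := hpoint
    _ = C₁ * eLpNorm g 2 (volume.restrict (Metric.ball z ρ)) := by
        rw [eLpNorm_congr_ae (ae_mono (Measure.restrict_mono hzW le_rfl) hgD)]
    _ ≤ (C₁ + 1 : ℝ≥0) * eLpNorm g 2 (volume.restrict V) := by
        exact mul_le_mul' (by simp)
          (eLpNorm_mono_measure g (Measure.restrict_mono (hzW.trans hWV) le_rfl))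
    _ = _ := mul_comm _ _

theorem eLpNorm_bergmanProjection_le
    (u : Lp ℂ 2 (volume.restrict (Ω : Set (CSpace n)))) :
    eLpNorm (bergmanProjection Ω u) 2 (volume.restrict (Ω : Set (CSpace n))) ≤
      eLpNorm u 2 (volume.restrict (Ω : Set (CSpace n))) := by
  have h : ‖bergmanProjection Ω u‖ ≤ ‖u‖ :=
    Submodule.norm_starProjection_apply_le (bergmanSpace Ω) u
  rw [Lp.norm_def, Lp.norm_def] at h
  exact (ENNReal.toReal_le_toReal (Lp.eLpNorm_ne_top _) (Lp.eLpNorm_ne_top _)).1 h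

theorem sobolevDualNorm_zero_mul_bergmanProjection_le {χ : CSpace n → ℝ} (hχ : Continuous χ)
    (h0 : ∀ x, 0 ≤ χ x) (h1 : ∀ x, χ x ≤ 1) (u : Lp ℂ 2 (volume.restrict (Ω : Set (CSpace n)))) :
    sobolevDualNorm Ω 0 (fun x => (χ x : ℂ) * bergmanProjection Ω u x) ≤
      eLpNorm u 2 (volume.restrict (Ω : Set (CSpace n))) := by
  have hc : Continuous fun x => (χ x : ℂ) := Complex.continuous_ofReal.comp hχ
  refine (sobolevDualNorm_zero_le Ω.isOpen
    (hc.aestronglyMeasurable.mul (Lp.aestronglyMeasurable _))).trans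
      (le_trans ?_ (eLpNorm_bergmanProjection_le u))
  refine eLpNorm_mono fun x => ?_
  rw [Pi.mul_apply, norm_mul, Complex.norm_real, Real.norm_of_nonneg (h0 x)]
  exact mul_le_of_le_one_left (norm_nonneg _) (h1 x)

/-- Combines the two losses ρ ^ (-d), one in the L² norm A and one in the point evaluation. In the
constant, `+ 1` avoids a square root, as t ^ 2 ≤ c implies t ≤ c + 1. In the exponent, it costs
nothing because ρ ≤ 1, and makes the exponent positive for every d. -/
theorem le_div_pow_of_ofReal_mul_le {d : ℕ} {ρ X : ℝ} {A : ℝ≥0∞} {C₂ K : ℝ≥0} (hρ : 0 < ρ)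
    (hρ1 : ρ ≤ 1) (hX : 0 ≤ X)
    (hA : ENNReal.ofReal (ρ ^ d) * A ≤ C₂)
    (h : (ENNReal.ofReal (ρ ^ d) * ENNReal.ofReal X) ^ 2 ≤ K * A ^ 2) :
    X ≤ (K * C₂ ^ 2 + 1 : ℝ≥0) / ρ ^ (2 * d + 1) := by
  have hfin : ENNReal.ofReal ((ρ ^ (2 * d) * X) ^ 2) ≤ (K * C₂ ^ 2 : ℝ≥0) := by
    have e : ENNReal.ofReal ((ρ ^ (2 * d) * X) ^ 2) =
        ENNReal.ofReal (ρ ^ d) ^ 2 * (ENNReal.ofReal (ρ ^ d) * ENNReal.ofReal X) ^ 2 := by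
      rw [ENNReal.ofReal_pow (by positivity), ENNReal.ofReal_mul (by positivity), two_mul, pow_add,
        ENNReal.ofReal_mul (by positivity)]
      ring
    rw [e]
    calc _ ≤ ENNReal.ofReal (ρ ^ d) ^ 2 * (K * A ^ 2) := by gcongr
      _ = K * (ENNReal.ofReal (ρ ^ d) * A) ^ 2 := by ring
      _ ≤ K * (C₂ : ℝ≥0∞) ^ 2 := by gcongr
      _ = _ := by push_cast; ring
  rw [← ENNReal.ofReal_coe_nnreal, ENNReal.ofReal_le_ofReal_iff (NNReal.coe_nonneg _)] at hfin
  have hle : ρ ^ (2 * d) * X ≤ (K * C₂ ^ 2 + 1 : ℝ≥0) := by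
    have h0 : (0 : ℝ) ≤ (K * C₂ ^ 2 : ℝ≥0) := NNReal.coe_nonneg _
    rw [NNReal.coe_add, NNReal.coe_one]
    nlinarith [sq_nonneg (ρ ^ (2 * d) * X - 1)]
  rw [le_div_iff₀ (by positivity), pow_succ]
  calc X * (ρ ^ (2 * d) * ρ) = X * ρ ^ (2 * d) * ρ := by ring
    _ ≤ X * ρ ^ (2 * d) * 1 := by gcongr
    _ ≤ _ := by rw [mul_one, mul_comm]; exact hle

theorem isTestFunction_contDiffBump {U : Set (CSpace n)} {p : CSpace n} (b : ContDiffBump p)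
    (h : Metric.closedBall p b.rOut ⊆ U) : IsTestFunction U b :=
  ⟨b.contDiff, b.hasCompactSupport, by rwa [b.tsupport_eq]⟩

theorem cutoffPrec_contDiffBump {p : CSpace n} (b b' : ContDiffBump p) (h : b.rOut ≤ b'.rIn) :
    CutoffPrec b b' := fun x hx => by
  rw [b.tsupport_eq] at hx
  exact b'.one_of_mem_closedBall (Metric.closedBall_subset_closedBall h hx)

/-- Under local Condition R, the Bergman projection of a smooth function supported away from a
cutoff is estimated there by the `L²` norm alone. -/
theorem LocalConditionR.exists_sobolevNormSq_le {z₀ : CSpace n} {U : Set (CSpace n)}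
    (hR : LocalConditionR Ω z₀ U) (k : ℕ) {p : CSpace n} {R : ℝ} (hR0 : 0 < R)
    (hU : Metric.closedBall p (5 * R) ⊆ U) (b : ContDiffBump p) (hb : b.rOut ≤ 3 * R) :
    ∃ c : ℝ≥0, ∀ (φ : CSpace n → ℂ) (u : Lp ℂ 2 (volume.restrict (Ω : Set (CSpace n)))),
      IsTestFunction univ φ → (∀ x, dist x p < 4 * R → φ x = 0) →
      u =ᵐ[volume.restrict (Ω : Set (CSpace n))] φ →
      sobolevNormSq Ω k (fun x => (b x : ℂ) * bergmanProjection Ω u x) ≤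
        c * eLpNorm u 2 (volume.restrict (Ω : Set (CSpace n))) ^ 2 := by
  obtain ⟨-, -, hest⟩ := hR
  -- b₂ vanishes outside the ball of radius 4 R, and φ vanishes inside it; so the term with k + M
  -- derivatives is zero, whatever M is.
  let b₂ : ContDiffBump p := ⟨3 * R, 4 * R, by positivity, by linarith⟩
  let b₃ : ContDiffBump p := ⟨4 * R, 5 * R, by positivity, by linarith⟩
  have htest : ∀ b : ContDiffBump p, b.rOut ≤ 5 * R → IsTestFunction U b := fun b hb =>
    isTestFunction_contDiffBump b ((Metric.closedBall_subset_closedBall hb).trans hU)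
  -- With m = 0 the dual norm of the projection is at most the L² norm of u.
  obtain ⟨M, hM⟩ := hest k 0
  obtain ⟨c, hc⟩ := hM b b₂ b₃ (htest b (by linarith)) (htest b₂ (by simp only [b₂]; linarith))
    (htest b₃ le_rfl) (cutoffPrec_contDiffBump b b₂ hb) (cutoffPrec_contDiffBump b₂ b₃ le_rfl)
  refine ⟨c * 2, fun φ u hφ hφ0 hu => ?_⟩
  have hest1 := hc u (hφ.memSobolev
    (ae_mono (Measure.restrict_mono inter_subset_right le_rfl) hu) _)
  have hzero : sobolevNormSq Ω (k + M) (fun x => (b₂ x : ℂ) * u x) = 0 := by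
    refine sobolevNormSq_eq_zero ?_ _
    filter_upwards [hu] with x hx
    rw [hx]
    by_cases hxp : dist x p < 4 * R
    · simp [hφ0 x hxp]
    · have : b₂ x = 0 := b₂.zero_of_le_dist (not_lt.1 hxp)
      simp [this]
  have hdual := sobolevDualNorm_zero_mul_bergmanProjection_le b₃.continuous
    (fun x => b₃.nonneg) (fun x => b₃.le_one) u
  rw [hzero, zero_add] at hest1
  refine hest1.trans ?_
  set A := eLpNorm u 2 (volume.restrict (Ω : Set (CSpace n)))
  calc (c : ℝ≥0∞) * (_ ^ 2 + A ^ 2) ≤ c * (A ^ 2 + A ^ 2) := by gcongr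
    _ = _ := by push_cast; ring

/-- Under local Condition R, the derivatives of the Bergman kernel in one variable grow, off the
diagonal, at most like a fixed power of the distance to the boundary. -/
theorem LocalConditionR.exists_norm_dirDeriv_le (hΩ : Bornology.IsBounded (Ω : Set (CSpace n)))
    {z₀ : CSpace n} {U : Set (CSpace n)} (hR : LocalConditionR Ω z₀ U) {p q : CSpace n} (hp : p ∈ U)
    (hpq : p ≠ q) (a : Fin n × Fin 2) : ∃ R : ℝ, 0 < R ∧ R ≤ 1 ∧ ∀ k : ℕ, ∃ C : ℝ, 0 ≤ C ∧
      ∀ (z : CSpace n) (w : Ω) (ρ : ℝ), z ∈ Metric.ball p R → (w : CSpace n) ∈ Metric.ball q R →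
        0 < ρ → ρ ≤ R → Metric.ball z ρ ⊆ Ω → Metric.ball (w : CSpace n) ρ ⊆ Ω →
        ‖(dirDeriv (realDirection a))^[k] (holRep (bergmanKerFun w)) z‖ ≤
          C / ρ ^ (2 * Module.finrank ℝ (CSpace n) + 1) := by
  obtain ⟨ε, hε, hεU⟩ := Metric.isOpen_iff.1 hR.1 p hp
  have hpq0 : 0 < dist p q := dist_pos.2 hpq
  -- The bump lives within R / 2 of w, hence within 3 R / 2 of q; with 6 R ≤ dist p q it stays at
  -- distance more than 4 R from p.
  obtain ⟨R, hR0, hR1, hRε, hRq⟩ : ∃ R : ℝ, 0 < R ∧ R ≤ 1 ∧ 6 * R ≤ ε ∧ 6 * R ≤ dist p q := by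
    refine ⟨min 1 (min (ε / 6) (dist p q / 6)),
      lt_min one_pos (lt_min (by positivity) (by positivity)), min_le_left _ _, ?_, ?_⟩
    · have := (min_le_right 1 (min (ε / 6) (dist p q / 6))).trans (min_le_left _ _)
      linarith
    · have := (min_le_right 1 (min (ε / 6) (dist p q / 6))).trans (min_le_right _ _)
      linarith
  refine ⟨R, hR0, hR1, fun k => ?_⟩
  let b : ContDiffBump p := ⟨2 * R, 3 * R, by positivity, by linarith⟩
  obtain ⟨c, hc⟩ := hR.exists_sobolevNormSq_le k hR0
    ((Metric.closedBall_subset_ball (by linarith)).trans hεU) b le_rfl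
  obtain ⟨C₁, h₁⟩ := exists_enorm_dirDeriv_iterate_le n
  obtain ⟨C₂, h₂⟩ := exists_bergmanProjection_eq_kerFun hΩ
  refine ⟨(C₁ ^ 2 * c * C₂ ^ 2 + 1 : ℝ≥0), NNReal.coe_nonneg _, ?_⟩
  intro z w ρ hz hw hρ hρR hzΩ hwΩ
  obtain ⟨φ, u, hφ, hφ0, hu, hBu, hun⟩ := h₂ w ρ hρ hwΩ
  have hφp : ∀ x, dist x p < 4 * R → φ x = 0 := fun x hx => by
    refine hφ0 x fun h3 => ?_
    have h3 : dist x w < ρ / 2 := h3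
    have h4 : dist (w : CSpace n) q < R := hw
    have h5 := dist_triangle p x q
    have h6 := dist_triangle x w q
    rw [dist_comm p x] at h5
    linarith
  have hest := hc φ u hφ hφp hu
  have hBh : bergmanProjection Ω u =ᵐ[volume.restrict (Ω : Set (CSpace n))]
      holRep (bergmanKerFun w) := by
    rw [hBu]; exact holRep_ae _
  have hW : IsOpen ((Ω : Set (CSpace n)) ∩ Metric.ball p (2 * R)) :=
    Ω.isOpen.inter Metric.isOpen_ball
  have hzW : Metric.ball z ρ ⊆ (Ω : Set (CSpace n)) ∩ Metric.ball p (2 * R) := by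
    refine subset_inter hzΩ (Metric.ball_subset_ball' ?_)
    have : dist z p < R := hz
    linarith
  have hlow := h₁ Ω _ (fun x => (b x : ℂ) * bergmanProjection Ω u x) (holRep (bergmanKerFun w)) a k z
    ρ Ω.isOpen hW inter_subset_left ((holRep_diff _).mono inter_subset_left) (by
      filter_upwards [ae_mono (Measure.restrict_mono inter_subset_left le_rfl) hBh,
        ae_restrict_mem hW.measurableSet] with x hx hxW
      rw [hx, b.one_of_mem_closedBall (Metric.ball_subset_closedBall hxW.2)]
      simp) hρ (hρR.trans hR1) hzW
  rw [← ofReal_norm] at hlow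
  refine le_div_pow_of_ofReal_mul_le hρ (hρR.trans hR1) (norm_nonneg _) hun (hlow.trans ?_)
  calc _ ≤ (C₁ : ℝ≥0∞) ^ 2 * (c * eLpNorm u 2 (volume.restrict (Ω : Set (CSpace n))) ^ 2) := by
        gcongr
    _ = _ := by push_cast; ring

end BergmanKernel

/-! ### Holomorphy of the conjugated kernel and its growth in each variable. -/

theorem norm_iteratedDeriv_conj_comp (g : ℝ → ℂ) (k : ℕ) (t : ℝ) :
    ‖iteratedDeriv k (fun s => conj (g s)) t‖ = ‖iteratedDeriv k g t‖ := by
  rw [← norm_iteratedFDeriv_eq_norm_iteratedDeriv, ← norm_iteratedFDeriv_eq_norm_iteratedDeriv]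
  exact Complex.conjLIE.norm_iteratedFDeriv_comp_left g t k

theorem norm_iteratedDeriv_line_smul {E F : Type*} [NormedAddCommGroup E] [NormedSpace ℝ E]
    [NormedAddCommGroup F] [NormedSpace ℝ F] (g : E → F) (x e : E) {σ : ℝ} (hσ : |σ| = 1) (k : ℕ) :
    ‖iteratedDeriv k (fun t : ℝ => g (x + t • σ • e)) 0‖ =
      ‖iteratedDeriv k (fun t : ℝ => g (x + t • e)) 0‖ := by
  rcases (abs_eq zero_le_one).1 hσ with rfl | rfl
  · simp
  · have := iteratedDeriv_comp_neg k (fun t : ℝ => g (x + t • e)) 0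
    simp only [neg_smul, one_smul, smul_neg] at this ⊢
    rw [this, norm_smul]
    simp

theorem HasDirectionalGrowth.mono {E : Type} [NormedAddCommGroup E] [NormedSpace ℝ E] {f : E → ℂ}
    {D : Set E} {x₀ e : E} {r r' : ℝ} {N : ℕ} (h : HasDirectionalGrowth f D x₀ e r N)
    (hr : r' ≤ r) : HasDirectionalGrowth f D x₀ e r' N := fun k => by
  obtain ⟨C, hC, h⟩ := h k
  exact ⟨C, hC, fun x hx ρ hρ hρr hb => h x (Metric.ball_subset_ball hr hx) ρ hρ (hρr.trans hr) hb⟩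

theorem ball_subset_of_ball_prod_subset {E₁ E₂ : Type*} [PseudoMetricSpace E₁]
    [PseudoMetricSpace E₂] {A : Set E₁} {B : Set E₂} {x : E₁} {y : E₂} {ρ : ℝ} (hρ : 0 < ρ)
    (h : Metric.ball (x, y) ρ ⊆ A ×ˢ B) : Metric.ball x ρ ⊆ A ∧ Metric.ball y ρ ⊆ B := by
  rw [← ball_prod_same] at h
  exact ⟨fun a ha => (@h (a, y) ⟨ha, Metric.mem_ball_self hρ⟩).1,
    fun b hb => (@h (x, b) ⟨Metric.mem_ball_self hρ, hb⟩).2⟩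

section BergmanKernelConj

variable {n : ℕ} {Ω : TopologicalSpace.Opens (CSpace n)}

theorem ball_conjSpace_subset {A : Set (CSpace n)} {w : CSpace n} {ρ : ℝ}
    (h : Metric.ball w ρ ⊆ conjSpace n ⁻¹' A) : Metric.ball (conjSpace n w) ρ ⊆ A := by
  intro x hx
  have := @h (conjSpace n x) (by
    rw [Metric.mem_ball, ← (conjSpace n).dist_map, conjSpace_conjSpace]; exact hx)
  simpa using this

variable (Ω) in
/-- The domain of the holomorphic function `(z, w) ↦ 𝓑(z, w̄)`. -/
def conjDomain : Set (CSpace n × CSpace n) :=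
  (Ω : Set (CSpace n)) ×ˢ (conjSpace n ⁻¹' (Ω : Set (CSpace n)))

theorem isOpen_conjDomain : IsOpen (conjDomain Ω) :=
  Ω.isOpen.prod (Ω.isOpen.preimage (conjSpace n).continuous)

open Classical in
variable (Ω) in
/-- The Bergman kernel with the second variable conjugated, extended by zero. -/
noncomputable def bergmanKernelConj (p : CSpace n × CSpace n) : ℂ :=
  if h : p.1 ∈ Ω ∧ conjSpace n p.2 ∈ Ω then bergmanKernel Ω ⟨p.1, h.1⟩ ⟨conjSpace n p.2, h.2⟩
  else 0

theorem bergmanKernelConj_eq {z w : CSpace n} (hz : z ∈ Ω) (hw : conjSpace n w ∈ Ω) :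
    bergmanKernelConj Ω (z, w) = bergmanKernel Ω ⟨z, hz⟩ ⟨conjSpace n w, hw⟩ :=
  dif_pos ⟨hz, hw⟩

theorem bergmanKernelConj_eq_fst {z w : CSpace n} (hz : z ∈ Ω) (hw : conjSpace n w ∈ Ω) :
    bergmanKernelConj Ω (z, w) = holRep (bergmanKerFun ⟨conjSpace n w, hw⟩) z := by
  rw [bergmanKernelConj_eq hz hw, bergmanKernel_eq_holRep]

theorem bergmanKernelConj_eq_snd {z w : CSpace n} (hz : z ∈ Ω) (hw : conjSpace n w ∈ Ω) :
    bergmanKernelConj Ω (z, w) = conj (holRep (bergmanKerFun ⟨z, hz⟩) (conjSpace n w)) := by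
  rw [bergmanKernelConj_eq hz hw, ← conj_bergmanKernel, bergmanKernel_eq_holRep]

/-- Osgood's lemma: the local bound comes from the reproducing property, and holomorphy in the
second variable from Hermitian symmetry. -/
theorem differentiableOn_bergmanKernelConj :
    DifferentiableOn ℂ (bergmanKernelConj Ω) (conjDomain Ω) := by
  rintro ⟨z, w⟩ hp
  obtain ⟨r, hr, hball⟩ := Metric.isOpen_iff.1 isOpen_conjDomain _ hp
  have hr2 : 0 < r / 2 := half_pos hr
  obtain ⟨C, hC⟩ := exists_norm_bergmanKernel_le (Ω := Ω) hr2
  obtain ⟨hz, hw⟩ := ball_subset_of_ball_prod_subset hr hball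
  have hz' : ∀ x ∈ Metric.ball z (r / 2), Metric.ball x (r / 2) ⊆ Ω := fun x hx =>
    (Metric.ball_subset_ball' (by linarith [Metric.mem_ball.1 hx])).trans hz
  have hw' : ∀ y ∈ Metric.ball w (r / 2), Metric.ball (conjSpace n y) (r / 2) ⊆ Ω := fun y hy =>
    ball_conjSpace_subset ((Metric.ball_subset_ball' (by linarith [Metric.mem_ball.1 hy])).trans hw)
  have hzm : ∀ x ∈ Metric.ball z (r / 2), x ∈ Ω := fun x hx => hz' x hx (Metric.mem_ball_self hr2)
  have hwm : ∀ y ∈ Metric.ball w (r / 2), conjSpace n y ∈ Ω := fun y hy =>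
    hw' y hy (Metric.mem_ball_self hr2)
  refine (differentiableAt_of_separately hr2 (M := C) ?_ ?_ ?_).differentiableWithinAt
  · intro y hy
    exact ((holRep_diff _).mono hzm).congr fun x hx =>
      bergmanKernelConj_eq_fst (hzm x hx) (hwm y hy)
  · intro x hx y hy
    refine DifferentiableWithinAt.congr (f := fun y =>
      conj (holRep (bergmanKerFun ⟨x, hzm x hx⟩) (conjSpace n y))) ?_ (fun y hy =>
      bergmanKernelConj_eq_snd (hzm x hx) (hwm y hy))
      (bergmanKernelConj_eq_snd (hzm x hx) (hwm y hy))
    exact (DifferentiableAt.conj_conjSpace ((holRep_diff _).differentiableAt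
      (Ω.isOpen.mem_nhds (hwm y hy)))).differentiableWithinAt
  · intro x hx y hy
    rw [bergmanKernelConj_eq (hzm x hx) (hwm y hy)]
    exact hC _ _ (hz' x hx) (hw' y hy)

theorem LocalConditionR.exists_norm_iteratedDeriv_le
    (hΩ : Bornology.IsBounded (Ω : Set (CSpace n)))
    {z₀ : CSpace n} {U : Set (CSpace n)} (hR : LocalConditionR Ω z₀ U) {p q : CSpace n} (hp : p ∈ U)
    (hpq : p ≠ q) (a : Fin n × Fin 2) {σ : ℝ} (hσ : |σ| = 1) :
    ∃ R : ℝ, 0 < R ∧ R ≤ 1 ∧ ∀ k : ℕ, ∃ C : ℝ, 0 ≤ C ∧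
      ∀ (z : CSpace n) (w : Ω) (ρ : ℝ), z ∈ Metric.ball p R → (w : CSpace n) ∈ Metric.ball q R →
        0 < ρ → ρ ≤ R → Metric.ball z ρ ⊆ Ω → Metric.ball (w : CSpace n) ρ ⊆ Ω →
        ‖iteratedDeriv k (fun t : ℝ => holRep (bergmanKerFun w) (z + t • σ • realDirection a)) 0‖ ≤
          C / ρ ^ (2 * Module.finrank ℝ (CSpace n) + 1) := by
  obtain ⟨R, hR0, hR1, h⟩ := hR.exists_norm_dirDeriv_le hΩ hp hpq a
  refine ⟨R, hR0, hR1, fun k => ?_⟩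
  obtain ⟨C, hC, h⟩ := h k
  refine ⟨C, hC, fun z w ρ hz hw hρ hρR hzΩ hwΩ => ?_⟩
  have hzm : z ∈ (Ω : Set (CSpace n)) := hzΩ (Metric.mem_ball_self hρ)
  rw [norm_iteratedDeriv_line_smul _ _ _ hσ, iteratedDeriv_line_eq Ω.isOpen
    ((contDiffOn_of_holomorphic Ω.isOpen (holRep_diff _)).restrict_scalars ℝ) z _ k (by simpa),
    zero_smul, add_zero]
  exact h z w ρ hz hw hρ hρR hzΩ hwΩ

theorem LocalConditionR.exists_hasDirectionalGrowth_fst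
    (hΩ : Bornology.IsBounded (Ω : Set (CSpace n)))
    {z₀ : CSpace n} {U : Set (CSpace n)} (hR : LocalConditionR Ω z₀ U) {p q : CSpace n} (hp : p ∈ U)
    (hpq : p ≠ q) (a : Fin n × Fin 2) {σ : ℝ} (hσ : |σ| = 1) :
    ∃ R : ℝ, 0 < R ∧ HasDirectionalGrowth (bergmanKernelConj Ω) (conjDomain Ω) (p, conjSpace n q)
      (σ • realDirection a, 0) R (2 * Module.finrank ℝ (CSpace n) + 1) := by
  obtain ⟨R, hR0, hR1, h⟩ := hR.exists_norm_iteratedDeriv_le hΩ hp hpq a hσ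
  refine ⟨R, hR0, fun k => ?_⟩
  obtain ⟨C, hC, h⟩ := h k
  refine ⟨C, hC, ?_⟩
  rintro ⟨z, w⟩ hx ρ hρ hρR hball
  obtain ⟨hz, hw⟩ := ball_subset_of_ball_prod_subset hρ hball
  replace hw := ball_conjSpace_subset hw
  have hwm : conjSpace n w ∈ Ω := hw (Metric.mem_ball_self hρ)
  have hzm : z ∈ (Ω : Set (CSpace n)) := hz (Metric.mem_ball_self hρ)
  rw [← ball_prod_same] at hx
  have hev : (fun t : ℝ => bergmanKernelConj Ω ((z, w) + t • (σ • realDirection a, 0))) =ᶠ[𝓝 0]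
      fun t : ℝ => holRep (bergmanKerFun ⟨conjSpace n w, hwm⟩) (z + t • σ • realDirection a) := by
    have hc : ContinuousAt (fun t : ℝ => z + t • σ • realDirection a) 0 := by fun_prop
    filter_upwards [hc.preimage_mem_nhds (Ω.isOpen.mem_nhds (by simpa using hzm))] with t ht
    rw [Prod.smul_mk, Prod.mk_add_mk, smul_zero, add_zero]
    exact bergmanKernelConj_eq_fst ht hwm
  rw [hev.iteratedDeriv_eq]
  refine h z ⟨_, hwm⟩ ρ hx.1 ?_ hρ hρR hz hw
  have := hx.2
  rw [Metric.mem_ball, ← (conjSpace n).dist_map, conjSpace_conjSpace] at this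
  exact this

/-- By Hermitian symmetry this is the bound in the first variable with p and q exchanged;
conjugating the values does not change the norm of a real derivative. -/
theorem LocalConditionR.exists_hasDirectionalGrowth_snd
    (hΩ : Bornology.IsBounded (Ω : Set (CSpace n)))
    {z₀ : CSpace n} {U : Set (CSpace n)} (hR : LocalConditionR Ω z₀ U) {p q : CSpace n} (hq : q ∈ U)
    (hpq : p ≠ q) (a : Fin n × Fin 2) {σ : ℝ} (hσ : |σ| = 1) :
    ∃ R : ℝ, 0 < R ∧ HasDirectionalGrowth (bergmanKernelConj Ω) (conjDomain Ω) (p, conjSpace n q)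
      (0, conjSpace n (σ • realDirection a)) R (2 * Module.finrank ℝ (CSpace n) + 1) := by
  obtain ⟨R, hR0, hR1, h⟩ := hR.exists_norm_iteratedDeriv_le hΩ hq hpq.symm a hσ
  refine ⟨R, hR0, fun k => ?_⟩
  obtain ⟨C, hC, h⟩ := h k
  refine ⟨C, hC, ?_⟩
  rintro ⟨z, w⟩ hx ρ hρ hρR hball
  obtain ⟨hz, hw⟩ := ball_subset_of_ball_prod_subset hρ hball
  replace hw := ball_conjSpace_subset hw
  have hwm : conjSpace n w ∈ Ω := hw (Metric.mem_ball_self hρ)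
  have hzm : z ∈ Ω := hz (Metric.mem_ball_self hρ)
  rw [← ball_prod_same] at hx
  have hev : (fun t : ℝ => bergmanKernelConj Ω
      ((z, w) + t • (0, conjSpace n (σ • realDirection a)))) =ᶠ[𝓝 0]
      fun t : ℝ => conj (holRep (bergmanKerFun ⟨z, hzm⟩)
        (conjSpace n w + t • σ • realDirection a)) := by
    have hc : ContinuousAt (fun t : ℝ => conjSpace n w + t • σ • realDirection a) 0 := by fun_prop
    filter_upwards [hc.preimage_mem_nhds (Ω.isOpen.mem_nhds (by simpa using hwm))] with t ht
    have e : conjSpace n (w + t • conjSpace n (σ • realDirection a)) =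
        conjSpace n w + t • σ • realDirection a := by
      rw [map_add, (conjSpace n).map_smul, conjSpace_conjSpace]
    rw [Prod.smul_mk, Prod.mk_add_mk, smul_zero, add_zero, bergmanKernelConj_eq_snd hzm (by
      rw [e]; exact ht), e]
  rw [hev.iteratedDeriv_eq, norm_iteratedDeriv_conj_comp]
  refine h _ ⟨z, hzm⟩ ρ ?_ hx.1 hρ hρR hw hz
  have := hx.2
  rw [Metric.mem_ball, ← (conjSpace n).dist_map, conjSpace_conjSpace] at this
  exact this

end BergmanKernelConj

/-! ### Smoothness of the kernel up to the boundary and uniform bounds. -/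

section Extension

variable {n : ℕ} {Ω : TopologicalSpace.Opens (CSpace n)}

theorem contDiffOn_bergmanKernelConj :
    ContDiffOn ℂ ∞ (bergmanKernelConj Ω) (conjDomain Ω) :=
  contDiffOn_of_holomorphic isOpen_conjDomain differentiableOn_bergmanKernelConj

theorem mem_closure_conjDomain {p q : CSpace n} (hp : p ∈ closure (Ω : Set (CSpace n)))
    (hq : q ∈ closure (Ω : Set (CSpace n))) : (p, conjSpace n q) ∈ closure (conjDomain Ω) := by
  rw [conjDomain, closure_prod_eq]
  refine ⟨hp, ?_⟩
  have : closure (conjSpace n ⁻¹' (Ω : Set (CSpace n))) = conjSpace n ⁻¹' closure Ω :=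
    ((conjSpace n).toHomeomorph.preimage_closure _).symm
  rw [this]
  simpa using hq

/-- Under local Condition R, the kernel with the second variable conjugated is smooth up to the
boundary off the diagonal. -/
theorem LocalConditionR.contDiffWithinAt_extendFrom
    (hΩ : IsSmoothBoundedPseudoconvex (Ω : Set (CSpace n)))
    {z₀ : CSpace n} (hz₀ : z₀ ∈ frontier (Ω : Set (CSpace n))) {U : Set (CSpace n)}
    (hR : LocalConditionR Ω z₀ U) {p q : CSpace n} (hp : p ∈ closure (Ω : Set (CSpace n)))
    (hq : q ∈ closure (Ω : Set (CSpace n))) (hpU : p ∈ U) (hqU : q ∈ U) (hpq : p ≠ q) (m : ℕ) :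
    ContDiffWithinAt ℝ m (extendFrom (conjDomain Ω) (bergmanKernelConj Ω))
      (closure (conjDomain Ω)) (p, conjSpace n q) := by
  obtain ⟨ψ, hψ, -⟩ := hΩ.pseudoconvex
  obtain ⟨a, σ, η₁, r₁, hσ, hη₁, hη₁', hr₁, hr₁', hc₁⟩ :=
    hψ.exists_hasInteriorCones_of_mem_closure Ω.isOpen ⟨z₀, hz₀⟩ hp
  obtain ⟨b, τ, η₂, r₂, hτ, hη₂, -, hr₂, -, hc₂⟩ :=
    hψ.exists_hasInteriorCones_of_mem_closure Ω.isOpen ⟨z₀, hz₀⟩ hq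
  obtain ⟨R₁, hR₁, hg₁⟩ := hR.exists_hasDirectionalGrowth_fst hΩ.isBounded hpU hpq a hσ
  obtain ⟨R₂, hR₂, hg₂⟩ := hR.exists_hasDirectionalGrowth_snd hΩ.isBounded hqU hpq b hτ
  replace hc₂ := hc₂.preimage (conjSpace n)
  rw [conjSpace_symm] at hc₂
  obtain ⟨r, hr, hrr₁, hrr₂, hrR₁, hrR₂⟩ :
      ∃ r : ℝ, 0 < r ∧ r ≤ r₁ / 2 ∧ r ≤ r₂ / 2 ∧ r ≤ R₁ ∧ r ≤ R₂ :=
    ⟨min (min (r₁ / 2) (r₂ / 2)) (min R₁ R₂), by positivity,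
      (min_le_left _ _).trans (min_le_left _ _), (min_le_left _ _).trans (min_le_right _ _),
      (min_le_right _ _).trans (min_le_left _ _), (min_le_right _ _).trans (min_le_right _ _)⟩
  obtain ⟨η, hη, hηη₁, hηη₂⟩ : ∃ η : ℝ, 0 < η ∧ η ≤ η₁ ∧ η ≤ η₂ :=
    ⟨min η₁ η₂, by positivity, min_le_left _ _, min_le_right _ _⟩
  -- The radius is 2 r because `HasInteriorCones.translatesInto` halves it.
  have hd₁ := hc₁.mono hηη₁ (show 2 * r ≤ r₁ by linarith)
  have hd₂ := hc₂.mono hηη₂ (show 2 * r ≤ r₂ by linarith)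
  have ht₁ := (hd₁.translatesInto hη).prod_fst (conjSpace n ⁻¹' Ω) (conjSpace n q)
  have ht₂ := (hd₂.translatesInto hη).prod_snd (Ω : Set (CSpace n)) p
  rw [mul_div_cancel_left₀ r two_ne_zero] at ht₁ ht₂
  obtain ⟨r', hr', hbd⟩ := exists_norm_iteratedFDeriv_le_of_growth isOpen_conjDomain
    differentiableOn_bergmanKernelConj (Nat.le_add_left 1 _) hr (by linarith) hη (by linarith)
    (hg₁.mono hrR₁) (hg₂.mono hrR₂) ht₁ ht₂
    ((hd₁.mono le_rfl (by linarith : r ≤ 2 * r)).movesInside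
      (hd₂.mono le_rfl (by linarith : r ≤ 2 * r)) hη.le)
  have hcone : HasInteriorCones (conjDomain Ω) (p, conjSpace n q)
      (σ • realDirection a, conjSpace n (τ • realDirection b)) η (min r r') :=
    (hd₁.prod hd₂).mono le_rfl ((min_le_left _ _).trans (by linarith))
  refine hcone.contDiffWithinAt_extendFrom isOpen_conjDomain hη (lt_min hr hr')
    (mem_closure_conjDomain hp hq) m (contDiffOn_bergmanKernelConj.restrict_scalars ℝ) fun l => ?_
  obtain ⟨C, hC⟩ := hbd l
  refine ⟨C, fun x hx hxD => ?_⟩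
  have hcd : ContDiffAt ℂ l (bergmanKernelConj Ω) x :=
    (contDiffOn_bergmanKernelConj.contDiffAt (isOpen_conjDomain.mem_nhds hxD)).of_le
      (by exact_mod_cast le_top)
  -- The bounds are for complex derivatives and the extension is over ℝ; restricting scalars
  -- preserves the norm.
  rw [← hcd.restrictScalars_iteratedFDeriv (𝕜 := ℝ), Function.comp_apply,
    ContinuousMultilinearMap.norm_restrictScalars]
  exact hC x (Metric.ball_subset_ball (min_le_right _ _) hx) hxD

theorem extendFrom_bergmanKernelConj {x : CSpace n × CSpace n} (hx : x ∈ conjDomain Ω) :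
    extendFrom (conjDomain Ω) (bergmanKernelConj Ω) x = bergmanKernelConj Ω x :=
  extendFrom_extends contDiffOn_bergmanKernelConj.continuousOn x hx

variable (Ω) in
/-- The extension of the Bergman kernel to the boundary by limits. -/
noncomputable def bergmanKernelExt (x : CSpace n × CSpace n) : ℂ :=
  extendFrom (conjDomain Ω) (bergmanKernelConj Ω) (x.1, conjSpace n x.2)

theorem bergmanKernelExt_eq (z w : Ω) :
    bergmanKernelExt Ω ((z : CSpace n), (w : CSpace n)) = bergmanKernel Ω z w := by
  have hw : conjSpace n (conjSpace n (w : CSpace n)) ∈ Ω := by simp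
  have : ((z : CSpace n), conjSpace n (w : CSpace n)) ∈ conjDomain Ω := ⟨z.2, hw⟩
  rw [bergmanKernelExt, extendFrom_bergmanKernelConj this, bergmanKernelConj_eq z.2 hw]
  congr
  simp

theorem LocalConditionR.contDiffOn_bergmanKernelExt
    (hΩ : IsSmoothBoundedPseudoconvex (Ω : Set (CSpace n)))
    {z₀ : CSpace n} (hz₀ : z₀ ∈ frontier (Ω : Set (CSpace n))) {U : Set (CSpace n)}
    (hR : LocalConditionR Ω z₀ U) :
    ContDiffOn ℝ ∞ (bergmanKernelExt Ω) (offBoundaryDiagonal (Ω : Set (CSpace n)) U) := by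
  rintro ⟨p, q⟩ ⟨⟨⟨hp, hpU⟩, hq, hqU⟩, hpq⟩
  have hmap : MapsTo (fun x : CSpace n × CSpace n => (x.1, conjSpace n x.2))
      (offBoundaryDiagonal (Ω : Set (CSpace n)) U) (closure (conjDomain Ω)) :=
    fun x hx => mem_closure_conjDomain hx.1.1.1 hx.1.2.1
  have hsm : ContDiff ℝ ∞ (fun x : CSpace n × CSpace n => (x.1, conjSpace n x.2)) :=
    contDiff_fst.prodMk ((conjSpace n).contDiff.comp contDiff_snd)
  refine ContDiffWithinAt.comp (p, q) (t := closure (conjDomain Ω)) ?_ hsm.contDiffWithinAt hmap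
  rw [contDiffWithinAt_infty]
  intro m
  -- A diagonal point of the set is interior; there the conjugated kernel is holomorphic and
  -- Condition R is not needed.
  by_cases h : p = q
  · subst h
    have hpΩ : p ∈ (Ω : Set (CSpace n)) := by
      by_contra hn
      exact hpq ⟨rfl, ⟨hp, by rwa [Ω.isOpen.interior_eq]⟩, hpU⟩
    have hD : ((p, p).1, conjSpace n (p, p).2) ∈ conjDomain Ω := ⟨hpΩ, by simpa using hpΩ⟩
    refine ContDiffAt.contDiffWithinAt ?_
    refine ContDiffAt.congr_of_eventuallyEq (f := bergmanKernelConj Ω) ?_ ?_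
    · exact ((contDiffOn_bergmanKernelConj.restrict_scalars ℝ).contDiffAt
        (isOpen_conjDomain.mem_nhds hD)).of_le (by exact_mod_cast le_top)
    · filter_upwards [isOpen_conjDomain.mem_nhds hD] with x hx
      exact extendFrom_bergmanKernelConj hx
  · exact hR.contDiffWithinAt_extendFrom hΩ hz₀ hp hq hpU hqU h m

/-- Makes `fderivWithin` preserve smoothness, so that Wirtinger derivatives can be iterated. The
subset (Ω ∩ U) × (Ω ∩ U) already has enough tangent vectors at each point. -/
theorem uniqueDiffOn_offBoundaryDiagonal
    (hΩ : IsSmoothBoundedPseudoconvex (Ω : Set (CSpace n)))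
    (hne : (frontier (Ω : Set (CSpace n))).Nonempty) {U : Set (CSpace n)} (hU : IsOpen U) :
    UniqueDiffOn ℝ (offBoundaryDiagonal (Ω : Set (CSpace n)) U) := by
  obtain ⟨ψ, hψ, -⟩ := hΩ.pseudoconvex
  have huniq : ∀ p ∈ closure (Ω : Set (CSpace n)), UniqueDiffWithinAt ℝ (Ω : Set (CSpace n)) p := by
    intro p hp
    obtain ⟨a, σ, η, r, -, hη, -, hr, -, hc⟩ :=
      hψ.exists_hasInteriorCones_of_mem_closure Ω.isOpen hne hp
    exact hc.uniqueDiffWithinAt hη hr hp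
  rintro ⟨p, q⟩ ⟨⟨⟨hp, hpU⟩, hq, hqU⟩, -⟩
  refine (((huniq p hp).inter (hU.mem_nhds hpU)).prod
    ((huniq q hq).inter (hU.mem_nhds hqU))).mono ?_
  rintro ⟨x, y⟩ ⟨⟨hx, hxU⟩, hy, hyU⟩
  refine ⟨⟨⟨subset_closure hx, hxU⟩, subset_closure hy, hyU⟩, ?_⟩
  rintro ⟨-, hfr, -⟩
  rw [Ω.isOpen.frontier_eq] at hfr
  exact hfr.2 hx

theorem contDiffOn_iterate_of_preserves {E F : Type*} [NormedAddCommGroup E] [NormedSpace ℝ E]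
    [NormedAddCommGroup F] [NormedSpace ℝ F] {S : Set E} {T : (E → F) → E → F}
    (hT : ∀ G, ContDiffOn ℝ ∞ G S → ContDiffOn ℝ ∞ (T G) S) {G : E → F}
    (hG : ContDiffOn ℝ ∞ G S) (k : ℕ) : ContDiffOn ℝ ∞ (T^[k] G) S := by
  induction k with
  | zero => exact hG
  | succ k ih => rw [Function.iterate_succ_apply']; exact hT _ ih

theorem contDiffOn_fderivWithin_const_apply {E F : Type*} [NormedAddCommGroup E] [NormedSpace ℝ E]
    [NormedAddCommGroup F] [NormedSpace ℝ F] {S : Set E} (hS : UniqueDiffOn ℝ S) {G : E → F}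
    (hG : ContDiffOn ℝ ∞ G S) (v : E) : ContDiffOn ℝ ∞ (fun x => fderivWithin ℝ G S x v) S :=
  (hG.fderivWithin hS (by simp)).clm_apply contDiffOn_const

theorem contDiffOn_mixedWirtinger {S : Set (CSpace n × CSpace n)} (hS : UniqueDiffOn ℝ S)
    {F : CSpace n × CSpace n → ℂ} (hF : ContDiffOn ℝ ∞ F S) (α β : Fin n → ℕ) :
    ContDiffOn ℝ ∞ (mixedWirtinger S α β F) S := by
  have h₁ : ∀ j G, ContDiffOn ℝ ∞ G S → ContDiffOn ℝ ∞ (wirtingerFst S j G) S := fun j G hG =>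
    contDiffOn_const.mul ((contDiffOn_fderivWithin_const_apply hS hG _).sub
      (contDiffOn_const.mul (contDiffOn_fderivWithin_const_apply hS hG _)))
  have h₂ : ∀ j G, ContDiffOn ℝ ∞ G S → ContDiffOn ℝ ∞ (wirtingerBarSnd S j G) S := fun j G hG =>
    contDiffOn_const.mul ((contDiffOn_fderivWithin_const_apply hS hG _).add
      (contDiffOn_const.mul (contDiffOn_fderivWithin_const_apply hS hG _)))
  have hfold : ∀ (T : Fin n → (CSpace n × CSpace n → ℂ) → CSpace n × CSpace n → ℂ) (γ : Fin n → ℕ)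
      (l : List (Fin n)) (G : CSpace n × CSpace n → ℂ),
      (∀ j G, ContDiffOn ℝ ∞ G S → ContDiffOn ℝ ∞ (T j G) S) → ContDiffOn ℝ ∞ G S →
      ContDiffOn ℝ ∞ (l.foldr (fun j G => (T j)^[γ j] G) G) S := by
    intro T γ l G hT hG
    induction l with
    | nil => exact hG
    | cons j l ih =>
      rw [List.foldr_cons]
      exact contDiffOn_iterate_of_preserves (hT j) ih _
  exact hfold _ α _ _ h₁ (hfold _ β _ _ h₂ hF)

/-- The absolute value removes the sign, so only the distance to the boundary is involved. -/
theorem continuous_isotropicDist (Ω : Set (CSpace n)) :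
    Continuous fun p : CSpace n × CSpace n => isotropicDist Ω p.1 p.2 := by
  have h : ∀ z, |signedBoundaryDist Ω z| = Metric.infDist z (frontier Ω) := fun z => by
    unfold signedBoundaryDist
    split_ifs <;> simp [abs_of_nonneg Metric.infDist_nonneg]
  simp only [isotropicDist, h]
  have hc := Metric.continuous_infDist_pt (frontier Ω)
  exact ((hc.comp continuous_fst).max (hc.comp continuous_snd)).max
    (continuous_fst.sub continuous_snd).norm

theorem isotropicDist_self_of_mem_frontier {Ω : Set (CSpace n)} {z : CSpace n}
    (hz : z ∈ frontier Ω) : isotropicDist Ω z z = 0 := by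
  have : signedBoundaryDist Ω z = 0 := by
    unfold signedBoundaryDist
    simp [Metric.infDist_zero_of_mem hz]
  simp [isotropicDist, this]

/-- Continuous functions off the boundary diagonal are bounded where the isotropic distance is. -/
theorem exists_norm_le_of_le_isotropicDist {Ω U V : Set (CSpace n)}
    (hΩ : Bornology.IsBounded Ω) (hV : closure V ⊆ U) {ε : ℝ} (hε : 0 < ε)
    {G : CSpace n × CSpace n → ℂ} (hG : ContinuousOn G (offBoundaryDiagonal Ω U)) :
    ∃ c : ℝ, ∀ z ∈ closure Ω ∩ V, ∀ w ∈ closure Ω ∩ V, ε ≤ isotropicDist Ω z w →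
      ‖G (z, w)‖ ≤ c := by
  have hK : IsCompact (closure Ω ∩ closure V) :=
    hΩ.isCompact_closure.inter_right isClosed_closure
  -- This compact set misses the boundary diagonal, where the isotropic distance is 0 < ε.
  have hK2 : IsCompact (((closure Ω ∩ closure V) ×ˢ (closure Ω ∩ closure V)) ∩
      {p | ε ≤ isotropicDist Ω p.1 p.2}) :=
    (hK.prod hK).inter_right (isClosed_le continuous_const (continuous_isotropicDist Ω))
  obtain ⟨c, hc⟩ := hK2.exists_bound_of_continuousOn (hG.mono (by
    rintro ⟨z, w⟩ ⟨⟨⟨hz, hzV⟩, hw, hwV⟩, hzw⟩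
    refine ⟨⟨⟨hz, hV hzV⟩, hw, hV hwV⟩, ?_⟩
    rintro ⟨h, hfr, -⟩
    obtain rfl : z = w := h
    have hzw : ε ≤ isotropicDist Ω z z := hzw
    rw [isotropicDist_self_of_mem_frontier hfr] at hzw
    exact absurd hzw (not_le.2 hε)))
  exact ⟨c, fun z hz w hw h =>
    hc (z, w) ⟨⟨⟨hz.1, subset_closure hz.2⟩, hw.1, subset_closure hw.2⟩, h⟩⟩

end Extension

theorem theorem2p1 {n : ℕ} (Ω : TopologicalSpace.Opens (CSpace n))
    (hΩ : IsSmoothBoundedPseudoconvex (Ω : Set (CSpace n)))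
    (z₀ : CSpace n) (hz₀ : z₀ ∈ frontier (Ω : Set (CSpace n)))
    (U : Set (CSpace n)) (hR : LocalConditionR Ω z₀ U) :
    ∃ K : CSpace n × CSpace n → ℂ,
      (∀ z w : Ω, (z : CSpace n) ∈ U → (w : CSpace n) ∈ U →
        K ((z : CSpace n), (w : CSpace n)) = bergmanKernel Ω z w) ∧
      ContDiffOn ℝ ∞ K (offBoundaryDiagonal (Ω : Set (CSpace n)) U) ∧
      ∀ V : Set (CSpace n), IsOpen V → closure V ⊆ U →
        ∀ ε : ℝ, 0 < ε → ∀ α β : Fin n → ℕ, ∃ c : ℝ,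
          ∀ z ∈ closure (Ω : Set (CSpace n)) ∩ V, ∀ w ∈ closure (Ω : Set (CSpace n)) ∩ V,
            ε ≤ isotropicDist (Ω : Set (CSpace n)) z w →
              ‖mixedWirtinger (offBoundaryDiagonal (Ω : Set (CSpace n)) U) α β K (z, w)‖ ≤ c := by
  have hK := hR.contDiffOn_bergmanKernelExt hΩ hz₀
  refine ⟨bergmanKernelExt Ω, fun z w _ _ => bergmanKernelExt_eq z w, hK, ?_⟩
  intro V _ hVU ε hε α β
  exact exists_norm_le_of_le_isotropicDist hΩ.isBounded hVU hε
    (contDiffOn_mixedWirtinger (uniqueDiffOn_offBoundaryDiagonal hΩ ⟨z₀, hz₀⟩ hR.1) hK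
      α β).continuousOn
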